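/- **Setting.** Fix integers $m,k,r,h_0$. Along a sequence with $p,q,T\to\infty$ (and $T>h_0$), consider $p\times q$ observations $$Y_t=AX_t+RF_tC'+E_t,\qquad W_t=RF_tC'+E_t,$$ on probability spaces that may vary along the sequence, where $A\in\mathbb R^{p\times m}$, $R\in\mathbb R^{p\times k}$, $C\in\mathbb R^{q\times r}$ are deterministic, $X_t$ ($m\times q$) is observed, $F_t$ ($k\times r$) and $E_t$ ($p\times q$) are not, and the processes are indexed by $t\in\mathbb Z$. For $1\le t,s\le T$: $\mathrm{vec}(E_t)$ is white noise (mean zero, covariance matrix $\Sigma_e$ not depending on $t$, uncorrelated over time); $\mathbb E F_t=0$; $F_t$ and $E_s$ are uncorrelated for all $t,s$; $X_t$ is uncorrelated with $E_t$ and with $F_t$. Put $$\widehat A=\Big(\tfrac1T\sum_{t=1}^TY_tX_t'\Big)\Big(\tfrac1T\sum_{t=1}^TX_tX_t'\Big)^{-1},\qquad \widehat W_t=Y_t-\widehat AX_t$$ (the value of $\widehat A$ when the inverse does not exist is immaterial). With $w_{t,i},\hat w_{t,i}$ the $i$-th columns of $W_t,\widehat W_t$, let $$\Omega_{ij}(h)=\tfrac1{T-h}\sum_{t=1}^{T-h}\mathrm{Cov}(w_{t,i},w_{t+h,j}),\qquad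 \widehat\Omega_{ij}(h)=\tfrac1{T-h}\sum_{t=1}^{T-h}\hat w_{t,i}\hat w_{t+h,j}',$$ $$M_1=\sum_{h=1}^{h_0}\sum_{i,j=1}^q\Omega_{ij}(h)\Omega_{ij}(h)',\qquad \widehat M_1=\sum_{h=1}^{h_0}\sum_{i,j=1}^q\widehat\Omega_{ij}(h)\widehat\Omega_{ij}(h)',$$ and let $M_2,\widehat M_2$ be the $q\times q$ matrices obtained in the same way from $W_t',\widehat W_t'$. **Conditions.** All constants and the implied constants of $\asymp$ are uniform along the sequence. 1. The process $(\mathrm{vec}\,Y_t,\mathrm{vec}\,X_t,\mathrm{vec}\,F_t)_{t\in\mathbb Z}$ is $\alpha$-mixing, and for some $\gamma>2$ the sums $\sum_{l\ge1}\alpha(l)^{1-2/\gamma}$ are bounded along the sequence. 2. All entries of $F_t,X_t,E_t$, $1\le t\le T$, have absolute moments of order $2\gamma$ bounded by a constant. 3. Let $k^*=\max(k,r)$ and $\Sigma_f(h)=\frac1{T-h}\sum_{t=1}^{T-h}\mathrm{Cov}(\mathrm{vec}\,F_t,\mathrm{vec}\,F_{t+h})$. For some $h\in\{1,\dots,h_0\}$,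 $\Sigma_f(h)$ has rank at least $k^*$, $\|\Sigma_f(h)\|_2\asymp1\asymp\sigma_{k^*}(\Sigma_f(h))$, where $\sigma_{k^*}$ is the $k^*$-th largest singular value, and for every row $F_{t,i\cdot}$ and every column $F_{t,\cdot j}$ the matrices $\frac1{T-h}\sum_{t=1}^{T-h}\mathrm{Cov}(F_{t,i\cdot},F_{t+h,i\cdot})$ and $\frac1{T-h}\sum_{t=1}^{T-h}\mathrm{Cov}(F_{t,\cdot j},F_{t+h,\cdot j})$ are nonzero. 4. $P_t=\mathbb E(X_tX_t')$ is positive definite for $1\le t\le T$, and there are positive definite matrices $P$ (which may vary along the sequence) with $q^{-1}\big(\frac1T\sum_{t=1}^TP_t-P\big)\to0$ and $\lambda_{\min}(P)\asymp q$. 5. The entries of $\Sigma_e$ are bounded by a constant. 6. $\|R\|_2^2\asymp p^{1-\delta_1}\asymp\|R\|_{\min}^2$ and $\|C\|_2^2\asymp q^{1-\delta_2}\asymp\|C\|_{\min}^2$ for constants $\delta_1,\delta_2\in[0,1]$, where $\|\cdot\|_2$ is the largest and $\|\cdot\|_{\min}$ the smallest nonzero singular value. 7. $M_1$ has $k$ and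 $M_2$ has $r$ distinct positive eigenvalues, $\lambda_{1,1}>\dots>\lambda_{1,k}>0$ and $\lambda_{2,1}>\dots>\lambda_{2,r}>0$, which are their $k$ (resp. $r$) largest eigenvalues. **Theorem.** Under these conditions, if $p^{\delta_1}q^{\delta_2}T^{-1/2}=o(1)$, then the eigenvalues $\hat\lambda_{1,1}\ge\dots\ge\hat\lambda_{1,p}$ of $\widehat M_1$ and $\hat\lambda_{2,1}\ge\dots\ge\hat\lambda_{2,q}$ of $\widehat M_2$ satisfy $$|\hat\lambda_{1,j}-\lambda_{1,j}|=O_p(p^{2-\delta_1}q^{2-\delta_2}T^{-1/2})\ (1\le j\le k),\qquad |\hat\lambda_{1,j}|=O_p(p^2q^2T^{-1})\ (k<j\le p),$$ $$|\hat\lambda_{2,j}-\lambda_{2,j}|=O_p(p^{2-\delta_1}q^{2-\delta_2}T^{-1/2})\ (1\le j\le r),\qquad |\hat\lambda_{2,j}|=O_p(p^2q^2T^{-1})\ (r<j\le q),$$ each bound being uniform in the stated $j$. -/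

import Mathlib

open scoped Matrix

noncomputable section

/-- The data of the model `Y_t = A X_t + R F_t Cᵀ + E_t` for `p × q` observations, with an
observed `m × q` regressor process `X`, a latent `k × r` factor process `F` and a `p × q` noise
process `E`, all indexed by the integers, and with deterministic `A`, `R`, `C`. -/
structure FactorModel (Ω : Type*) (p q m k r : ℕ) where
  /-- regression coefficients -/
  A : Matrix (Fin p) (Fin m) ℝ
  /-- row (front) loadings -/
  R : Matrix (Fin p) (Fin k) ℝ
  /-- column (back) loadings -/
  C : Matrix (Fin q) (Fin r) ℝ
  /-- observed regressors -/
  X : ℤ → Ω → Matrix (Fin m) (Fin q) ℝ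
  /-- latent factors -/
  F : ℤ → Ω → Matrix (Fin k) (Fin r) ℝ
  /-- noise -/
  E : ℤ → Ω → Matrix (Fin p) (Fin q) ℝ

/-! ### Linear algebra -/

/-- The eigenvalues of a real symmetric matrix in descending order, with multiplicity, counted
from `j = 0`; the value is `0` for `j` beyond the size (and for non-symmetric matrices). -/
def sortedEigenvalue {a : ℕ} (M : Matrix (Fin a) (Fin a) ℝ) (j : ℕ) : ℝ :=
  open Classical in
  if h : M.IsHermitian ∧ j < Fintype.card (Fin a) then h.1.eigenvalues₀ ⟨j, h.2⟩ else 0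

/-- The spectral norm `‖M‖₂`. -/
def specNorm {α β : Type*} [Fintype α] [Fintype β] [DecidableEq β] (M : Matrix α β ℝ) : ℝ :=
  ‖LinearMap.toContinuousLinearMap (Matrix.toEuclideanLin M)‖

/-- The `j`-th largest singular value, counted from `j = 0`. -/
def singVal {α β : Type*} [Fintype α] [Fintype β] [DecidableEq β] (M : Matrix α β ℝ)
    (j : ℕ) : ℝ :=
  (Matrix.toEuclideanLin M).singularValues j

/-- `‖M‖_min`: the smallest nonzero singular value. -/
def minNorm {α β : Type*} [Fintype α] [Fintype β] [DecidableEq β] (M : Matrix α β ℝ) : ℝ :=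
  sInf {s : ℝ | 0 < s ∧ ∃ j, s = singVal M j}

/-- The `d` largest eigenvalues of `M` satisfy `λ₁ > ⋯ > λ_d > 0` (and `d` does not exceed the
size of `M`). -/
def HasDistinctPosEigenvalues {a : ℕ} (M : Matrix (Fin a) (Fin a) ℝ) (d : ℕ) : Prop :=
  d ≤ a ∧ (∀ j < d, 0 < sortedEigenvalue M j) ∧
    ∀ i j, i < j → j < d → sortedEigenvalue M j < sortedEigenvalue M i

/-! ### Lagged autocovariances of a matrix series -/

/-- `Ω̂_{ij}(h) = (T-h)⁻¹ ∑_{t=1}^{T-h} v_{t,i} v_{t+h,j}ᵀ`, where `v_{t,i}` is the `i`-th column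
of `V t`. -/
def sampleAutocov {a b : ℕ} (V : ℤ → Matrix (Fin a) (Fin b) ℝ) (T h : ℕ) (i j : Fin b) :
    Matrix (Fin a) (Fin a) ℝ :=
  ((T : ℝ) - h)⁻¹ • ∑ t ∈ Finset.Icc (1 : ℤ) ((T : ℤ) - h),
    Matrix.of fun u v => V t u i * V (t + h) v j

/-- `M̂ = ∑_{h=1}^{h₀} ∑_i ∑_j Ω̂_{ij}(h) Ω̂_{ij}(h)ᵀ`. -/
def sampleM {a b : ℕ} (V : ℤ → Matrix (Fin a) (Fin b) ℝ) (T h₀ : ℕ) :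
    Matrix (Fin a) (Fin a) ℝ :=
  ∑ h ∈ Finset.Icc 1 h₀, ∑ i, ∑ j, sampleAutocov V T h i j * (sampleAutocov V T h i j)ᵀ

theorem sampleM_isHermitian {a b : ℕ} (V : ℤ → Matrix (Fin a) (Fin b) ℝ) (T h₀ : ℕ) :
    (sampleM V T h₀).IsHermitian := by
  simp [Matrix.IsHermitian, sampleM, Matrix.conjTranspose_eq_transpose_of_trivial,
    Matrix.transpose_sum, Matrix.transpose_mul]

/-- `Ω_{ij}(h) = (T-h)⁻¹ ∑_{t=1}^{T-h} Cov(v_{t,i}, v_{t+h,j})`. -/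
def autocov {Ω : Type*} [MeasurableSpace Ω] (μ : MeasureTheory.Measure Ω) {a b : ℕ}
    (V : ℤ → Ω → Matrix (Fin a) (Fin b) ℝ) (T h : ℕ) (i j : Fin b) :
    Matrix (Fin a) (Fin a) ℝ :=
  ((T : ℝ) - h)⁻¹ • ∑ t ∈ Finset.Icc (1 : ℤ) ((T : ℤ) - h),
    Matrix.of fun u v =>
      ProbabilityTheory.covariance (fun ω => V t ω u i) (fun ω => V (t + h) ω v j) μ

/-- `M = ∑_{h=1}^{h₀} ∑_i ∑_j Ω_{ij}(h) Ω_{ij}(h)ᵀ`. -/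
def populationM {Ω : Type*} [MeasurableSpace Ω] (μ : MeasureTheory.Measure Ω) {a b : ℕ}
    (V : ℤ → Ω → Matrix (Fin a) (Fin b) ℝ) (T h₀ : ℕ) : Matrix (Fin a) (Fin a) ℝ :=
  ∑ h ∈ Finset.Icc 1 h₀, ∑ i, ∑ j, autocov μ V T h i j * (autocov μ V T h i j)ᵀ

theorem populationM_isHermitian {Ω : Type*} [MeasurableSpace Ω] (μ : MeasureTheory.Measure Ω)
    {a b : ℕ} (V : ℤ → Ω → Matrix (Fin a) (Fin b) ℝ) (T h₀ : ℕ) :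
    (populationM μ V T h₀).IsHermitian := by
  simp [Matrix.IsHermitian, populationM, Matrix.conjTranspose_eq_transpose_of_trivial,
    Matrix.transpose_sum, Matrix.transpose_mul]

/-! ### Mixing -/

/-- The `α`-mixing coefficient at lag `l` of a process whose value at time `t` generates the
σ-algebra `𝒢 t`. -/
def mixingCoeff {Ω : Type*} [MeasurableSpace Ω] (μ : MeasureTheory.Measure Ω)
    (𝒢 : ℤ → MeasurableSpace Ω) (l : ℕ) : ℝ :=
  sSup {x : ℝ | ∃ (i : ℤ) (A B : Set Ω),
    @MeasurableSet Ω (⨆ (t : ℤ) (_ : t ≤ i), 𝒢 t) A ∧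
    @MeasurableSet Ω (⨆ (t : ℤ) (_ : i + l ≤ t), 𝒢 t) B ∧
    x = |μ.real A * μ.real B - μ.real (A ∩ B)|}

/-- The σ-algebra generated by the entries of a random matrix. -/
@[reducible]
def sigmaOf {Ω : Type*} {a b : ℕ} (V : Ω → Matrix (Fin a) (Fin b) ℝ) : MeasurableSpace Ω :=
  ⨆ (i : Fin a) (j : Fin b), MeasurableSpace.comap (fun ω => V ω i j) inferInstance

namespace FactorModel

variable {Ω : Type*} {p q m k r : ℕ}

/-- `W_t = R F_t Cᵀ + E_t`. -/
def W (D : FactorModel Ω p q m k r) (t : ℤ) (ω : Ω) : Matrix (Fin p) (Fin q) ℝ :=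
  D.R * D.F t ω * D.Cᵀ + D.E t ω

/-- The observations `Y_t = A X_t + R F_t Cᵀ + E_t`. -/
def Y (D : FactorModel Ω p q m k r) (t : ℤ) (ω : Ω) : Matrix (Fin p) (Fin q) ℝ :=
  D.A * D.X t ω + D.R * D.F t ω * D.Cᵀ + D.E t ω

/-- The least squares estimator
`Â = (T⁻¹ ∑_{t=1}^T Y_t X_tᵀ) (T⁻¹ ∑_{t=1}^T X_t X_tᵀ)⁻¹`. -/
def AHat (D : FactorModel Ω p q m k r) (T : ℕ) (ω : Ω) : Matrix (Fin p) (Fin m) ℝ :=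
  ((T : ℝ)⁻¹ • ∑ t ∈ Finset.Icc (1 : ℤ) T, D.Y t ω * (D.X t ω)ᵀ) *
    ((T : ℝ)⁻¹ • ∑ t ∈ Finset.Icc (1 : ℤ) T, D.X t ω * (D.X t ω)ᵀ)⁻¹

/-- The residuals `Ŵ_t = Y_t - Â X_t`. -/
def WHat (D : FactorModel Ω p q m k r) (T : ℕ) (t : ℤ) (ω : Ω) : Matrix (Fin p) (Fin q) ℝ :=
  D.Y t ω - D.AHat T ω * D.X t ω

/-- `M̂₁`. -/
def MHat₁ (D : FactorModel Ω p q m k r) (T h₀ : ℕ) (ω : Ω) : Matrix (Fin p) (Fin p) ℝ :=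
  sampleM (fun t => D.WHat T t ω) T h₀

/-- `M̂₂`: the same construction applied to the transposed residuals. -/
def MHat₂ (D : FactorModel Ω p q m k r) (T h₀ : ℕ) (ω : Ω) : Matrix (Fin q) (Fin q) ℝ :=
  sampleM (fun t => (D.WHat T t ω)ᵀ) T h₀

/-- The σ-algebra generated by `(Y_t, X_t, F_t)`. -/
@[reducible]
def sigmaAt (D : FactorModel Ω p q m k r) (t : ℤ) : MeasurableSpace Ω :=
  sigmaOf (D.Y t) ⊔ sigmaOf (D.X t) ⊔ sigmaOf (D.F t)

variable [MeasurableSpace Ω]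

/-- `M₁`. -/
def M₁ (μ : MeasureTheory.Measure Ω) (D : FactorModel Ω p q m k r) (T h₀ : ℕ) :
    Matrix (Fin p) (Fin p) ℝ :=
  populationM μ D.W T h₀

/-- `M₂`: the same construction applied to the transposes `W_tᵀ`. -/
def M₂ (μ : MeasureTheory.Measure Ω) (D : FactorModel Ω p q m k r) (T h₀ : ℕ) :
    Matrix (Fin q) (Fin q) ℝ :=
  populationM μ (fun t ω => (D.W t ω)ᵀ) T h₀

/-- `Σ_f(h) = (T-h)⁻¹ ∑_{t=1}^{T-h} Cov(vec F_t, vec F_{t+h})`. -/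
def SigmaF (μ : MeasureTheory.Measure Ω) (D : FactorModel Ω p q m k r) (T h : ℕ) :
    Matrix (Fin k × Fin r) (Fin k × Fin r) ℝ :=
  ((T : ℝ) - h)⁻¹ • ∑ t ∈ Finset.Icc (1 : ℤ) ((T : ℤ) - h),
    Matrix.of fun a b =>
      ProbabilityTheory.covariance (fun ω => D.F t ω a.1 a.2) (fun ω => D.F (t + h) ω b.1 b.2) μ

/-- `E(X_t X_tᵀ)`. -/
def Pt (μ : MeasureTheory.Measure Ω) (D : FactorModel Ω p q m k r) (t : ℤ) :
    Matrix (Fin m) (Fin m) ℝ :=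
  Matrix.of fun a b => ∫ ω, (D.X t ω * (D.X t ω)ᵀ) a b ∂μ

/-- The entries of `X_t`, `F_t`, `E_t` are random variables. -/
def Measurability (D : FactorModel Ω p q m k r) : Prop :=
  ∀ t : ℤ, (∀ a b, Measurable fun ω => D.X t ω a b) ∧
    (∀ a b, Measurable fun ω => D.F t ω a b) ∧ (∀ a b, Measurable fun ω => D.E t ω a b)

/-- On the sample `1 ≤ t ≤ T`, `vec(E_t)` is white noise: centred, with the same covariance matrix
at all times, and uncorrelated between different times. -/
def WhiteNoise (μ : MeasureTheory.Measure Ω) (D : FactorModel Ω p q m k r) (T : ℕ) : Prop :=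
  (∀ t ∈ Finset.Icc (1 : ℤ) T, ∀ u g, ∫ ω, D.E t ω u g ∂μ = 0) ∧
  (∀ t ∈ Finset.Icc (1 : ℤ) T, ∀ s ∈ Finset.Icc (1 : ℤ) T, ∀ u g u' g',
    ProbabilityTheory.covariance (fun ω => D.E t ω u g) (fun ω => D.E t ω u' g') μ =
      ProbabilityTheory.covariance (fun ω => D.E s ω u g) (fun ω => D.E s ω u' g') μ) ∧
  ∀ t ∈ Finset.Icc (1 : ℤ) T, ∀ s ∈ Finset.Icc (1 : ℤ) T, t ≠ s → ∀ u g u' g',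
    ProbabilityTheory.covariance (fun ω => D.E t ω u g) (fun ω => D.E s ω u' g') μ = 0

/-- The latent factors are centred, uncorrelated with the noise at all leads and lags; the
regressors are uncorrelated with the noise and the factors of the same time. -/
def Uncorrelated (μ : MeasureTheory.Measure Ω) (D : FactorModel Ω p q m k r) (T : ℕ) : Prop :=
  (∀ t ∈ Finset.Icc (1 : ℤ) T, ∀ i j, ∫ ω, D.F t ω i j ∂μ = 0) ∧
  (∀ t ∈ Finset.Icc (1 : ℤ) T, ∀ s ∈ Finset.Icc (1 : ℤ) T, ∀ i j u g,
    ProbabilityTheory.covariance (fun ω => D.F t ω i j) (fun ω => D.E s ω u g) μ = 0) ∧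
  (∀ t ∈ Finset.Icc (1 : ℤ) T, ∀ l g' u g,
    ProbabilityTheory.covariance (fun ω => D.X t ω l g') (fun ω => D.E t ω u g) μ = 0) ∧
  ∀ t ∈ Finset.Icc (1 : ℤ) T, ∀ l g i j,
    ProbabilityTheory.covariance (fun ω => D.X t ω l g) (fun ω => D.F t ω i j) μ = 0

end FactorModel

/-! ### Asymptotic conditions

The asymptotics run along a sequence `n ↦ (p n, q n, T n)`, with one model for each `n` and with
`m`, `k`, `r` fixed. -/

section Asymptotics

variable {Ω : ℕ → Type*} [∀ n, MeasurableSpace (Ω n)] {p q : ℕ → ℕ} {m k r : ℕ}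

/-- `ξ` has absolute moment of order `s` at most `c`. -/
def MomentLE {Ω' : Type*} [MeasurableSpace Ω'] (μ : MeasureTheory.Measure Ω') (ξ : Ω' → ℝ)
    (s c : ℝ) : Prop :=
  MeasureTheory.Integrable (fun ω => |ξ ω| ^ s) μ ∧ ∫ ω, |ξ ω| ^ s ∂μ ≤ c

/-- The process `(vec Y_t, vec X_t, vec F_t)` is `α`-mixing with
`∑_{l ≥ 1} α(l)^{1 - 2/γ} < ∞`, uniformly along the sequence. -/
def MixingCond (μ : ∀ n, MeasureTheory.Measure (Ω n))
    (D : ∀ n, FactorModel (Ω n) (p n) (q n) m k r) (γ : ℝ) : Prop :=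
  ∃ K : ℝ, ∀ n,
    Summable (fun l : ℕ => mixingCoeff (μ n) (D n).sigmaAt (l + 1) ^ (1 - 2 / γ)) ∧
    ∑' l : ℕ, mixingCoeff (μ n) (D n).sigmaAt (l + 1) ^ (1 - 2 / γ) ≤ K

/-- Uniformly bounded moments of order `2γ` of all entries of `F_t`, `X_t`, `E_t`. -/
def MomentCond (μ : ∀ n, MeasureTheory.Measure (Ω n)) (T : ℕ → ℕ)
    (D : ∀ n, FactorModel (Ω n) (p n) (q n) m k r) (γ : ℝ) : Prop :=
  ∃ c : ℝ, ∀ n, ∀ t ∈ Finset.Icc (1 : ℤ) (T n),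
    (∀ i j, MomentLE (μ n) (fun ω => (D n).F t ω i j) (2 * γ) c) ∧
    (∀ l g, MomentLE (μ n) (fun ω => (D n).X t ω l g) (2 * γ) c) ∧
    (∀ u g, MomentLE (μ n) (fun ω => (D n).E t ω u g) (2 * γ) c)

/-- For some lag `1 ≤ h ≤ h₀`, with `k* = max(k, r)`: `Σ_f(h)` has rank at least `k*`, its largest
and its `k*`-th singular value are of exact order one, and the averaged lag-`h` autocovariance
matrix of each row and of each column of `F_t` is nonzero. -/
def FactorAutocovCond (μ : ∀ n, MeasureTheory.Measure (Ω n)) (T : ℕ → ℕ)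
    (D : ∀ n, FactorModel (Ω n) (p n) (q n) m k r) (h₀ : ℕ) : Prop :=
  ∃ h : ℕ, 1 ≤ h ∧ h ≤ h₀ ∧
    (∀ n, max k r ≤ ((D n).SigmaF (μ n) (T n) h).rank) ∧
    ((fun n => specNorm ((D n).SigmaF (μ n) (T n) h)) =Θ[Filter.atTop] fun _ => (1 : ℝ)) ∧
    ((fun n => singVal ((D n).SigmaF (μ n) (T n) h) (max k r - 1)) =Θ[Filter.atTop]
      fun _ => (1 : ℝ)) ∧
    ∀ n, (∀ i : Fin k, autocov (μ n) (fun t ω => ((D n).F t ω)ᵀ) (T n) h i i ≠ 0) ∧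
      ∀ j : Fin r, autocov (μ n) (D n).F (T n) h j j ≠ 0

/-- `P_t = E(X_t X_tᵀ)` is positive definite, and its time average approaches a positive definite
matrix `P` (of order `q`, with `λ_min(P) ≍ q`), in the sense that the difference is `o(q)`. -/
def RegressorCond (μ : ∀ n, MeasureTheory.Measure (Ω n)) (T : ℕ → ℕ)
    (D : ∀ n, FactorModel (Ω n) (p n) (q n) m k r) : Prop :=
  (∀ n, ∀ t ∈ Finset.Icc (1 : ℤ) (T n), ((D n).Pt (μ n) t).PosDef) ∧
  ∃ P : ℕ → Matrix (Fin m) (Fin m) ℝ, (∀ n, (P n).PosDef) ∧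
    (∀ a b, Filter.Tendsto
      (fun n => (q n : ℝ)⁻¹ * (((T n : ℝ)⁻¹ • ∑ t ∈ Finset.Icc (1 : ℤ) (T n),
        (D n).Pt (μ n) t) a b - P n a b)) Filter.atTop (nhds 0)) ∧
    ((fun n => sortedEigenvalue (P n) (m - 1)) =Θ[Filter.atTop] fun n => (q n : ℝ))

/-- The entries of the noise covariance matrix are bounded. -/
def NoiseCovCond (μ : ∀ n, MeasureTheory.Measure (Ω n)) (T : ℕ → ℕ)
    (D : ∀ n, FactorModel (Ω n) (p n) (q n) m k r) : Prop :=
  ∃ c : ℝ, ∀ n, ∀ t ∈ Finset.Icc (1 : ℤ) (T n), ∀ u g u' g',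
    |ProbabilityTheory.covariance (fun ω => (D n).E t ω u g) (fun ω => (D n).E t ω u' g') (μ n)|
      ≤ c

/-- `‖R‖₂² ≍ p^{1-δ₁} ≍ ‖R‖_min²` and `‖C‖₂² ≍ q^{1-δ₂} ≍ ‖C‖_min²`. -/
def LoadingCond (D : ∀ n, FactorModel (Ω n) (p n) (q n) m k r) (δ₁ δ₂ : ℝ) : Prop :=
  ((fun n => specNorm (D n).R ^ 2) =Θ[Filter.atTop] fun n => (p n : ℝ) ^ (1 - δ₁)) ∧
  ((fun n => minNorm (D n).R ^ 2) =Θ[Filter.atTop] fun n => (p n : ℝ) ^ (1 - δ₁)) ∧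
  ((fun n => specNorm (D n).C ^ 2) =Θ[Filter.atTop] fun n => (q n : ℝ) ^ (1 - δ₂)) ∧
  ((fun n => minNorm (D n).C ^ 2) =Θ[Filter.atTop] fun n => (q n : ℝ) ^ (1 - δ₂))

/-- `M₁` and `M₂` have `k` and `r` distinct positive eigenvalues, respectively. -/
def DistinctEigCond (μ : ∀ n, MeasureTheory.Measure (Ω n)) (T : ℕ → ℕ)
    (D : ∀ n, FactorModel (Ω n) (p n) (q n) m k r) (h₀ : ℕ) : Prop :=
  ∀ n, HasDistinctPosEigenvalues ((D n).M₁ (μ n) (T n) h₀) k ∧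
    HasDistinctPosEigenvalues ((D n).M₂ (μ n) (T n) h₀) r

/-- `max_{j ∈ J n} |ξ n j| = O_p(a n)`: for every `ε > 0` there is a constant `c` such that, for all
large `n`, with probability at least `1 - ε`, `|ξ n j| ≤ c * a n` for all `j ∈ J n`. -/
def UniformBigOp (μ : ∀ n, MeasureTheory.Measure (Ω n)) (J : ℕ → Set ℕ)
    (ξ : ∀ n, ℕ → Ω n → ℝ) (a : ℕ → ℝ) : Prop :=
  ∀ ε : ℝ, 0 < ε → ∃ c : ℝ, 0 < c ∧ ∀ᶠ n in Filter.atTop,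
    μ n {ω | ∃ j ∈ J n, c * a n < |ξ n j ω|} ≤ ENNReal.ofReal ε

end Asymptotics

end

noncomputable section

/-! Let N be the array with entries N_h(u,i,v,j), the averaged covariance of W_{t,ui} and
W_{t+h,vj}, and let N̂ be its sample version computed from the residuals. M₁ is the Gram matrix of
the vectors u ↦ N_h(u,i,v,j) and M₂ that of the vectors i ↦ N_h(u,i,v,j); N̂ gives the hatted
matrices in the same way. All four claims therefore follow from two Frobenius bounds, ‖N‖ ≤ β and
‖N̂ - N‖ ≤ d.

The quadratic forms of M̂ and M differ by at most d(2β+d)|x|², so by Weyl's inequality no eigenvalue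
moves further than that (`abs_sortedEigenvalue_sub_le`). At lags h ≥ 1 the noise drops out of N, so
its vectors lie in the column space of R (of C for M₂). On the orthogonal complement, of codimension
at most k (or r), the form of M̂ sees only N̂ - N and is at most d²|x|²; Courant–Fischer then bounds
the remaining eigenvalues by d² (`abs_sortedEigenvalue_le_of_ker`).

The loadings give β of order p^{1-δ₁}q^{1-δ₂}. It remains to show d = O_p(pqT^{-1/2}). With W in
place of the residuals, each entry of the array has, up to its scale, variance of order 1/T:
Davydov's covariance inequality (`abs_integral_mul_sub_le_of_moment`) and summable mixing
coefficients control the variance of a sum over time (`meanLE_sq_sum_sub`). The residuals are W_t -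
U_t with U_t = G H⁻¹ X_t, where G is the mean of W_t X_tᵀ and H the mean of X_t X_tᵀ. Since W_t and
X_t are uncorrelated, E‖G‖² = O(pq²/T), while λ_min(H) is at least of order q with high probability;
hence ∑‖U_t‖² = O_p(pq) (`energy_regression_le`). Against ∑‖W_t‖² = O_p(Tpq), Cauchy–Schwarz makes
the effect on the array O_p(p²q²/T) in squared norm.

Finally, dβ has the order ρ = p^{2-δ₁}q^{2-δ₂}T^{-1/2}, and d² has the order ρ·p^{δ₁}q^{δ₂}T^{-1/2},
which the rate condition absorbs into ρ. -/

/-! ### Eigenvalues through quadratic forms -/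

theorem sortedEigenvalue_of_lt {a : ℕ} {M : Matrix (Fin a) (Fin a) ℝ} (hM : M.IsHermitian)
    {j : ℕ} (hj : j < Fintype.card (Fin a)) : sortedEigenvalue M j = hM.eigenvalues₀ ⟨j, hj⟩ := by
  unfold sortedEigenvalue
  exact dif_pos ⟨hM, hj⟩

theorem sortedEigenvalue_of_le {a : ℕ} (M : Matrix (Fin a) (Fin a) ℝ) {j : ℕ} (hj : a ≤ j) :
    sortedEigenvalue M j = 0 := by
  unfold sortedEigenvalue
  rw [dif_neg]
  rintro ⟨-, h⟩
  simp at h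
  omega

theorem dotProduct_self_nonneg_real {a : ℕ} (x : Fin a → ℝ) : 0 ≤ x ⬝ᵥ x :=
  Finset.sum_nonneg fun _ _ => mul_self_nonneg _

/-- The spectral theorem as a linear change of coordinates, so that subspaces can be cut out by
vanishing coordinates. Injectivity in finite dimension also makes every coordinate vector
attainable. -/
theorem exists_eigenvector_coordinates {a : ℕ} {M : Matrix (Fin a) (Fin a) ℝ}
    (hM : M.IsHermitian) :
    ∃ f : (Fin a → ℝ) →ₗ[ℝ] (Fin a → ℝ), Function.Injective f ∧
      (∀ x, x ⬝ᵥ x = ∑ i, f x i ^ 2) ∧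
      ∀ x, x ⬝ᵥ M *ᵥ x = ∑ i : Fin a, sortedEigenvalue M i * f x i ^ 2 := by
  have hs := Matrix.isSymmetric_toEuclideanLin_iff.mpr hM
  have hc : Fintype.card (Fin a) = a := Fintype.card_fin a
  let b := hs.eigenvectorBasis finrank_euclideanSpace
  let e : Fin (Fintype.card (Fin a)) ≃ Fin a := finCongr hc
  have hinner : ∀ x y : Fin a → ℝ,
      x ⬝ᵥ y = inner ℝ (WithLp.toLp 2 x : EuclideanSpace ℝ (Fin a)) (WithLp.toLp 2 y) := by
    intro x y
    simp [PiLp.inner_apply, dotProduct, mul_comm]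
  let f : (Fin a → ℝ) →ₗ[ℝ] (Fin a → ℝ) :=
    { toFun := fun x i => inner ℝ (b (e.symm i)) (WithLp.toLp 2 x)
      map_add' := by intro x y; ext i; simp [inner_add_right]
      map_smul' := by intro c x; ext i; simp [inner_smul_right] }
  have hf : ∀ x y, x ⬝ᵥ y = ∑ i, f x i * f y i := by
    intro x y
    rw [hinner, ← b.sum_inner_mul_inner, ← e.symm.sum_comp]
    refine Finset.sum_congr rfl fun i _ => ?_
    simp only [f, LinearMap.coe_mk, AddHom.coe_mk]
    rw [real_inner_comm]
  have hMf : ∀ x i, f (M *ᵥ x) i = sortedEigenvalue M i * f x i := by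
    intro x i
    have h1 : (WithLp.toLp 2 (M *ᵥ x) : EuclideanSpace ℝ (Fin a)) =
        Matrix.toEuclideanLin M (WithLp.toLp 2 x) := by
      simp [Matrix.toLpLin_apply]
    have h2 : sortedEigenvalue M i = hs.eigenvalues finrank_euclideanSpace (e.symm i) := by
      rw [sortedEigenvalue_of_lt hM (by simp)]
      rfl
    simp only [f, LinearMap.coe_mk, AddHom.coe_mk]
    rw [h1, ← hs, hs.apply_eigenvectorBasis, h2]
    simp [inner_smul_left, b]
  refine ⟨f, ?_, fun x => ?_, fun x => ?_⟩
  · rw [← LinearMap.ker_eq_bot, LinearMap.ker_eq_bot']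
    intro x hx
    have := hf x x
    rw [hx] at this
    simpa using this
  · rw [hf]; simp [sq]
  · rw [hf]
    refine Finset.sum_congr rfl fun i _ => ?_
    rw [hMf]; ring

theorem sortedEigenvalue_anti {a : ℕ} {M : Matrix (Fin a) (Fin a) ℝ} (hM : M.IsHermitian)
    {i j : ℕ} (hij : i ≤ j) (hj : j < a) : sortedEigenvalue M j ≤ sortedEigenvalue M i := by
  rw [sortedEigenvalue_of_lt hM (by simpa using hj),
    sortedEigenvalue_of_lt hM (by simpa using hij.trans_lt hj)]
  exact hM.eigenvalues₀_antitone (by simpa using hij)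

/-- One half of the Courant–Fischer principle. -/
theorem sortedEigenvalue_le_of_quadratic_le {a d j : ℕ} {M : Matrix (Fin a) (Fin a) ℝ}
    (hM : M.IsHermitian) (hj : j < a) (hd : d ≤ j) (g : (Fin a → ℝ) →ₗ[ℝ] (Fin d → ℝ)) (c : ℝ)
    (h : ∀ x, g x = 0 → x ⬝ᵥ M *ᵥ x ≤ c * (x ⬝ᵥ x)) : sortedEigenvalue M j ≤ c := by
  obtain ⟨f, -, hf, hMf⟩ := exists_eigenvector_coordinates hM
  -- Annihilating the eigencoordinates beyond `j` costs `a - 1 - j` conditions and `g` costs `d ≤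
  -- j`. Together they are fewer than `a`, so a nonzero vector satisfies all of them; on it the form
  -- is at least the `j`-th eigenvalue times the squared norm.
  let π : (Fin a → ℝ) →ₗ[ℝ] (Fin (a - 1 - j) → ℝ) :=
    LinearMap.funLeft ℝ ℝ (fun i : Fin (a - 1 - j) => (⟨j + 1 + i, by omega⟩ : Fin a))
  have hker : LinearMap.ker (g.prod (π ∘ₗ f)) ≠ ⊥ := by
    apply LinearMap.ker_ne_bot_of_finrank_lt
    simp
    omega
  obtain ⟨x, hx, hx0⟩ := (Submodule.ne_bot_iff _).mp hker
  replace hx : (g x, (π ∘ₗ f) x) = 0 := hx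
  rw [Prod.mk_eq_zero] at hx
  obtain ⟨hgx, hπ⟩ := hx
  have hzero : ∀ i : Fin a, j < i → f x i = 0 := by
    intro i hi
    have := congrFun hπ ⟨i - (j + 1), by omega⟩
    simp only [LinearMap.comp_apply, LinearMap.funLeft_apply, π, Pi.zero_apply] at this
    convert this using 2
    ext; simp; omega
  have hle : sortedEigenvalue M j * (x ⬝ᵥ x) ≤ x ⬝ᵥ M *ᵥ x := by
    rw [hf, hMf, Finset.mul_sum]
    refine Finset.sum_le_sum fun i _ => ?_
    by_cases hi : j < i
    · simp [hzero i hi]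
    · exact mul_le_mul_of_nonneg_right (sortedEigenvalue_anti hM (by omega) hj) (sq_nonneg _)
  have hpos : 0 < x ⬝ᵥ x := by
    refine lt_of_le_of_ne (dotProduct_self_nonneg_real x) fun h => hx0 ?_
    exact dotProduct_self_eq_zero.mp h.symm
  exact le_of_mul_le_mul_right (hle.trans (h x hgx)) hpos

/-- Weyl's inequality. -/
theorem sortedEigenvalue_le_add {a : ℕ} {M N : Matrix (Fin a) (Fin a) ℝ} (hM : M.IsHermitian)
    (hN : N.IsHermitian) {c : ℝ} (hc : 0 ≤ c)
    (h : ∀ x, x ⬝ᵥ M *ᵥ x ≤ x ⬝ᵥ N *ᵥ x + c * (x ⬝ᵥ x)) (j : ℕ) :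
    sortedEigenvalue M j ≤ sortedEigenvalue N j + c := by
  rcases le_or_gt a j with hj | hj
  -- Beyond the size of the matrices both sides carry the default value 0, and only `0 ≤ c` is
  -- needed.
  · simpa [sortedEigenvalue_of_le _ hj] using hc
  obtain ⟨f, -, hf, hNf⟩ := exists_eigenvector_coordinates hN
  -- The `j` conditions are the vanishing of the first `j` eigencoordinates of `N`; there the form
  -- of `N` is at most its `j`-th eigenvalue times the squared norm.
  refine sortedEigenvalue_le_of_quadratic_le hM hj le_rfl
    (LinearMap.funLeft ℝ ℝ (fun i : Fin j => (⟨i, by omega⟩ : Fin a)) ∘ₗ f) _ fun x hx => ?_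
  have hzero : ∀ i : Fin a, i.1 < j → f x i = 0 := fun i hi => congrFun hx ⟨i, hi⟩
  have hle : x ⬝ᵥ N *ᵥ x ≤ sortedEigenvalue N j * (x ⬝ᵥ x) := by
    rw [hf, hNf, Finset.mul_sum]
    refine Finset.sum_le_sum fun i _ => ?_
    by_cases hi : i.1 < j
    · simp [hzero i hi]
    · exact mul_le_mul_of_nonneg_right (sortedEigenvalue_anti hN (by omega) i.2) (sq_nonneg _)
  linarith [h x]

theorem sortedEigenvalue_last_mul_le {a : ℕ} {M : Matrix (Fin a) (Fin a) ℝ}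
    (hM : M.IsHermitian) (x : Fin a → ℝ) :
    sortedEigenvalue M (a - 1) * (x ⬝ᵥ x) ≤ x ⬝ᵥ M *ᵥ x := by
  obtain ⟨f, -, hf, hMf⟩ := exists_eigenvector_coordinates hM
  rw [hf, hMf, Finset.mul_sum]
  refine Finset.sum_le_sum fun i _ => mul_le_mul_of_nonneg_right
    (sortedEigenvalue_anti hM (by have := i.2; omega) (by have := i.2; omega)) (sq_nonneg _)

theorem sortedEigenvalue_nonneg {a : ℕ} {M : Matrix (Fin a) (Fin a) ℝ}
    (hM : M.IsHermitian) (h : ∀ x, 0 ≤ x ⬝ᵥ M *ᵥ x) (j : ℕ) : 0 ≤ sortedEigenvalue M j := by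
  rcases le_or_gt a j with hj | hj
  · rw [sortedEigenvalue_of_le _ hj]
  obtain ⟨f, hinj, -, hMf⟩ := exists_eigenvector_coordinates hM
  obtain ⟨x, hx⟩ := (LinearMap.injective_iff_surjective.mp hinj) (Pi.single ⟨j, hj⟩ 1)
  have := h x
  rw [hMf, hx] at this
  simpa [Pi.single_apply, ite_pow] using this

/-! ### Sums of squares of linear forms -/

/-- If `M` and `M'` are Gram matrices of families of vectors whose difference has Frobenius norm
at most `d`, then their eigenvalues are close. -/
theorem abs_sortedEigenvalue_sub_le {a : ℕ} {κ : Type*} (s : Finset κ)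
    {M M' : Matrix (Fin a) (Fin a) ℝ} (hM : M.IsHermitian) (hM' : M'.IsHermitian)
    (B B' : κ → Fin a → ℝ) (hB : ∀ x, x ⬝ᵥ M *ᵥ x = ∑ i ∈ s, (x ⬝ᵥ B i) ^ 2)
    (hB' : ∀ x, x ⬝ᵥ M' *ᵥ x = ∑ i ∈ s, (x ⬝ᵥ B' i) ^ 2) {b d : ℝ} (hb : 0 ≤ b) (hd : 0 ≤ d)
    (hBb : ∑ i ∈ s, ∑ u, B i u ^ 2 ≤ b ^ 2)
    (hBd : ∑ i ∈ s, ∑ u, (B' i u - B i u) ^ 2 ≤ d ^ 2) (j : ℕ) :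
    |sortedEigenvalue M' j - sortedEigenvalue M j| ≤ d * (2 * b + d) := by
  have key : ∀ x, |x ⬝ᵥ M' *ᵥ x - x ⬝ᵥ M *ᵥ x| ≤ d * (2 * b + d) * (x ⬝ᵥ x) := by
    intro x
    have hx := dotProduct_self_nonneg_real x
    have hcs : ∀ y : Fin a → ℝ, (x ⬝ᵥ y) ^ 2 ≤ (x ⬝ᵥ x) * ∑ u, y u ^ 2 := by
      intro y
      have := Finset.sum_mul_sq_le_sq_mul_sq Finset.univ x y
      simpa [dotProduct, sq] using this
    have h1 : ∑ i ∈ s, (x ⬝ᵥ B i) ^ 2 ≤ b ^ 2 * (x ⬝ᵥ x) := by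
      calc _ ≤ ∑ i ∈ s, (x ⬝ᵥ x) * ∑ u, B i u ^ 2 := Finset.sum_le_sum fun i _ => hcs _
        _ ≤ _ := by rw [← Finset.mul_sum, mul_comm]; gcongr
    have h2 : ∑ i ∈ s, (x ⬝ᵥ (B' i - B i)) ^ 2 ≤ d ^ 2 * (x ⬝ᵥ x) := by
      calc _ ≤ ∑ i ∈ s, (x ⬝ᵥ x) * ∑ u, (B' i u - B i u) ^ 2 :=
            Finset.sum_le_sum fun i _ => hcs _
        _ ≤ _ := by rw [← Finset.mul_sum, mul_comm]; gcongr
    have h3 : |∑ i ∈ s, (x ⬝ᵥ B i) * (x ⬝ᵥ (B' i - B i))| ≤ b * d * (x ⬝ᵥ x) := by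
      apply abs_le_of_sq_le_sq _ (by positivity)
      calc _ ≤ _ := Finset.sum_mul_sq_le_sq_mul_sq s _ _
        _ ≤ (b ^ 2 * (x ⬝ᵥ x)) * (d ^ 2 * (x ⬝ᵥ x)) := by
            gcongr
        _ = _ := by ring
    -- With e = x·(B' - B), each summand is (x·B + e)² - (x·B)² = e² + 2(x·B)e. The two parts
    -- contribute at most d²|x|² and 2bd|x|², which is the source of d(2b + d).
    have h4 : x ⬝ᵥ M' *ᵥ x - x ⬝ᵥ M *ᵥ x = ∑ i ∈ s, (x ⬝ᵥ (B' i - B i)) ^ 2 +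
        2 * ∑ i ∈ s, (x ⬝ᵥ B i) * (x ⬝ᵥ (B' i - B i)) := by
      rw [hB, hB', ← Finset.sum_sub_distrib, Finset.mul_sum, ← Finset.sum_add_distrib]
      refine Finset.sum_congr rfl fun i _ => ?_
      rw [dotProduct_sub]; ring
    have h5 : 0 ≤ ∑ i ∈ s, (x ⬝ᵥ (B' i - B i)) ^ 2 := Finset.sum_nonneg fun _ _ => sq_nonneg _
    rw [h4]
    rw [abs_le] at h3 ⊢
    constructor <;> nlinarith [mul_nonneg (sq_nonneg d) hx]
  have hc : 0 ≤ d * (2 * b + d) := by positivity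
  have h1 := sortedEigenvalue_le_add hM' hM hc (fun x => by linarith [(abs_le.mp (key x)).2]) j
  have h2 := sortedEigenvalue_le_add hM hM' hc (fun x => by linarith [(abs_le.mp (key x)).1]) j
  rw [abs_le]
  constructor <;> linarith

/-- On the kernel of `g`, of codimension at most `k`, the form of `M'` depends on `B' - B` alone.
The bound is therefore quadratic in the perturbation, which is why the trailing eigenvalues have
their own rate. -/
theorem abs_sortedEigenvalue_le_of_ker {a k : ℕ} {κ : Type*} (s : Finset κ)
    {M' : Matrix (Fin a) (Fin a) ℝ} (hM' : M'.IsHermitian)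
    (B B' : κ → Fin a → ℝ)
    (hB' : ∀ x, x ⬝ᵥ M' *ᵥ x = ∑ i ∈ s, (x ⬝ᵥ B' i) ^ 2)
    (g : (Fin a → ℝ) →ₗ[ℝ] (Fin k → ℝ)) (hg : ∀ x, g x = 0 → ∀ i ∈ s, x ⬝ᵥ B i = 0) {c : ℝ}
    (hBd : ∑ i ∈ s, ∑ u, (B' i u - B i u) ^ 2 ≤ c) {j : ℕ} (hkj : k ≤ j) (hj : j < a) :
    |sortedEigenvalue M' j| ≤ c := by
  rw [abs_of_nonneg (sortedEigenvalue_nonneg hM' (fun x => by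
    rw [hB']; exact Finset.sum_nonneg fun _ _ => sq_nonneg _) j)]
  refine sortedEigenvalue_le_of_quadratic_le hM' hj hkj g c fun x hx => ?_
  have h0 := dotProduct_self_nonneg_real x
  rw [hB']
  calc ∑ i ∈ s, (x ⬝ᵥ B' i) ^ 2 ≤ ∑ i ∈ s, (x ⬝ᵥ x) * ∑ u, (B' i u - B i u) ^ 2 := by
        refine Finset.sum_le_sum fun i hi => ?_
        have h1 : x ⬝ᵥ B' i = x ⬝ᵥ (B' i - B i) := by rw [dotProduct_sub, hg x hx i hi, sub_zero]
        rw [h1]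
        have := Finset.sum_mul_sq_le_sq_mul_sq Finset.univ x (B' i - B i)
        simpa [dotProduct, sq] using this
    _ ≤ _ := by rw [← Finset.mul_sum, mul_comm]; gcongr

/-- `∑_h ∑_i ∑_j N_{ij}(h) N_{ij}(h)ᵀ` for the matrices `N_{ij}(h)` with entries `N h u i v j`. -/
def gramM {a b : ℕ} (N : ℕ → Fin a → Fin b → Fin a → Fin b → ℝ) (h₀ : ℕ) :
    Matrix (Fin a) (Fin a) ℝ :=
  ∑ h ∈ Finset.Icc 1 h₀, ∑ i, ∑ j,
    (Matrix.of fun u v => N h u i v j) * (Matrix.of fun u v => N h u i v j)ᵀ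

theorem gramM_isHermitian {a b : ℕ} (N : ℕ → Fin a → Fin b → Fin a → Fin b → ℝ) (h₀ : ℕ) :
    (gramM N h₀).IsHermitian := by
  simp [Matrix.IsHermitian, gramM, Matrix.conjTranspose_eq_transpose_of_trivial,
    Matrix.transpose_sum, Matrix.transpose_mul]

/-- The squared Frobenius norm of the array `N h u i v j`. -/
def frobSq {a b : ℕ} (N : ℕ → Fin a → Fin b → Fin a → Fin b → ℝ) (h₀ : ℕ) : ℝ :=
  ∑ h ∈ Finset.Icc 1 h₀, ∑ u, ∑ i, ∑ v, ∑ j, N h u i v j ^ 2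

theorem sum_prod_index {a b : ℕ} (h₀ : ℕ) (f : ℕ → Fin b → Fin b → Fin a → ℝ) :
    ∑ x ∈ Finset.Icc 1 h₀ ×ˢ (Finset.univ : Finset (Fin b × Fin b × Fin a)),
      f x.1 x.2.1 x.2.2.1 x.2.2.2 = ∑ h ∈ Finset.Icc 1 h₀, ∑ i, ∑ j, ∑ v, f h i j v := by
  rw [Finset.sum_product]
  simp_rw [Fintype.sum_prod_type]

/-- One vector per `(h, i, j, v)`: the form of N Nᵀ at x is the squared norm of xᵀN, whose
coordinates are indexed by `v`. -/
theorem gramM_quadratic {a b : ℕ} (N : ℕ → Fin a → Fin b → Fin a → Fin b → ℝ) (h₀ : ℕ)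
    (x : Fin a → ℝ) : x ⬝ᵥ gramM N h₀ *ᵥ x =
      ∑ y ∈ Finset.Icc 1 h₀ ×ˢ (Finset.univ : Finset (Fin b × Fin b × Fin a)),
        (x ⬝ᵥ fun u => N y.1 u y.2.1 y.2.2.2 y.2.2.1) ^ 2 := by
  rw [sum_prod_index h₀ (fun h i j v => (x ⬝ᵥ fun u => N h u i v j) ^ 2)]
  simp_rw [gramM, Matrix.sum_mulVec, dotProduct_sum]
  refine Finset.sum_congr rfl fun h _ => Finset.sum_congr rfl fun i _ =>
    Finset.sum_congr rfl fun j _ => ?_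
  rw [← Matrix.mulVec_mulVec, Matrix.dotProduct_mulVec, Matrix.mulVec_transpose]
  simp [dotProduct, Matrix.vecMul, sq]

theorem frobSq_eq_sum {a b : ℕ} (N : ℕ → Fin a → Fin b → Fin a → Fin b → ℝ) (h₀ : ℕ) :
    frobSq N h₀ = ∑ y ∈ Finset.Icc 1 h₀ ×ˢ (Finset.univ : Finset (Fin b × Fin b × Fin a)),
        ∑ u, N y.1 u y.2.1 y.2.2.2 y.2.2.1 ^ 2 := by
  rw [sum_prod_index h₀ (fun h i j v => ∑ u, N h u i v j ^ 2), frobSq]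
  refine Finset.sum_congr rfl fun h _ => ?_
  rw [Finset.sum_comm]
  refine Finset.sum_congr rfl fun i _ => ?_
  rw [Finset.sum_comm]
  conv_rhs => rw [Finset.sum_comm]
  refine Finset.sum_congr rfl fun v _ => ?_
  rw [Finset.sum_comm]

theorem abs_sortedEigenvalue_gramM_sub_le {a b : ℕ}
    (N N' : ℕ → Fin a → Fin b → Fin a → Fin b → ℝ) (h₀ : ℕ) {β d : ℝ} (hβ : 0 ≤ β) (hd : 0 ≤ d)
    (hN : frobSq N h₀ ≤ β ^ 2)
    (hNd : frobSq (fun h u i v j => N' h u i v j - N h u i v j) h₀ ≤ d ^ 2) (j : ℕ) :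
    |sortedEigenvalue (gramM N' h₀) j - sortedEigenvalue (gramM N h₀) j| ≤ d * (2 * β + d) := by
  have h1 := gramM_quadratic N h₀
  have h2 := gramM_quadratic N' h₀
  rw [frobSq_eq_sum] at hN hNd
  have h3 := gramM_isHermitian N h₀
  have h4 := gramM_isHermitian N' h₀
  revert h1 h2 h3 h4
  generalize gramM N h₀ = M
  generalize gramM N' h₀ = M'
  intro h1 h2 h3 h4
  generalize Finset.Icc 1 h₀ ×ˢ (Finset.univ : Finset (Fin b × Fin b × Fin a)) = s at *
  exact abs_sortedEigenvalue_sub_le s h3 h4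
    (fun y u => N y.1 u y.2.1 y.2.2.2 y.2.2.1) (fun y u => N' y.1 u y.2.1 y.2.2.2 y.2.2.1)
    h1 h2 hβ hd hN hNd j

/-- The factorisation puts all vectors of `N` in the span of the `k` columns of `L`, so the `k`
linear conditions that annihilate them are the coordinates of Lᵀx. -/
theorem abs_sortedEigenvalue_gramM_le {a b k : ℕ}
    (N N' : ℕ → Fin a → Fin b → Fin a → Fin b → ℝ) (h₀ : ℕ) {c : ℝ}
    (L : Matrix (Fin a) (Fin k) ℝ) (K : ℕ → Fin k → Fin b → Fin a → Fin b → ℝ)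
    (hL : ∀ h ∈ Finset.Icc 1 h₀, ∀ u i v j, N h u i v j = ∑ l, L u l * K h l i v j)
    (hNd : frobSq (fun h u i v j => N' h u i v j - N h u i v j) h₀ ≤ c) {j : ℕ} (hkj : k ≤ j)
    (hj : j < a) : |sortedEigenvalue (gramM N' h₀) j| ≤ c := by
  have hker : ∀ x, Matrix.mulVecLin Lᵀ x = 0 →
      ∀ y ∈ Finset.Icc 1 h₀ ×ˢ (Finset.univ : Finset (Fin b × Fin b × Fin a)),
        (x ⬝ᵥ fun u => N y.1 u y.2.1 y.2.2.2 y.2.2.1) = 0 := by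
    intro x hx y hy
    have hy1 : y.1 ∈ Finset.Icc 1 h₀ := (Finset.mem_product.mp hy).1
    simp only [dotProduct]
    simp_rw [hL _ hy1, Finset.mul_sum]
    rw [Finset.sum_comm]
    refine Finset.sum_eq_zero fun l _ => ?_
    have := congrFun hx l
    simp only [Matrix.mulVecLin_apply, Matrix.mulVec, dotProduct, Matrix.transpose_apply,
      Pi.zero_apply] at this
    calc _ = (∑ u, L u l * x u) * K y.1 l y.2.1 y.2.2.2 y.2.2.1 := by
          rw [Finset.sum_mul]; refine Finset.sum_congr rfl fun u _ => by ring
      _ = 0 := by rw [this, zero_mul]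
  have h2 := gramM_quadratic N' h₀
  rw [frobSq_eq_sum] at hNd
  have h4 := gramM_isHermitian N' h₀
  revert h2 h4
  generalize gramM N' h₀ = M'
  intro h2 h4
  generalize Finset.Icc 1 h₀ ×ˢ (Finset.univ : Finset (Fin b × Fin b × Fin a)) = s at *
  exact abs_sortedEigenvalue_le_of_ker s h4
    (fun y u => N y.1 u y.2.1 y.2.2.2 y.2.2.1) (fun y u => N' y.1 u y.2.1 y.2.2.2 y.2.2.1)
    h2 _ hker hNd hkj hj

/-! ### Means of real random variables -/

/-- `f` is integrable with mean at most `c`. -/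
def MeanLE {Ω : Type*} [MeasurableSpace Ω] (μ : MeasureTheory.Measure Ω) (f : Ω → ℝ)
    (c : ℝ) : Prop :=
  MeasureTheory.Integrable f μ ∧ ∫ ω, f ω ∂μ ≤ c

section Mixing

open MeasureTheory

variable {Ω : Type*} {𝒜 ℬ : MeasurableSpace Ω} [m₀ : MeasurableSpace Ω] {μ : Measure Ω}

theorem MeanLE.mono {f : Ω → ℝ} {c d : ℝ} (h : MeanLE μ f c) (hcd : c ≤ d) : MeanLE μ f d :=
  ⟨h.1, h.2.trans hcd⟩

theorem MeanLE.of_le {f g : Ω → ℝ} {c : ℝ} (h : MeanLE μ f c) (hg : Measurable g)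
    (hg0 : ∀ ω, 0 ≤ g ω) (hgf : ∀ ω, g ω ≤ f ω) : MeanLE μ g c := by
  have hi : Integrable g μ := h.1.mono' hg.aestronglyMeasurable
    (Filter.Eventually.of_forall fun ω => by rw [Real.norm_of_nonneg (hg0 ω)]; exact hgf ω)
  exact ⟨hi, (integral_mono hi h.1 hgf).trans h.2⟩

theorem MeanLE.sum {ι : Type*} (s : Finset ι) {f : ι → Ω → ℝ} {c : ι → ℝ}
    (h : ∀ i ∈ s, MeanLE μ (f i) (c i)) : MeanLE μ (fun ω => ∑ i ∈ s, f i ω) (∑ i ∈ s, c i) := by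
  refine ⟨integrable_finsetSum _ fun i hi => (h i hi).1, ?_⟩
  rw [integral_finsetSum _ fun i hi => (h i hi).1]
  exact Finset.sum_le_sum fun i hi => (h i hi).2

theorem MeanLE.add {f g : Ω → ℝ} {c d : ℝ} (hf : MeanLE μ f c) (hg : MeanLE μ g d) :
    MeanLE μ (fun ω => f ω + g ω) (c + d) := by
  refine ⟨hf.1.add hg.1, ?_⟩
  rw [integral_add hf.1 hg.1]
  exact add_le_add hf.2 hg.2

theorem MeanLE.const_mul {f : Ω → ℝ} {c : ℝ} (hf : MeanLE μ f c) {a : ℝ} (ha : 0 ≤ a) :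
    MeanLE μ (fun ω => a * f ω) (a * c) := by
  refine ⟨hf.1.const_mul a, ?_⟩
  rw [integral_const_mul]
  exact mul_le_mul_of_nonneg_left hf.2 ha

variable [IsProbabilityMeasure μ]

theorem MeanLE.const (a : ℝ) : MeanLE μ (fun _ => a) a := ⟨integrable_const _, by simp⟩

/-- Markov's inequality. -/
theorem MeanLE.measure_lt_le {f : Ω → ℝ} {c ε : ℝ} (hf : MeanLE μ f c) (hf0 : ∀ ω, 0 ≤ f ω)
    {a : ℝ} (ha : 0 < a) (hc : c ≤ ε * a) : μ {ω | a < f ω} ≤ ENNReal.ofReal ε := by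
  have h1 := mul_meas_ge_le_integral_of_nonneg (Filter.Eventually.of_forall hf0) hf.1 a
  have h2 : μ.real {ω | a ≤ f ω} ≤ ε := by
    have : a * μ.real {ω | a ≤ f ω} ≤ a * ε := by linarith [hf.2]
    exact le_of_mul_le_mul_left this ha
  calc μ {ω | a < f ω} ≤ μ {ω | a ≤ f ω} := measure_mono fun ω (h : a < f ω) => h.le
    _ = ENNReal.ofReal (μ.real {ω | a ≤ f ω}) := (ofReal_measureReal).symm
    _ ≤ _ := ENNReal.ofReal_le_ofReal h2

/-! ### Covariance inequalities under strong mixing -/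

/-- Averaging out a bounded random variable that is measurable with respect to a sub-σ-algebra. -/
theorem exists_abs_integral_mul_sub_le (h𝒜 : 𝒜 ≤ m₀) {ξ η : Ω → ℝ}
    {M : ℝ} (hξ : Measurable[𝒜] ξ) (hξM : ∀ ω, |ξ ω| ≤ M) (hη : Integrable η μ) :
    ∃ A, MeasurableSet[𝒜] A ∧ |∫ ω, ξ ω * η ω ∂μ - (∫ ω, ξ ω ∂μ) * ∫ ω, η ω ∂μ| ≤
      2 * M * |∫ ω in A, η ω ∂μ - μ.real A * ∫ ω, η ω ∂μ| := by
  set e := ∫ ω, η ω ∂μ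
  set g : Ω → ℝ := fun ω => (μ[η|𝒜]) ω - e with hg
  have hgm : StronglyMeasurable[𝒜] g := stronglyMeasurable_condExp.sub stronglyMeasurable_const
  have hgi : Integrable g μ := integrable_condExp.sub (integrable_const _)
  have hξm : Measurable ξ := hξ.mono h𝒜 le_rfl
  have hξi : Integrable ξ μ := Integrable.of_bound hξm.aestronglyMeasurable M
    (Filter.Eventually.of_forall hξM)
  have hξη : Integrable (ξ * η) μ :=
    hη.bdd_mul hξm.aestronglyMeasurable (Filter.Eventually.of_forall hξM)
  have hξg : Integrable (fun ω => ξ ω * g ω) μ :=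
    hgi.bdd_mul hξm.aestronglyMeasurable (Filter.Eventually.of_forall hξM)
  have hξc : Integrable (fun ω => ξ ω * (μ[η|𝒜]) ω) μ :=
    integrable_condExp.bdd_mul hξm.aestronglyMeasurable (Filter.Eventually.of_forall hξM)
  have h1 : ∫ ω, ξ ω * η ω ∂μ = ∫ ω, ξ ω * (μ[η|𝒜]) ω ∂μ := by
    rw [← integral_condExp h𝒜 (f := fun ω => ξ ω * η ω)]
    exact integral_congr_ae (condExp_mul_of_stronglyMeasurable_left hξ.stronglyMeasurable hξη hη)
  have h2 : ∫ ω, ξ ω * η ω ∂μ - (∫ ω, ξ ω ∂μ) * e = ∫ ω, ξ ω * g ω ∂μ := by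
    have : (fun ω => ξ ω * g ω) = fun ω => ξ ω * (μ[η|𝒜]) ω - ξ ω * e := by
      ext ω; simp only [hg]; ring
    rw [this, integral_sub hξc (hξi.mul_const _), h1, integral_mul_const]
  have hg0 : ∫ ω, g ω ∂μ = 0 := by
    simp only [hg]
    rw [integral_sub integrable_condExp (integrable_const _), integral_condExp h𝒜]
    simp [e]
  have hM : 0 ≤ M := (abs_nonneg _).trans (hξM (Classical.choice
    (by by_contra h; rw [not_nonempty_iff] at h; exact IsProbabilityMeasure.ne_zero μ
          (Measure.eq_zero_of_isEmpty μ))))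
  -- As `g` has mean zero, E|g| is twice its integral over the set where it is positive. Bounding
  -- |ξ| by `M` thus trades ξ for the indicator of an 𝒜-measurable set.
  set A : Set Ω := {ω | 0 < g ω} with hA
  have hAm : MeasurableSet[𝒜] A := measurableSet_lt measurable_const hgm.measurable
  refine ⟨A, hAm, ?_⟩
  have hAm' : MeasurableSet A := h𝒜 _ hAm
  have h3 : ∫ ω in A, g ω ∂μ = ∫ ω in A, η ω ∂μ - μ.real A * e := by
    simp only [hg]
    rw [integral_sub integrable_condExp.integrableOn (integrable_const _),
      setIntegral_condExp h𝒜 hη hAm]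
    simp
  have h4 : ∫ ω, |g ω| ∂μ = 2 * ∫ ω in A, g ω ∂μ := by
    have : (fun ω => |g ω|) = fun ω => 2 * A.indicator g ω - g ω := by
      ext ω
      by_cases h : 0 < g ω
      · rw [Set.indicator_of_mem (by exact h), abs_of_pos h]; ring
      · rw [Set.indicator_of_notMem (by exact h), abs_of_nonpos (not_lt.mp h)]; ring
    rw [this, integral_sub ((hgi.indicator hAm').const_mul 2) hgi, hg0, integral_const_mul,
      integral_indicator hAm', sub_zero]
  rw [h2, ← h3]
  calc |∫ ω, ξ ω * g ω ∂μ| ≤ ∫ ω, |ξ ω * g ω| ∂μ := abs_integral_le_integral_abs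
    _ ≤ ∫ ω, M * |g ω| ∂μ := by
        refine integral_mono hξg.abs (hgi.abs.const_mul M) fun ω => ?_
        simp only [abs_mul]
        exact mul_le_mul_of_nonneg_right (hξM ω) (abs_nonneg _)
    _ = M * (2 * ∫ ω in A, g ω ∂μ) := by rw [integral_const_mul, h4]
    _ ≤ M * (2 * |∫ ω in A, g ω ∂μ|) := by gcongr; exact le_abs_self _
    _ = _ := by ring

/-- `a` bounds the strong mixing coefficient of `𝒜` and `ℬ`. -/
def AlphaLE (μ : Measure Ω) (𝒜 ℬ : MeasurableSpace Ω) (a : ℝ) : Prop :=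
  ∀ A B : Set Ω, MeasurableSet[𝒜] A → MeasurableSet[ℬ] B →
    |μ.real A * μ.real B - μ.real (A ∩ B)| ≤ a

/-- Averaging is applied twice: ξ gives way to the indicator of some A in 𝒜, then η to that of some
B in ℬ, each at the cost of a factor 2M. What remains is the mixing quantity of A and B. -/
theorem abs_integral_mul_sub_le_of_bounded (h𝒜 : 𝒜 ≤ m₀)
    (hℬ : ℬ ≤ m₀) {a : ℝ} (hα : AlphaLE μ 𝒜 ℬ a) {ξ η : Ω → ℝ} {M : ℝ} (hM : 0 ≤ M)
    (hξ : Measurable[𝒜] ξ) (hη : Measurable[ℬ] η) (hξM : ∀ ω, |ξ ω| ≤ M)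
    (hηM : ∀ ω, |η ω| ≤ M) :
    |∫ ω, ξ ω * η ω ∂μ - (∫ ω, ξ ω ∂μ) * ∫ ω, η ω ∂μ| ≤ 4 * a * M ^ 2 := by
  have hηi : Integrable η μ := Integrable.of_bound (hη.mono hℬ le_rfl).aestronglyMeasurable M
    (Filter.Eventually.of_forall hηM)
  obtain ⟨A, hA, h1⟩ := exists_abs_integral_mul_sub_le h𝒜 hξ hξM hηi
  have hA' : MeasurableSet A := h𝒜 _ hA
  have hAi : Integrable (A.indicator (1 : Ω → ℝ)) μ := (integrable_const (1 : ℝ)).indicator hA'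
  obtain ⟨B, hB, h2⟩ := exists_abs_integral_mul_sub_le hℬ hη hηM hAi
  have hB' : MeasurableSet B := hℬ _ hB
  have h3 : ∫ ω, η ω * A.indicator (1 : Ω → ℝ) ω ∂μ = ∫ ω in A, η ω ∂μ := by
    rw [← integral_indicator hA']
    congr 1; ext ω
    by_cases h : ω ∈ A <;> simp [h]
  have h4 : ∫ ω, A.indicator (1 : Ω → ℝ) ω ∂μ = μ.real A := integral_indicator_one hA'
  have h5 : ∫ ω in B, A.indicator (1 : Ω → ℝ) ω ∂μ = μ.real (A ∩ B) := by
    rw [integral_indicator_one hA', measureReal_restrict_apply hA']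
  rw [h3, h4, h5] at h2
  have h6 := hα A B hA hB
  rw [abs_sub_comm] at h6
  rw [mul_comm (∫ ω, η ω ∂μ)] at h2
  rw [mul_comm (μ.real B)] at h2
  calc _ ≤ _ := h1
    _ ≤ 2 * M * (2 * M * a) := by
        refine mul_le_mul_of_nonneg_left (h2.trans ?_) (by positivity)
        exact mul_le_mul_of_nonneg_left h6 (by positivity)
    _ = _ := by ring

end Mixing

/-! ### Truncation errors -/

section Truncation

/-- Truncation at level `M`. -/
def clip (M x : ℝ) : ℝ := max (-M) (min x M)

theorem measurable_clip (M : ℝ) : Measurable (clip M) := by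
  unfold clip; fun_prop

theorem abs_clip_le {M : ℝ} (hM : 0 ≤ M) (x : ℝ) : |clip M x| ≤ M := by
  rw [clip, abs_le]
  exact ⟨le_max_left _ _, max_le (by linarith) (min_le_right _ _)⟩

theorem clip_of_abs_le {M x : ℝ} (h : |x| ≤ M) : clip M x = x := by
  rw [abs_le] at h
  rw [clip, min_eq_left h.2, max_eq_right h.1]

theorem abs_clip_le_abs {M : ℝ} (hM : 0 ≤ M) (x : ℝ) : |clip M x| ≤ |x| := by
  rcases le_total |x| M with h | h
  · rw [clip_of_abs_le h]
  · exact (abs_clip_le hM x).trans h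

theorem abs_sub_clip_le_abs {M : ℝ} (hM : 0 ≤ M) (x : ℝ) : |x - clip M x| ≤ |x| := by
  rcases le_total x 0 with h | h
  · have h1 : clip M x ≤ 0 := max_le (by linarith) ((min_le_left _ _).trans h)
    have h2 : x ≤ clip M x := by
      unfold clip; rw [min_eq_left (h.trans hM)]; exact le_max_right _ _
    rw [abs_le, abs_of_nonpos h]; constructor <;> linarith
  · have h1 : 0 ≤ clip M x := le_max_of_le_right (le_min h hM)
    have h2 : clip M x ≤ x := max_le (by linarith) (min_le_left _ _)
    rw [abs_le, abs_of_nonneg h]; constructor <;> linarith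

theorem sq_le_rpow_mul {γ M t : ℝ} (hγ : 2 < γ) (hM : 1 ≤ M) (ht : M ≤ t) :
    t ^ 2 ≤ M ^ (2 - γ) * t ^ γ := by
  have ht0 : 0 < t := by linarith
  have h1 : t ^ (2 - γ) ≤ M ^ (2 - γ) :=
    Real.rpow_le_rpow_of_nonpos (by linarith) ht (by linarith)
  calc t ^ 2 = t ^ (2 - γ) * t ^ γ := by
        rw [← Real.rpow_add ht0, sub_add_cancel, Real.rpow_two]
    _ ≤ _ := by gcongr

/-- The error is nonzero only where |x| exceeds M. There the product is at most the square of the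
larger of |x| and |y|, which lies above M, and the power γ - 2 to spare yields the factor M^(2-γ).
-/
theorem abs_sub_clip_mul_le {γ M : ℝ} (hγ : 2 < γ) (hM : 1 ≤ M) (x y : ℝ) :
    |x - clip M x| * |y| ≤ M ^ (2 - γ) * (|x| ^ γ + |y| ^ γ) := by
  have hM0 : 0 ≤ M := by linarith
  have hx := Real.rpow_nonneg (abs_nonneg x) γ
  have hy := Real.rpow_nonneg (abs_nonneg y) γ
  have hMr := Real.rpow_nonneg hM0 (2 - γ)
  rcases le_total |x| M with h | h
  · rw [clip_of_abs_le h, sub_self, abs_zero, zero_mul]; positivity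
  have h1 := abs_sub_clip_le_abs hM0 x
  rcases le_total |y| |x| with h2 | h2
  · have := sq_le_rpow_mul hγ hM h
    nlinarith [abs_nonneg y, abs_nonneg x, mul_nonneg hMr hy]
  · have := sq_le_rpow_mul hγ hM (h.trans h2)
    nlinarith [abs_nonneg y, abs_nonneg x, mul_nonneg hMr hx]

theorem abs_sub_clip_le {γ M : ℝ} (hγ : 2 < γ) (hM : 1 ≤ M) (x : ℝ) :
    |x - clip M x| ≤ M ^ (2 - γ) * |x| ^ γ := by
  have hM0 : 0 ≤ M := by linarith
  have hx := Real.rpow_nonneg (abs_nonneg x) γ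
  have hMr := Real.rpow_nonneg hM0 (2 - γ)
  rcases le_total |x| M with h | h
  · rw [clip_of_abs_le h, sub_self, abs_zero]; positivity
  have h1 := abs_sub_clip_le_abs hM0 x
  have := sq_le_rpow_mul hγ hM h
  nlinarith [abs_nonneg x]

theorem sq_le_one_add_rpow {γ : ℝ} (hγ : 2 < γ) (x : ℝ) : x ^ 2 ≤ 1 + |x| ^ γ := by
  have hx := Real.rpow_nonneg (abs_nonneg x) γ
  rw [← sq_abs]
  rcases le_total |x| 1 with h | h
  · nlinarith [abs_nonneg x]
  · have := sq_le_rpow_mul hγ le_rfl h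
    rw [Real.one_rpow] at this
    linarith

theorem abs_le_one_add_rpow {γ : ℝ} (hγ : 2 < γ) (x : ℝ) : |x| ≤ 1 + |x| ^ γ := by
  have hx := Real.rpow_nonneg (abs_nonneg x) γ
  rcases le_total |x| 1 with h | h
  · linarith
  · have := sq_le_one_add_rpow hγ x
    rw [← sq_abs] at this
    nlinarith

end Truncation

/-! ### Davydov's inequality from moments of order γ -/

section Davydov

open MeasureTheory

variable {Ω : Type*} {𝒜 ℬ : MeasurableSpace Ω} [m₀ : MeasurableSpace Ω] {μ : Measure Ω}

theorem MeanLE.abs_integral_le {f g : Ω → ℝ} {c : ℝ} (hg : MeanLE μ g c) (hf : Measurable f)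
    (h : ∀ ω, |f ω| ≤ g ω) : Integrable f μ ∧ |∫ ω, f ω ∂μ| ≤ c := by
  have hi : Integrable f μ := hg.1.mono' hf.aestronglyMeasurable (Filter.Eventually.of_forall h)
  exact ⟨hi, abs_integral_le_integral_abs.trans ((integral_mono hi.abs hg.1 h).trans hg.2)⟩

theorem MeanLE.nonneg {g : Ω → ℝ} {c : ℝ} (hg : MeanLE μ g c) (h : ∀ ω, 0 ≤ g ω) : 0 ≤ c :=
  (integral_nonneg h).trans hg.2

variable [IsProbabilityMeasure μ]

/-- The constant in the covariance inequality for variables with `γ`-th moments at most `c`. -/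
def covConst (c : ℝ) : ℝ := 4 + 6 * c + 2 * c ^ 2

theorem covConst_nonneg {c : ℝ} (hc : 0 ≤ c) : 0 ≤ covConst c := by
  unfold covConst; positivity

/-- Davydov's covariance inequality. -/
theorem abs_integral_mul_sub_le_of_moment_aux (h𝒜 : 𝒜 ≤ m₀) (hℬ : ℬ ≤ m₀) {γ a c : ℝ}
    (hγ : 2 < γ) (ha : 0 < a) (ha1 : a ≤ 1) (hα : AlphaLE μ 𝒜 ℬ a) {ξ η : Ω → ℝ}
    (hξ : Measurable[𝒜] ξ) (hη : Measurable[ℬ] η) (hξc : MeanLE μ (fun ω => |ξ ω| ^ γ) c)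
    (hηc : MeanLE μ (fun ω => |η ω| ^ γ) c) :
    |∫ ω, ξ ω * η ω ∂μ - (∫ ω, ξ ω ∂μ) * ∫ ω, η ω ∂μ| ≤ covConst c * a ^ (1 - 2 / γ) := by
  have hc : 0 ≤ c := hξc.nonneg fun ω => Real.rpow_nonneg (abs_nonneg _) _
  have hγ0 : 0 < γ := by linarith
  -- This level balances the cost a·M² of the bounded parts against the tail cost M^(2-γ): both
  -- equal a^(1-2/γ).
  set M : ℝ := a ^ (-(1 / γ)) with hMdef
  have hM : 1 ≤ M := Real.one_le_rpow_of_pos_of_le_one_of_nonpos ha ha1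
    (by rw [neg_nonpos]; positivity)
  have hM0 : 0 ≤ M := by linarith
  set τ : ℝ := a ^ (1 - 2 / γ)
  have hM2 : M ^ (2 - γ) = τ := by
    rw [hMdef, ← Real.rpow_mul ha.le]; congr 1; field_simp; ring
  have haM : a * M ^ 2 = τ := by
    rw [hMdef, ← Real.rpow_natCast, ← Real.rpow_mul ha.le]
    nth_rewrite 1 [← Real.rpow_one a]
    rw [← Real.rpow_add ha]; congr 1; push_cast; field_simp; ring
  have hτ : 0 ≤ τ := Real.rpow_nonneg ha.le _
  set ξ₁ : Ω → ℝ := fun ω => clip M (ξ ω) with hξ₁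
  set η₁ : Ω → ℝ := fun ω => clip M (η ω) with hη₁
  have hξm : Measurable ξ := hξ.mono h𝒜 le_rfl
  have hηm : Measurable η := hη.mono hℬ le_rfl
  have hξ₁A : Measurable[𝒜] ξ₁ := (measurable_clip M).comp hξ
  have hη₁B : Measurable[ℬ] η₁ := (measurable_clip M).comp hη
  have hξ₁m : Measurable ξ₁ := hξ₁A.mono h𝒜 le_rfl
  have hη₁m : Measurable η₁ := hη₁B.mono hℬ le_rfl
  have main := abs_integral_mul_sub_le_of_bounded h𝒜 hℬ hα hM0 hξ₁A hη₁B
    (fun ω => abs_clip_le hM0 _) (fun ω => abs_clip_le hM0 _)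
  rw [mul_assoc, haM] at main
  have hone : MeanLE μ (fun _ => (1 : ℝ)) 1 := MeanLE.const 1
  obtain ⟨i1, b1⟩ := ((hξc.add hηc).const_mul hτ).abs_integral_le
    (f := fun ω => (ξ ω - ξ₁ ω) * η ω) ((hξm.sub hξ₁m).mul hηm) fun ω => by
      rw [abs_mul, ← hM2]; exact abs_sub_clip_mul_le hγ hM _ _
  obtain ⟨i2, b2⟩ := ((hηc.add hξc).const_mul hτ).abs_integral_le
    (f := fun ω => ξ₁ ω * (η ω - η₁ ω)) (hξ₁m.mul (hηm.sub hη₁m)) fun ω => by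
      rw [abs_mul, mul_comm, ← hM2]
      exact (mul_le_mul_of_nonneg_left (abs_clip_le_abs hM0 _) (abs_nonneg _)).trans
        (abs_sub_clip_mul_le hγ hM _ _)
  obtain ⟨i3, b3⟩ := (hξc.const_mul hτ).abs_integral_le
    (f := fun ω => ξ ω - ξ₁ ω) (hξm.sub hξ₁m) fun ω => by
      rw [← hM2]; exact abs_sub_clip_le hγ hM _
  obtain ⟨i4, b4⟩ := (hηc.const_mul hτ).abs_integral_le
    (f := fun ω => η ω - η₁ ω) (hηm.sub hη₁m) fun ω => by
      rw [← hM2]; exact abs_sub_clip_le hγ hM _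
  obtain ⟨i5, b5⟩ := (hone.add hηc).abs_integral_le (f := η) hηm
    fun ω => abs_le_one_add_rpow hγ _
  obtain ⟨i6, b6⟩ := (hone.add hξc).abs_integral_le (f := ξ₁) hξ₁m
    fun ω => (abs_clip_le_abs hM0 _).trans (abs_le_one_add_rpow hγ _)
  have i7 : Integrable (fun ω => ξ₁ ω * η₁ ω) μ :=
    Integrable.of_bound (hξ₁m.mul hη₁m).aestronglyMeasurable (M * M)
      (Filter.Eventually.of_forall fun ω => by
        rw [norm_mul]
        exact mul_le_mul (abs_clip_le hM0 _) (abs_clip_le hM0 _) (norm_nonneg _) hM0)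
  have i8 : Integrable ξ μ := by
    have := i3.add i6
    refine this.congr (Filter.Eventually.of_forall fun ω => ?_)
    simp
  have i9 : Integrable η₁ μ := by
    have := i5.sub i4
    refine this.congr (Filter.Eventually.of_forall fun ω => ?_)
    simp
  have e1 : ∫ ω, ξ ω * η ω ∂μ = ∫ ω, ξ₁ ω * η₁ ω ∂μ + ∫ ω, (ξ ω - ξ₁ ω) * η ω ∂μ +
      ∫ ω, ξ₁ ω * (η ω - η₁ ω) ∂μ := by
    have i71 : Integrable (fun ω => ξ₁ ω * η₁ ω + (ξ ω - ξ₁ ω) * η ω) μ := i7.add i1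
    rw [← integral_add i7 i1, ← integral_add i71 i2]
    congr 1; ext ω; ring
  rw [integral_sub i8 i6] at b3
  rw [integral_sub i5 i9] at b4
  rw [e1]
  set P := ∫ ω, ξ₁ ω * η₁ ω ∂μ
  set Q := ∫ ω, (ξ ω - ξ₁ ω) * η ω ∂μ
  set R := ∫ ω, ξ₁ ω * (η ω - η₁ ω) ∂μ
  set x := ∫ ω, ξ ω ∂μ
  set x₁ := ∫ ω, ξ₁ ω ∂μ
  set y := ∫ ω, η ω ∂μ
  set y₁ := ∫ ω, η₁ ω ∂μ
  have p1 : |(x - x₁) * y| ≤ τ * c * (1 + c) := by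
    rw [abs_mul]; exact mul_le_mul b3 b5 (abs_nonneg _) (by positivity)
  have p2 : |x₁ * (y - y₁)| ≤ (1 + c) * (τ * c) := by
    rw [abs_mul]; exact mul_le_mul b6 b4 (abs_nonneg _) (by positivity)
  -- In units of τ the five terms cost 4, 2c, 2c, c(1+c) and c(1+c), which add up to `covConst c`.
  have e2 : P + Q + R - x * y = (P - x₁ * y₁) + Q + R - (x - x₁) * y - x₁ * (y - y₁) := by ring
  rw [e2]
  unfold covConst
  rw [abs_le] at *
  constructor <;> nlinarith

/-- The trivial level 1 turns the mixing inequality into a moment bound on the covariance of an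
arbitrary pair; it serves wherever no time gap is available. -/
theorem AlphaLE.one : AlphaLE μ 𝒜 ℬ 1 := by
  intro A B _ _
  have h1 : μ.real A ≤ 1 := measureReal_le_one
  have h2 : μ.real B ≤ 1 := measureReal_le_one
  have h3 : μ.real (A ∩ B) ≤ 1 := measureReal_le_one
  have h4 : 0 ≤ μ.real A := measureReal_nonneg
  have h5 : 0 ≤ μ.real B := measureReal_nonneg
  have h6 : 0 ≤ μ.real (A ∩ B) := measureReal_nonneg
  rw [abs_le]
  constructor <;> nlinarith

/-- Every b > a is also a mixing bound, with 1 available when b exceeds 1. Letting b decrease to a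
covers a = 0, where the truncation level would be infinite. -/
theorem abs_integral_mul_sub_le_of_moment (h𝒜 : 𝒜 ≤ m₀) (hℬ : ℬ ≤ m₀) {γ a c : ℝ}
    (hγ : 2 < γ) (ha : 0 ≤ a) (hα : AlphaLE μ 𝒜 ℬ a) {ξ η : Ω → ℝ}
    (hξ : Measurable[𝒜] ξ) (hη : Measurable[ℬ] η) (hξc : MeanLE μ (fun ω => |ξ ω| ^ γ) c)
    (hηc : MeanLE μ (fun ω => |η ω| ^ γ) c) :
    |∫ ω, ξ ω * η ω ∂μ - (∫ ω, ξ ω ∂μ) * ∫ ω, η ω ∂μ| ≤ covConst c * a ^ (1 - 2 / γ) := by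
  have hc : 0 ≤ c := hξc.nonneg fun ω => Real.rpow_nonneg (abs_nonneg _) _
  have hexp : 0 < 1 - 2 / γ := by
    rw [sub_pos, div_lt_one (by linarith)]; exact hγ
  have h1 : ∀ b, a < b → |∫ ω, ξ ω * η ω ∂μ - (∫ ω, ξ ω ∂μ) * ∫ ω, η ω ∂μ| ≤
      covConst c * b ^ (1 - 2 / γ) := by
    intro b hb
    rcases le_or_gt b 1 with hb1 | hb1
    · exact abs_integral_mul_sub_le_of_moment_aux h𝒜 hℬ hγ (ha.trans_lt hb) hb1
        (fun A B hA hB => (hα A B hA hB).trans hb.le) hξ hη hξc hηc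
    · refine (abs_integral_mul_sub_le_of_moment_aux h𝒜 hℬ hγ one_pos le_rfl
        AlphaLE.one hξ hη hξc hηc).trans ?_
      refine mul_le_mul_of_nonneg_left ?_ (covConst_nonneg hc)
      exact Real.rpow_le_rpow zero_le_one hb1.le hexp.le
  have hcont : Filter.Tendsto (fun b : ℝ => covConst c * b ^ (1 - 2 / γ))
      (nhdsWithin a (Set.Ioi a)) (nhds (covConst c * a ^ (1 - 2 / γ))) :=
    (((Real.continuous_rpow_const hexp.le).const_mul _).tendsto a).mono_left nhdsWithin_le_nhds
  exact ge_of_tendsto hcont (Filter.eventually_of_mem self_mem_nhdsWithin h1)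

end Davydov

/-! ### Variance of sums over a mixing process -/

section MixingSums

open MeasureTheory ProbabilityTheory

variable {Ω : Type*} [m₀ : MeasurableSpace Ω] {μ : Measure Ω}

theorem mixingCoeff_nonneg (𝒢 : ℤ → MeasurableSpace Ω) (l : ℕ) : 0 ≤ mixingCoeff μ 𝒢 l :=
  Real.sSup_nonneg (by rintro x ⟨-, A, B, -, -, rfl⟩; exact abs_nonneg _)

variable [IsProbabilityMeasure μ]

theorem abs_mul_sub_inter_le_one (A B : Set Ω) :
    |μ.real A * μ.real B - μ.real (A ∩ B)| ≤ 1 :=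
  AlphaLE.one (𝒜 := ⊤) (ℬ := ⊤) A B trivial trivial

theorem alphaLE_mixingCoeff (𝒢 : ℤ → MeasurableSpace Ω) (i : ℤ) (l : ℕ) :
    AlphaLE μ (⨆ (t : ℤ) (_ : t ≤ i), 𝒢 t) (⨆ (t : ℤ) (_ : i + l ≤ t), 𝒢 t)
      (mixingCoeff μ 𝒢 l) := by
  intro A B hA hB
  -- The bound 1 is needed because the real supremum of an unbounded set is 0 by convention.
  refine le_csSup ⟨1, ?_⟩ ⟨i, A, B, hA, hB, rfl⟩
  rintro x ⟨-, A, B, -, -, rfl⟩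
  exact abs_mul_sub_inter_le_one A B

theorem MeanLE.memLp_two {f : Ω → ℝ} (hf : Measurable f) {γ c : ℝ} (hγ : 2 < γ)
    (h : MeanLE μ (fun ω => |f ω| ^ γ) c) : MemLp f 2 μ := by
  rw [memLp_two_iff_integrable_sq hf.aestronglyMeasurable]
  refine ((integrable_const (1 : ℝ)).add h.1).mono' (hf.pow_const 2).aestronglyMeasurable
    (Filter.Eventually.of_forall fun ω => ?_)
  rw [Real.norm_of_nonneg (sq_nonneg _)]
  exact sq_le_one_add_rpow hγ _

/-- The bound for the correlation at lag `d` of a moving window of length `h`. -/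
def lagBound (ρ : ℕ → ℝ) (h d : ℕ) : ℝ := if d ≤ h then 1 else ρ (d - h)

theorem sum_lagBound_le {ρ : ℕ → ℝ} (hρ : ∀ l, 0 ≤ ρ l) {K : ℝ}
    (hs : Summable fun l => ρ (l + 1)) (hK : ∑' l, ρ (l + 1) ≤ K) (h : ℕ) (F : Finset ℕ) :
    ∑ d ∈ F, lagBound ρ h d ≤ (h + 1) + K := by
  rw [← Finset.sum_filter_add_sum_filter_not F (fun d => d ≤ h)]
  refine add_le_add ?_ ?_
  · calc ∑ d ∈ F with d ≤ h, lagBound ρ h d = ∑ d ∈ F with d ≤ h, (1 : ℝ) :=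
          Finset.sum_congr rfl fun d hd => if_pos (Finset.mem_filter.mp hd).2
      _ = ((F.filter fun d => d ≤ h).card : ℝ) := by simp
      _ ≤ ((Finset.range (h + 1)).card : ℝ) := by
          gcongr
          intro d hd
          simp only [Finset.mem_filter, Finset.mem_range] at hd ⊢
          omega
      _ = h + 1 := by simp
  · calc ∑ d ∈ F with ¬ d ≤ h, lagBound ρ h d
        = ∑ d ∈ F with ¬ d ≤ h, ρ (d - h - 1 + 1) := by
          refine Finset.sum_congr rfl fun d hd => ?_
          have hd' := (Finset.mem_filter.mp hd).2
          rw [lagBound, if_neg hd']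
          congr 1; omega
      _ = ∑ l ∈ (F.filter fun d => ¬ d ≤ h).image (fun d => d - h - 1), ρ (l + 1) := by
          rw [Finset.sum_image]
          intro x hx y hy hxy
          simp only [Finset.coe_filter, Set.mem_ofPred_eq] at hx hy hxy
          omega
      _ ≤ ∑' l, ρ (l + 1) := hs.sum_le_tsum _ fun l _ => hρ _
      _ ≤ K := hK

theorem sum_lagBound_natAbs_le {ρ : ℕ → ℝ} (hρ : ∀ l, 0 ≤ ρ l) {K : ℝ}
    (hs : Summable fun l => ρ (l + 1)) (hK : ∑' l, ρ (l + 1) ≤ K) (h : ℕ) (S : Finset ℤ)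
    (t : ℤ) : ∑ s ∈ S, lagBound ρ h (t - s).natAbs ≤ 2 * ((h + 1) + K) := by
  -- On each side of `t` a given distance occurs at most once, so the sum over times is at most two
  -- sums over lags.
  rw [← Finset.sum_filter_add_sum_filter_not S (fun s => s ≤ t), two_mul]
  refine add_le_add ?_ ?_
  · rw [← Finset.sum_image (f := lagBound ρ h) (g := fun s => (t - s).natAbs)]
    · exact sum_lagBound_le hρ hs hK h _
    · intro x hx y hy hxy
      simp only [Finset.coe_filter, Set.mem_ofPred_eq] at hx hy hxy
      omega
  · rw [← Finset.sum_image (f := lagBound ρ h) (g := fun s => (t - s).natAbs)]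
    · exact sum_lagBound_le hρ hs hK h _
    · intro x hx y hy hxy
      simp only [Finset.coe_filter, Set.mem_ofPred_eq] at hx hy hxy
      omega

variable {𝒢 : ℤ → MeasurableSpace Ω} {γ c : ℝ} {h : ℕ} {Z : ℤ → Ω → ℝ}

theorem abs_covariance_le_of_le (h𝒢 : ∀ t, 𝒢 t ≤ m₀) (hγ : 2 < γ) {t s : ℤ} (hts : t ≤ s)
    (hZt : Measurable[𝒢 t ⊔ 𝒢 (t + h)] (Z t)) (hZs : Measurable[𝒢 s ⊔ 𝒢 (s + h)] (Z s))
    (hct : MeanLE μ (fun ω => |Z t ω| ^ γ) c) (hcs : MeanLE μ (fun ω => |Z s ω| ^ γ) c) :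
    |cov[Z t, Z s; μ]| ≤ covConst c *
      lagBound (fun l => mixingCoeff μ 𝒢 l ^ (1 - 2 / γ)) h (s - t).natAbs := by
  have hZt' : Measurable (Z t) := hZt.mono (sup_le (h𝒢 _) (h𝒢 _)) le_rfl
  have hZs' : Measurable (Z s) := hZs.mono (sup_le (h𝒢 _) (h𝒢 _)) le_rfl
  rw [covariance_eq_sub (hct.memLp_two hZt' hγ) (hcs.memLp_two hZs' hγ)]
  simp only [Pi.mul_apply]
  unfold lagBound
  split_ifs with hd
  · have := abs_integral_mul_sub_le_of_moment (μ := μ) (sup_le (h𝒢 _) (h𝒢 _))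
      (sup_le (h𝒢 _) (h𝒢 _)) hγ zero_le_one AlphaLE.one hZt hZs hct hcs
    rwa [Real.one_rpow] at this
  -- `Z t` depends on times up to `t + h` and `Z s` on times from `s` on, so the gap that mixing
  -- sees is the distance minus the window length.
  · have hl : s = (t + h) + ((s - t).natAbs - h : ℕ) := by omega
    set l := (s - t).natAbs - h
    refine abs_integral_mul_sub_le_of_moment (iSup₂_le fun u _ => h𝒢 u)
      (iSup₂_le fun u _ => h𝒢 u) hγ (mixingCoeff_nonneg _ _)
      (alphaLE_mixingCoeff 𝒢 (t + h) l) (hZt.mono (sup_le ?_ ?_) le_rfl)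
      (hZs.mono (sup_le ?_ ?_) le_rfl) hct hcs
    · exact le_iSup₂_of_le t (by omega) le_rfl
    · exact le_iSup₂_of_le (t + h) le_rfl le_rfl
    · exact le_iSup₂_of_le s (by omega) le_rfl
    · exact le_iSup₂_of_le (s + h) (by omega) le_rfl

theorem abs_covariance_le (h𝒢 : ∀ t, 𝒢 t ≤ m₀) (hγ : 2 < γ) {t s : ℤ}
    (hZt : Measurable[𝒢 t ⊔ 𝒢 (t + h)] (Z t)) (hZs : Measurable[𝒢 s ⊔ 𝒢 (s + h)] (Z s))
    (hct : MeanLE μ (fun ω => |Z t ω| ^ γ) c) (hcs : MeanLE μ (fun ω => |Z s ω| ^ γ) c) :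
    |cov[Z t, Z s; μ]| ≤ covConst c *
      lagBound (fun l => mixingCoeff μ 𝒢 l ^ (1 - 2 / γ)) h (t - s).natAbs := by
  rcases le_total t s with hts | hts
  · rw [show (t - s).natAbs = (s - t).natAbs by omega]
    exact abs_covariance_le_of_le h𝒢 hγ hts hZt hZs hct hcs
  · rw [covariance_comm]
    exact abs_covariance_le_of_le h𝒢 hγ hts hZs hZt hcs hct

/-- The variance of a sum over a moving window of a strongly mixing process grows at most linearly
in the number of summands. -/
theorem meanLE_sq_sum_sub (h𝒢 : ∀ t, 𝒢 t ≤ m₀) (hγ : 2 < γ) {K : ℝ}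
    (hs : Summable fun l : ℕ => mixingCoeff μ 𝒢 (l + 1) ^ (1 - 2 / γ))
    (hK : ∑' l : ℕ, mixingCoeff μ 𝒢 (l + 1) ^ (1 - 2 / γ) ≤ K) (hc : 0 ≤ c) (S : Finset ℤ)
    (hZ : ∀ t ∈ S, Measurable[𝒢 t ⊔ 𝒢 (t + h)] (Z t))
    (hZc : ∀ t ∈ S, MeanLE μ (fun ω => |Z t ω| ^ γ) c) :
    MeanLE μ (fun ω => (∑ t ∈ S, (Z t ω - ∫ ω', Z t ω' ∂μ)) ^ 2)
      (S.card * (covConst c * (2 * ((h + 1) + K)))) := by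
  have hmem : ∀ t ∈ S, MemLp (fun ω => Z t ω - ∫ ω', Z t ω' ∂μ) 2 μ := fun t ht =>
    ((hZc t ht).memLp_two ((hZ t ht).mono (sup_le (h𝒢 _) (h𝒢 _)) le_rfl) hγ).sub
      (memLp_const _)
  have hexp : (fun ω => (∑ t ∈ S, (Z t ω - ∫ ω', Z t ω' ∂μ)) ^ 2) = fun ω =>
      ∑ t ∈ S, ∑ s ∈ S, (Z t ω - ∫ ω', Z t ω' ∂μ) * (Z s ω - ∫ ω', Z s ω' ∂μ) := by
    ext ω; rw [sq, Finset.sum_mul_sum]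
  rw [hexp]
  have hcov : ∀ t ∈ S, ∀ s ∈ S,
      MeanLE μ (fun ω => (Z t ω - ∫ ω', Z t ω' ∂μ) * (Z s ω - ∫ ω', Z s ω' ∂μ)) (covConst c *
        lagBound (fun l => mixingCoeff μ 𝒢 l ^ (1 - 2 / γ)) h (t - s).natAbs) :=
    fun t ht s hs' => ⟨(hmem t ht).integrable_mul (hmem s hs'), (le_abs_self _).trans
      (abs_covariance_le h𝒢 hγ (hZ t ht) (hZ s hs') (hZc t ht) (hZc s hs'))⟩
  have hsum := MeanLE.sum S fun t ht => MeanLE.sum S (hcov t ht)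
  refine hsum.mono ?_
  rw [← nsmul_eq_mul]
  refine Finset.sum_le_card_nsmul _ _ _ fun t ht => ?_
  rw [← Finset.mul_sum]
  refine mul_le_mul_of_nonneg_left ?_ (covConst_nonneg hc)
  have hρ : ∀ l, 0 ≤ mixingCoeff μ 𝒢 l ^ (1 - 2 / γ) :=
    fun l => Real.rpow_nonneg (mixingCoeff_nonneg _ _) _
  exact sum_lagBound_natAbs_le (ρ := fun l => mixingCoeff μ 𝒢 l ^ (1 - 2 / γ)) hρ hs hK h S t

/-- The mean square error of lagged products of two adapted processes. -/
theorem meanLE_sq_sum_mul_sub (h𝒢 : ∀ t, 𝒢 t ≤ m₀) (hγ : 2 < γ) {K : ℝ}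
    (hs : Summable fun l : ℕ => mixingCoeff μ 𝒢 (l + 1) ^ (1 - 2 / γ))
    (hK : ∑' l : ℕ, mixingCoeff μ 𝒢 (l + 1) ^ (1 - 2 / γ) ≤ K) (hc : 0 ≤ c) (S : Finset ℤ)
    {ξ η : ℤ → Ω → ℝ} (hξ : ∀ t ∈ S, Measurable[𝒢 t] (ξ t))
    (hη : ∀ t ∈ S, Measurable[𝒢 (t + h)] (η (t + h))) {a b : ℝ} (ha : 0 < a) (hb : 0 < b)
    (hξc : ∀ t ∈ S, MeanLE μ (fun ω => |ξ t ω / a| ^ (2 * γ)) c)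
    (hηc : ∀ t ∈ S, MeanLE μ (fun ω => |η (t + h) ω / b| ^ (2 * γ)) c) :
    MeanLE μ (fun ω => (∑ t ∈ S, (ξ t ω * η (t + h) ω -
        ∫ ω', ξ t ω' * η (t + h) ω' ∂μ)) ^ 2)
      (a ^ 2 * b ^ 2 * (S.card * (covConst (2 * c) * (2 * ((h + 1) + K))))) := by
  -- Dividing by `a` and `b` keeps the variance constant free of the scale of the processes;
  -- homogeneity restores the factor a²b².
  set Z : ℤ → Ω → ℝ := fun t ω => (ξ t ω / a) * (η (t + h) ω / b) with hZdef
  have hZ : ∀ t ∈ S, Measurable[𝒢 t ⊔ 𝒢 (t + h)] (Z t) := fun t ht =>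
    (((hξ t ht).mono le_sup_left le_rfl).div_const a).mul
      (((hη t ht).mono le_sup_right le_rfl).div_const b)
  have hZ' : ∀ t ∈ S, Measurable (Z t) := fun t ht =>
    (hZ t ht).mono (sup_le (h𝒢 _) (h𝒢 _)) le_rfl
  -- Moments of order 2γ of the factors give moments of order γ of the product, as Davydov's
  -- inequality requires.
  have hpt : ∀ x y : ℝ, |x * y| ^ γ ≤ |x| ^ (2 * γ) + |y| ^ (2 * γ) := by
    intro x y
    rw [abs_mul, Real.mul_rpow (abs_nonneg _) (abs_nonneg _), mul_comm 2 γ,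
      Real.rpow_mul (abs_nonneg _), Real.rpow_mul (abs_nonneg _), Real.rpow_two, Real.rpow_two]
    have := Real.rpow_nonneg (abs_nonneg x) γ
    have := Real.rpow_nonneg (abs_nonneg y) γ
    nlinarith [sq_nonneg (|x| ^ γ - |y| ^ γ)]
  have hZc : ∀ t ∈ S, MeanLE μ (fun ω => |Z t ω| ^ γ) (2 * c) := fun t ht => by
    refine (((hξc t ht).add (hηc t ht)).mono (by linarith)).of_le ?_
      (fun ω => Real.rpow_nonneg (abs_nonneg _) _) fun ω => hpt _ _
    exact (measurable_norm.comp (hZ' t ht)).pow_const γ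
  have main := (meanLE_sq_sum_sub h𝒢 hγ hs hK (by linarith) S hZ hZc).const_mul
    (a := a ^ 2 * b ^ 2) (by positivity)
  convert main using 2 with ω
  rw [← mul_pow, ← mul_pow, Finset.mul_sum]
  congr 1
  refine Finset.sum_congr rfl fun t _ => ?_
  rw [mul_sub, ← integral_const_mul]
  congr 1
  · simp only [hZdef]; field_simp
  · congr 1; ext ω'; simp only [hZdef]; field_simp

end MixingSums

/-! ### Lagged products of matrix series -/

/-- `(T-h)⁻¹ ∑_{t=1}^{T-h} V_{t,ui} V_{t+h,vj}`. -/
def lagMean {a b : ℕ} (V : ℤ → Matrix (Fin a) (Fin b) ℝ) (T h : ℕ) (u : Fin a) (i : Fin b)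
    (v : Fin a) (j : Fin b) : ℝ :=
  ((T : ℝ) - h)⁻¹ * ∑ t ∈ Finset.Icc (1 : ℤ) ((T : ℤ) - h), V t u i * V (t + h) v j

theorem sampleM_eq_gramM {a b : ℕ} (V : ℤ → Matrix (Fin a) (Fin b) ℝ) (T h₀ : ℕ) :
    sampleM V T h₀ = gramM (fun h u i v j => lagMean V T h u i v j) h₀ := by
  have : ∀ h i j, sampleAutocov V T h i j = Matrix.of fun u v => lagMean V T h u i v j := by
    intro h i j
    ext u v
    simp [sampleAutocov, lagMean, Matrix.sum_apply]
  simp only [sampleM, gramM, this]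

/-- M₁ and M₂ unfold the same array along rows or along columns, so one norm estimate serves both.
-/
theorem frobSq_transpose {a b : ℕ} (N : ℕ → Fin a → Fin b → Fin a → Fin b → ℝ) (h₀ : ℕ) :
    frobSq (fun h i u j v => N h u i v j) h₀ = frobSq N h₀ := by
  refine Finset.sum_congr rfl fun h _ => ?_
  rw [Finset.sum_comm]
  refine Finset.sum_congr rfl fun u _ => Finset.sum_congr rfl fun i _ => ?_
  rw [Finset.sum_comm]

/-- `∑_{t=1}^T ‖V_t‖_F²`. -/
def energy {a b : ℕ} (V : ℤ → Matrix (Fin a) (Fin b) ℝ) (T : ℕ) : ℝ :=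
  ∑ t ∈ Finset.Icc (1 : ℤ) T, ∑ u, ∑ i, V t u i ^ 2

theorem energy_nonneg {a b : ℕ} (V : ℤ → Matrix (Fin a) (Fin b) ℝ) (T : ℕ) : 0 ≤ energy V T :=
  Finset.sum_nonneg fun _ _ => Finset.sum_nonneg fun _ _ => Finset.sum_nonneg fun _ _ =>
    sq_nonneg _

theorem energy_eq {a b : ℕ} (V : ℤ → Matrix (Fin a) (Fin b) ℝ) (T : ℕ) :
    energy V T = ∑ u, ∑ i, ∑ t ∈ Finset.Icc (1 : ℤ) T, V t u i ^ 2 := by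
  rw [energy, Finset.sum_comm]
  refine Finset.sum_congr rfl fun u _ => ?_
  rw [Finset.sum_comm]

/-- Cauchy–Schwarz in time for each entry; the indices `(u, i)` and `(v, j)` then separate and the
sum factors. The lag only shifts the time range within the sample. -/
theorem sum_sq_sum_mul_le {a b : ℕ} (V V' : ℤ → Matrix (Fin a) (Fin b) ℝ) (T h : ℕ) :
    ∑ u, ∑ i, ∑ v, ∑ j, (∑ t ∈ Finset.Icc (1 : ℤ) ((T : ℤ) - h), V t u i * V' (t + h) v j) ^ 2 ≤
      energy V T * energy V' T := by
  have hle1 : ∀ u i, ∑ t ∈ Finset.Icc (1 : ℤ) ((T : ℤ) - h), V t u i ^ 2 ≤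
      ∑ t ∈ Finset.Icc (1 : ℤ) T, V t u i ^ 2 := fun u i =>
    Finset.sum_le_sum_of_subset_of_nonneg (Finset.Icc_subset_Icc le_rfl (by omega))
      fun _ _ _ => sq_nonneg _
  have hle2 : ∀ v j, ∑ t ∈ Finset.Icc (1 : ℤ) ((T : ℤ) - h), V' (t + h) v j ^ 2 ≤
      ∑ t ∈ Finset.Icc (1 : ℤ) T, V' t v j ^ 2 := fun v j => by
    rw [← Finset.sum_image (f := fun t => V' t v j ^ 2) (g := fun t => t + (h : ℤ))
      (fun x _ y _ hxy => by simpa using hxy)]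
    refine Finset.sum_le_sum_of_subset_of_nonneg ?_ fun _ _ _ => sq_nonneg _
    intro x hx
    simp only [Finset.mem_image, Finset.mem_Icc] at hx ⊢
    obtain ⟨y, hy, rfl⟩ := hx
    omega
  rw [energy_eq, energy_eq, Finset.sum_mul]
  refine Finset.sum_le_sum fun u _ => ?_
  rw [Finset.sum_mul]
  refine Finset.sum_le_sum fun i _ => ?_
  rw [Finset.mul_sum]
  refine Finset.sum_le_sum fun v _ => ?_
  rw [Finset.mul_sum]
  refine Finset.sum_le_sum fun j _ => ?_
  refine (Finset.sum_mul_sq_le_sq_mul_sq _ _ _).trans ?_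
  exact mul_le_mul (hle1 u i) (hle2 v j) (Finset.sum_nonneg fun _ _ => sq_nonneg _)
    (Finset.sum_nonneg fun _ _ => sq_nonneg _)

theorem inv_sub_le {T h h₀ : ℕ} (hT : h₀ < T) (hh : h ≤ h₀) :
    ((T : ℝ) - h)⁻¹ ≤ (h₀ + 1) / T := by
  have h1 : (h₀ : ℝ) + 1 ≤ T := by exact_mod_cast hT
  have h2 : (h : ℝ) ≤ h₀ := by exact_mod_cast hh
  have h3 : (0 : ℝ) ≤ h := by positivity
  have h4 : (0 : ℝ) < T - h := by linarith
  rw [inv_eq_one_div, div_le_div_iff₀ h4 (by linarith)]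
  nlinarith

/-- Expanding the products leaves the errors WU, UW and UU, each bounded by Cauchy–Schwarz. No
cancellation is needed, because in the application the energy of U is smaller than that of W by a
factor of order T. -/
theorem frobSq_lagMean_sub_le {a b : ℕ} (W U : ℤ → Matrix (Fin a) (Fin b) ℝ) {T h₀ : ℕ}
    (hT : h₀ < T) :
    frobSq (fun h u i v j => lagMean (fun t => W t - U t) T h u i v j - lagMean W T h u i v j) h₀ ≤
      h₀ * (((h₀ + 1) / T) ^ 2 * (3 * (2 * energy W T * energy U T + energy U T ^ 2))) := by
  unfold frobSq
  have hE : 0 ≤ 3 * (2 * energy W T * energy U T + energy U T ^ 2) := by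
    have := energy_nonneg W T; have := energy_nonneg U T; positivity
  have hcard : ∀ c : ℝ, h₀ * c = (Finset.Icc 1 h₀).card • c := by simp
  rw [hcard]
  refine Finset.sum_le_card_nsmul _ _ _ fun h hh => ?_
  have hh0 : h ≤ h₀ := (Finset.mem_Icc.mp hh).2
  set r : ℝ := ((T : ℝ) - h)⁻¹ with hr
  have hr0 : 0 ≤ r := by
    rw [hr, inv_nonneg, sub_nonneg]; exact_mod_cast (hh0.trans hT.le)
  have hr1 : r ≤ (h₀ + 1) / T := inv_sub_le hT hh0
  set I := Finset.Icc (1 : ℤ) ((T : ℤ) - h) with hI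
  have hpt : ∀ u i v j,
      (lagMean (fun t => W t - U t) T h u i v j - lagMean W T h u i v j) ^ 2 ≤
      r ^ 2 * 3 * ((∑ t ∈ I, W t u i * U (t + h) v j) ^ 2 +
        (∑ t ∈ I, U t u i * W (t + h) v j) ^ 2 + (∑ t ∈ I, U t u i * U (t + h) v j) ^ 2) := by
    intro u i v j
    have : lagMean (fun t => W t - U t) T h u i v j - lagMean W T h u i v j =
        r * (-(∑ t ∈ I, W t u i * U (t + h) v j) - (∑ t ∈ I, U t u i * W (t + h) v j) +
          ∑ t ∈ I, U t u i * U (t + h) v j) := by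
      simp only [lagMean, ← hI, ← hr, ← mul_sub, ← Finset.sum_sub_distrib,
        ← Finset.sum_add_distrib, ← Finset.sum_neg_distrib]
      congr 1
      refine Finset.sum_congr rfl fun t _ => ?_
      simp only [Matrix.sub_apply]; ring
    rw [this, mul_pow, mul_assoc]
    refine mul_le_mul_of_nonneg_left ?_ (sq_nonneg _)
    generalize ∑ t ∈ I, W t u i * U (t + h) v j = x
    generalize ∑ t ∈ I, U t u i * W (t + h) v j = y
    generalize ∑ t ∈ I, U t u i * U (t + h) v j = z
    nlinarith [sq_nonneg (x - y), sq_nonneg (x + z), sq_nonneg (y + z)]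
  calc _ ≤ ∑ u, ∑ i, ∑ v, ∑ j, r ^ 2 * 3 * ((∑ t ∈ I, W t u i * U (t + h) v j) ^ 2 +
        (∑ t ∈ I, U t u i * W (t + h) v j) ^ 2 + (∑ t ∈ I, U t u i * U (t + h) v j) ^ 2) :=
        Finset.sum_le_sum fun u _ => Finset.sum_le_sum fun i _ => Finset.sum_le_sum fun v _ =>
          Finset.sum_le_sum fun j _ => hpt u i v j
    _ = r ^ 2 * 3 * (∑ u, ∑ i, ∑ v, ∑ j, (∑ t ∈ I, W t u i * U (t + h) v j) ^ 2 +
        ∑ u, ∑ i, ∑ v, ∑ j, (∑ t ∈ I, U t u i * W (t + h) v j) ^ 2 +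
        ∑ u, ∑ i, ∑ v, ∑ j, (∑ t ∈ I, U t u i * U (t + h) v j) ^ 2) := by
        simp only [← Finset.mul_sum, Finset.sum_add_distrib]
    _ ≤ r ^ 2 * 3 * (energy W T * energy U T + energy U T * energy W T +
          energy U T * energy U T) := by
        gcongr <;> exact sum_sq_sum_mul_le _ _ T h
    _ = r ^ 2 * (3 * (2 * energy W T * energy U T + energy U T ^ 2)) := by ring
    _ ≤ _ := by gcongr

theorem frobSq_sub_le {a b : ℕ} (N₁ N₂ N₃ : ℕ → Fin a → Fin b → Fin a → Fin b → ℝ) (h₀ : ℕ) :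
    frobSq (fun h u i v j => N₁ h u i v j - N₃ h u i v j) h₀ ≤
      2 * frobSq (fun h u i v j => N₁ h u i v j - N₂ h u i v j) h₀ +
      2 * frobSq (fun h u i v j => N₂ h u i v j - N₃ h u i v j) h₀ := by
  simp only [frobSq, Finset.mul_sum, ← Finset.sum_add_distrib]
  refine Finset.sum_le_sum fun h _ => Finset.sum_le_sum fun u _ => Finset.sum_le_sum fun i _ =>
    Finset.sum_le_sum fun v _ => Finset.sum_le_sum fun j _ => ?_
  nlinarith [sq_nonneg (N₁ h u i v j - 2 * N₂ h u i v j + N₃ h u i v j)]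

/-! ### Least squares -/

theorem isUnit_det_of_quadratic_ge {m : ℕ} {H : Matrix (Fin m) (Fin m) ℝ} {l : ℝ} (hl : 0 < l)
    (hH : ∀ x, l * (x ⬝ᵥ x) ≤ x ⬝ᵥ H *ᵥ x) : IsUnit H.det := by
  rw [← Matrix.isUnit_iff_isUnit_det, ← Matrix.mulVec_injective_iff_isUnit]
  rw [← Matrix.coe_mulVecLin, ← LinearMap.ker_eq_bot, LinearMap.ker_eq_bot']
  intro x hx
  have h1 := hH x
  rw [Matrix.mulVecLin_apply] at hx
  rw [hx, dotProduct_zero] at h1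
  have h2 : x ⬝ᵥ x = 0 :=
    le_antisymm (nonpos_of_mul_nonpos_right h1 hl) (dotProduct_self_nonneg_real x)
  exact dotProduct_self_eq_zero.mp h2

/-- The mean of `X_t X_tᵀ`. -/
def gramMean {m q : ℕ} (X : ℤ → Matrix (Fin m) (Fin q) ℝ) (T : ℕ) : Matrix (Fin m) (Fin m) ℝ :=
  (T : ℝ)⁻¹ • ∑ t ∈ Finset.Icc (1 : ℤ) T, X t * (X t)ᵀ

/-- The mean of `W_t X_tᵀ`. -/
def crossMean {p m q : ℕ} (W : ℤ → Matrix (Fin p) (Fin q) ℝ) (X : ℤ → Matrix (Fin m) (Fin q) ℝ)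
    (T : ℕ) : Matrix (Fin p) (Fin m) ℝ :=
  (T : ℝ)⁻¹ • ∑ t ∈ Finset.Icc (1 : ℤ) T, W t * (X t)ᵀ

theorem quadratic_gramMean {m q : ℕ} (X : ℤ → Matrix (Fin m) (Fin q) ℝ) (T : ℕ)
    (x : Fin m → ℝ) :
    x ⬝ᵥ gramMean X T *ᵥ x =
      (T : ℝ)⁻¹ * ∑ t ∈ Finset.Icc (1 : ℤ) T, ∑ i, (∑ a, x a * X t a i) ^ 2 := by
  rw [gramMean, Matrix.smul_mulVec, dotProduct_smul, smul_eq_mul, Matrix.sum_mulVec,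
    dotProduct_sum]
  congr 1
  refine Finset.sum_congr rfl fun t _ => ?_
  rw [← Matrix.mulVec_mulVec, Matrix.dotProduct_mulVec, Matrix.mulVec_transpose]
  simp [dotProduct, Matrix.vecMul, sq]

/-- With Δ = GH⁻¹ the energy is T times the sum over rows of Δ_u H Δ_uᵀ, and ΔH = G turns each of
these forms into G_u·Δ_u. Cauchy–Schwarz and the lower bound on H then bound the form by itself. -/
theorem energy_regression_le {p m q : ℕ} (W : ℤ → Matrix (Fin p) (Fin q) ℝ)
    (X : ℤ → Matrix (Fin m) (Fin q) ℝ) {T : ℕ} (hT : 0 < T) {l : ℝ} (hl : 0 < l)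
    (hH : ∀ x, l * (x ⬝ᵥ x) ≤ x ⬝ᵥ gramMean X T *ᵥ x) :
    energy (fun t => (crossMean W X T * (gramMean X T)⁻¹) * X t) T ≤
      T / l * ∑ u, ∑ a, crossMean W X T u a ^ 2 := by
  set H := gramMean X T with hHdef
  set G := crossMean W X T
  set Δ := G * H⁻¹ with hΔ
  have hT' : (0 : ℝ) < T := by exact_mod_cast hT
  have hΔH : Δ * H = G := by
    rw [hΔ, Matrix.mul_assoc, Matrix.nonsing_inv_mul _ (isUnit_det_of_quadratic_ge hl hH),
      Matrix.mul_one]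
  have hrow : ∀ u, Δ u ⬝ᵥ H *ᵥ Δ u ≤ l⁻¹ * ∑ a, G u a ^ 2 := by
    intro u
    have h1 : Δ u ⬝ᵥ H *ᵥ Δ u = G u ⬝ᵥ Δ u := by
      rw [Matrix.dotProduct_mulVec]
      congr 1
      rw [← hΔH]; rfl
    have h2 : (G u ⬝ᵥ Δ u) ^ 2 ≤ (∑ a, G u a ^ 2) * (Δ u ⬝ᵥ Δ u) := by
      have := Finset.sum_mul_sq_le_sq_mul_sq Finset.univ (G u) (Δ u)
      simpa [dotProduct, sq] using this
    have h3 := hH (Δ u)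
    have h4 : 0 ≤ ∑ a, G u a ^ 2 := Finset.sum_nonneg fun _ _ => sq_nonneg _
    rw [h1] at h3 ⊢
    have h5 := dotProduct_self_nonneg_real (Δ u)
    rw [inv_mul_eq_div, le_div_iff₀ hl]
    -- For Q = G_u·Δ_u one has Q² ≤ |G_u|²|Δ_u|² ≤ |G_u|² Q / l; dividing by Q requires Q > 0.
    rcases (mul_nonneg hl.le h5).trans h3 |>.eq_or_lt with h6 | h6
    · rw [← h6, zero_mul]; exact h4
    · nlinarith
  have henergy : energy (fun t => Δ * X t) T = ∑ u, T * (Δ u ⬝ᵥ H *ᵥ Δ u) := by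
    rw [energy, Finset.sum_comm]
    refine Finset.sum_congr rfl fun u _ => ?_
    rw [hHdef, quadratic_gramMean, ← mul_assoc, mul_inv_cancel₀ hT'.ne', one_mul]
    rfl
  rw [henergy]
  calc _ ≤ ∑ u, T * (l⁻¹ * ∑ a, G u a ^ 2) := Finset.sum_le_sum fun u _ =>
        mul_le_mul_of_nonneg_left (hrow u) hT'.le
    _ = _ := by rw [Finset.mul_sum]; refine Finset.sum_congr rfl fun u _ => ?_; ring

theorem FactorModel.Y_eq {Ω : Type*} {p q m k r : ℕ} (D : FactorModel Ω p q m k r) (t : ℤ)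
    (ω : Ω) : D.Y t ω = D.A * D.X t ω + D.W t ω := by
  rw [FactorModel.Y, FactorModel.W, add_assoc]

/-- When the Gram matrix is invertible the coefficient `A` cancels: the estimation error is the
regression of W on X. -/
theorem FactorModel.WHat_eq {Ω : Type*} {p q m k r : ℕ} (D : FactorModel Ω p q m k r)
    (T : ℕ) (ω : Ω) (h : IsUnit (gramMean (fun t => D.X t ω) T).det) (t : ℤ) :
    D.WHat T t ω = D.W t ω - (crossMean (fun t => D.W t ω) (fun t => D.X t ω) T *
      (gramMean (fun t => D.X t ω) T)⁻¹) * D.X t ω := by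
  have hA : D.AHat T ω = D.A + crossMean (fun t => D.W t ω) (fun t => D.X t ω) T *
      (gramMean (fun t => D.X t ω) T)⁻¹ := by
    have h1 : (T : ℝ)⁻¹ • ∑ t ∈ Finset.Icc (1 : ℤ) T, D.Y t ω * (D.X t ω)ᵀ =
        D.A * gramMean (fun t => D.X t ω) T +
          crossMean (fun t => D.W t ω) (fun t => D.X t ω) T := by
      simp only [FactorModel.Y_eq, gramMean, crossMean, Matrix.add_mul, Finset.sum_add_distrib,
        smul_add, Matrix.mul_assoc, Matrix.mul_smul, Matrix.mul_sum]
    have h2 : (T : ℝ)⁻¹ • ∑ t ∈ Finset.Icc (1 : ℤ) T, D.X t ω * (D.X t ω)ᵀ =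
        gramMean (fun t => D.X t ω) T := rfl
    rw [FactorModel.AHat, h1, h2, Matrix.add_mul, Matrix.mul_assoc, Matrix.mul_nonsing_inv _ h, Matrix.mul_one]
  rw [FactorModel.WHat, hA, FactorModel.Y_eq, Matrix.add_mul]
  abel

open MeasureTheory ProbabilityTheory

/-! ### Moment bounds for a single model -/

/-- The non-asymptotic form of the assumptions for a single model, with moment bound `c` and mixing
bound `K`. -/
structure FactorModel.IsRegular {Ω : Type*} [MeasurableSpace Ω] {p q m k r : ℕ}
    (D : FactorModel Ω p q m k r) (μ : Measure Ω) (T : ℕ) (γ c K : ℝ) : Prop where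
  meas : D.Measurability
  noise : D.WhiteNoise μ T
  uncorr : D.Uncorrelated μ T
  two_lt : 2 < γ
  nonneg : 0 ≤ c
  moment : ∀ t ∈ Finset.Icc (1 : ℤ) T,
    (∀ i j, MeanLE μ (fun ω => |D.F t ω i j| ^ (2 * γ)) c) ∧
    (∀ l g, MeanLE μ (fun ω => |D.X t ω l g| ^ (2 * γ)) c) ∧
    (∀ u g, MeanLE μ (fun ω => |D.E t ω u g| ^ (2 * γ)) c)
  summable : Summable fun l : ℕ => mixingCoeff μ D.sigmaAt (l + 1) ^ (1 - 2 / γ)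
  tsum_le : ∑' l : ℕ, mixingCoeff μ D.sigmaAt (l + 1) ^ (1 - 2 / γ) ≤ K

namespace FactorModel

variable {Ω : Type*} {p q m k r : ℕ} (D : FactorModel Ω p q m k r)

/-- The `ℓ¹` norm of a row of the front loadings. -/
def rowWeight (u : Fin p) : ℝ := ∑ a, |D.R u a|

/-- The `ℓ¹` norm of a row of the back loadings. -/
def colWeight (i : Fin q) : ℝ := ∑ b, |D.C i b|

/-- The scale of the entry `(u, i)` of `W_t`. -/
def weight (u : Fin p) (i : Fin q) : ℝ := 1 + D.rowWeight u * D.colWeight i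

theorem rowWeight_nonneg (u : Fin p) : 0 ≤ D.rowWeight u :=
  Finset.sum_nonneg fun _ _ => abs_nonneg _

theorem colWeight_nonneg (i : Fin q) : 0 ≤ D.colWeight i :=
  Finset.sum_nonneg fun _ _ => abs_nonneg _

theorem weight_pos (u : Fin p) (i : Fin q) : 0 < D.weight u i := by
  have := mul_nonneg (D.rowWeight_nonneg u) (D.colWeight_nonneg i)
  unfold weight; linarith

theorem sum_abs_loadings (u : Fin p) (i : Fin q) :
    ∑ x : Fin k × Fin r, |D.R u x.1 * D.C i x.2| = D.rowWeight u * D.colWeight i := by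
  rw [rowWeight, colWeight, Finset.sum_mul_sum, Fintype.sum_prod_type]
  simp [abs_mul]

theorem W_apply (t : ℤ) (ω : Ω) (u : Fin p) (i : Fin q) :
    D.W t ω u i = ∑ x : Fin k × Fin r, (D.R u x.1 * D.C i x.2) * D.F t ω x.1 x.2 +
      D.E t ω u i := by
  rw [W, Matrix.add_apply, Matrix.mul_apply, Fintype.sum_prod_type, Finset.sum_comm]
  congr 1
  refine Finset.sum_congr rfl fun b _ => ?_
  rw [Matrix.mul_apply, Finset.sum_mul]
  refine Finset.sum_congr rfl fun a _ => ?_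
  rw [Matrix.transpose_apply]; ring

theorem abs_W_le (t : ℤ) (ω : Ω) (u : Fin p) (i : Fin q) {B : ℝ}
    (hF : ∀ a b, |D.F t ω a b| ≤ B) (hE : |D.E t ω u i| ≤ B) :
    |D.W t ω u i| ≤ D.weight u i * B := by
  rw [W_apply]
  calc _ ≤ |∑ x : Fin k × Fin r, (D.R u x.1 * D.C i x.2) * D.F t ω x.1 x.2| + |D.E t ω u i| :=
        abs_add_le _ _
    _ ≤ ∑ x : Fin k × Fin r, |D.R u x.1 * D.C i x.2| * B + B := by
        refine add_le_add ((Finset.abs_sum_le_sum_abs _ _).trans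
          (Finset.sum_le_sum fun x _ => ?_)) hE
        rw [abs_mul]
        exact mul_le_mul_of_nonneg_left (hF _ _) (abs_nonneg _)
    _ = _ := by rw [← Finset.sum_mul, sum_abs_loadings, weight]; ring

/-- Single rows of the loadings may be large, so entries of W have controlled moments only relative
to their weight. If B is the right-hand side, every |F| and |E| involved is at most B^(1/s), hence
|W| is at most weight·B^(1/s). -/
theorem rpow_W_div_weight_le (t : ℤ) (ω : Ω) (u : Fin p) (i : Fin q) {s : ℝ} (hs : 0 < s) :
    |D.W t ω u i / D.weight u i| ^ s ≤
      ∑ x : Fin k × Fin r, |D.F t ω x.1 x.2| ^ s + |D.E t ω u i| ^ s := by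
  set B := ∑ x : Fin k × Fin r, |D.F t ω x.1 x.2| ^ s + |D.E t ω u i| ^ s with hB
  have hF0 : 0 ≤ ∑ x : Fin k × Fin r, |D.F t ω x.1 x.2| ^ s :=
    Finset.sum_nonneg fun x _ => Real.rpow_nonneg (abs_nonneg _) _
  have hE0 : 0 ≤ |D.E t ω u i| ^ s := Real.rpow_nonneg (abs_nonneg _) _
  have hB0 : 0 ≤ B := add_nonneg hF0 hE0
  have hroot : ∀ y, 0 ≤ y → y ^ s ≤ B → y ≤ B ^ s⁻¹ := fun y hy hyB =>
    (Real.le_rpow_inv_iff_of_pos hy hB0 hs).mpr hyB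
  have h := D.abs_W_le t ω u i (B := B ^ s⁻¹)
    (fun a b => hroot _ (abs_nonneg _) (by
      have := Finset.single_le_sum (f := fun x : Fin k × Fin r => |D.F t ω x.1 x.2| ^ s)
        (fun x _ => Real.rpow_nonneg (abs_nonneg _) _) (Finset.mem_univ (a, b))
      simp only at this
      linarith))
    (hroot _ (abs_nonneg _) (by linarith))
  have h2 : |D.W t ω u i / D.weight u i| ≤ B ^ s⁻¹ := by
    rw [abs_div, abs_of_pos (D.weight_pos u i), div_le_iff₀ (D.weight_pos u i), mul_comm]
    exact h
  calc _ ≤ (B ^ s⁻¹) ^ s := Real.rpow_le_rpow (abs_nonneg _) h2 hs.le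
    _ = B := Real.rpow_inv_rpow hB0 hs.ne'

theorem measurable_Y_sigmaAt (t : ℤ) (u : Fin p) (i : Fin q) :
    Measurable[D.sigmaAt t] fun ω => D.Y t ω u i := by
  rw [measurable_iff_comap_le]
  refine le_trans ?_ (le_sup_left.trans le_sup_left)
  exact le_iSup₂_of_le u i le_rfl

theorem measurable_X_sigmaAt (t : ℤ) (u : Fin m) (i : Fin q) :
    Measurable[D.sigmaAt t] fun ω => D.X t ω u i := by
  rw [measurable_iff_comap_le]
  refine le_trans ?_ (le_sup_right.trans le_sup_left)
  exact le_iSup₂_of_le u i le_rfl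

/-- Mixing concerns (Y, X, F); W inherits it because W = Y - AX. -/
theorem measurable_W_sigmaAt (t : ℤ) (u : Fin p) (i : Fin q) :
    Measurable[D.sigmaAt t] fun ω => D.W t ω u i := by
  have h : (fun ω => D.W t ω u i) = fun ω => D.Y t ω u i - ∑ l, D.A u l * D.X t ω l i := by
    ext ω
    rw [Y_eq, Matrix.add_apply, Matrix.mul_apply]; ring
  rw [h]
  exact (D.measurable_Y_sigmaAt t u i).sub
    (Finset.measurable_sum _ fun l _ => (D.measurable_X_sigmaAt t l i).const_mul _)

variable {D} [MeasurableSpace Ω] {μ : Measure Ω} {T : ℕ} {γ c K : ℝ}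

theorem sigmaOf_le {a b : ℕ} {V : Ω → Matrix (Fin a) (Fin b) ℝ}
    (h : ∀ i j, Measurable fun ω => V ω i j) : sigmaOf V ≤ ‹MeasurableSpace Ω› :=
  iSup₂_le fun i j => (h i j).comap_le

theorem Measurability.W (h : D.Measurability) (t : ℤ) (u : Fin p) (i : Fin q) :
    Measurable fun ω => D.W t ω u i := by
  simp only [W_apply]
  exact (Finset.measurable_sum _ fun x _ => ((h t).2.1 _ _).const_mul _).add ((h t).2.2 _ _)

theorem Measurability.sigmaAt_le (h : D.Measurability) (t : ℤ) :
    D.sigmaAt t ≤ ‹MeasurableSpace Ω› := by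
  refine sup_le (sup_le (sigmaOf_le fun u i => ?_) (sigmaOf_le (h t).1)) (sigmaOf_le (h t).2.1)
  simp only [Y_eq, Matrix.add_apply, Matrix.mul_apply]
  exact (Finset.measurable_sum _ fun l _ => ((h t).1 _ _).const_mul _).add (h.W t u i)

namespace IsRegular

theorem momentConst_nonneg (hD : D.IsRegular μ T γ c K) : 0 ≤ (k * r + 1) * c :=
  mul_nonneg (by positivity) hD.nonneg

theorem meanLE_W (hD : D.IsRegular μ T γ c K) {t : ℤ} (ht : t ∈ Finset.Icc (1 : ℤ) T) (u : Fin p) (i : Fin q) :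
    MeanLE μ (fun ω => |D.W t ω u i / D.weight u i| ^ (2 * γ)) ((k * r + 1) * c) := by
  have hγ := hD.two_lt
  have h1 := (MeanLE.sum Finset.univ fun (x : Fin k × Fin r) _ =>
    (hD.moment t ht).1 x.1 x.2).add ((hD.moment t ht).2.2 u i)
  refine (h1.mono ?_).of_le ?_ (fun ω => Real.rpow_nonneg (abs_nonneg _) _)
    fun ω => D.rpow_W_div_weight_le t ω u i (by linarith)
  · simp; linarith
  · exact (measurable_norm.comp ((hD.meas.W t u i).div_const _)).pow_const _

theorem meanLE_X (hD : D.IsRegular μ T γ c K) {t : ℤ} (ht : t ∈ Finset.Icc (1 : ℤ) T) (u : Fin m) (i : Fin q) :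
    MeanLE μ (fun ω => |D.X t ω u i / 1| ^ (2 * γ)) ((k * r + 1) * c) := by
  simp only [div_one]
  refine ((hD.moment t ht).2.1 u i).mono ?_
  have := hD.nonneg
  have : (0 : ℝ) ≤ k * r := by positivity
  nlinarith

theorem two_lt_two_mul (hD : D.IsRegular μ T γ c K) : 2 < 2 * γ := by linarith [hD.two_lt]

variable [IsProbabilityMeasure μ]

theorem memLp_F (hD : D.IsRegular μ T γ c K) {t : ℤ} (ht : t ∈ Finset.Icc (1 : ℤ) T) (a : Fin k) (b : Fin r) :
    MemLp (fun ω => D.F t ω a b) 2 μ :=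
  ((hD.moment t ht).1 a b).memLp_two ((hD.meas t).2.1 a b) hD.two_lt_two_mul

theorem memLp_X (hD : D.IsRegular μ T γ c K) {t : ℤ} (ht : t ∈ Finset.Icc (1 : ℤ) T) (a : Fin m) (b : Fin q) :
    MemLp (fun ω => D.X t ω a b) 2 μ :=
  ((hD.moment t ht).2.1 a b).memLp_two ((hD.meas t).1 a b) hD.two_lt_two_mul

theorem memLp_E (hD : D.IsRegular μ T γ c K) {t : ℤ} (ht : t ∈ Finset.Icc (1 : ℤ) T) (a : Fin p) (b : Fin q) :
    MemLp (fun ω => D.E t ω a b) 2 μ :=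
  ((hD.moment t ht).2.2 a b).memLp_two ((hD.meas t).2.2 a b) hD.two_lt_two_mul

theorem memLp_RFC_summand (hD : D.IsRegular μ T γ c K) {t : ℤ} (ht : t ∈ Finset.Icc (1 : ℤ) T)
    (u : Fin p) (i : Fin q) (x : Fin k × Fin r) :
    MemLp (fun ω => (D.R u x.1 * D.C i x.2) * D.F t ω x.1 x.2) 2 μ :=
  (hD.memLp_F ht x.1 x.2).const_mul _

theorem memLp_RFC (hD : D.IsRegular μ T γ c K) {t : ℤ} (ht : t ∈ Finset.Icc (1 : ℤ) T) (u : Fin p) (i : Fin q) :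
    MemLp (fun ω => ∑ x : Fin k × Fin r, (D.R u x.1 * D.C i x.2) * D.F t ω x.1 x.2) 2 μ :=
  memLp_finsetSum _ fun x _ => hD.memLp_RFC_summand ht u i x

theorem memLp_W (hD : D.IsRegular μ T γ c K) {t : ℤ} (ht : t ∈ Finset.Icc (1 : ℤ) T) (u : Fin p) (i : Fin q) :
    MemLp (fun ω => D.W t ω u i) 2 μ := by
  simp only [W_apply]
  exact (hD.memLp_RFC ht u i).add (hD.memLp_E ht u i)

theorem integral_W (hD : D.IsRegular μ T γ c K) {t : ℤ} (ht : t ∈ Finset.Icc (1 : ℤ) T) (u : Fin p) (i : Fin q) :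
    ∫ ω, D.W t ω u i ∂μ = 0 := by
  simp only [W_apply]
  rw [integral_add ((hD.memLp_RFC ht u i).integrable one_le_two)
    ((hD.memLp_E ht u i).integrable one_le_two), hD.noise.1 t ht u i,
    integral_finsetSum _ fun x _ => ((hD.memLp_F ht x.1 x.2).integrable one_le_two).const_mul _]
  simp [integral_const_mul, hD.uncorr.1 t ht]

theorem integral_W_mul_W (hD : D.IsRegular μ T γ c K) {t s : ℤ} (ht : t ∈ Finset.Icc (1 : ℤ) T)
    (hs : s ∈ Finset.Icc (1 : ℤ) T) (u : Fin p) (i : Fin q) (v : Fin p) (j : Fin q) :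
    ∫ ω, D.W t ω u i * D.W s ω v j ∂μ =
      cov[fun ω => D.W t ω u i, fun ω => D.W s ω v j; μ] := by
  rw [covariance_eq_sub (hD.memLp_W ht u i) (hD.memLp_W hs v j), hD.integral_W ht, zero_mul,
    sub_zero]
  rfl

/-- W is centred, so zero covariance already gives a zero mean product, whatever the mean of X. -/
theorem integral_W_mul_X (hD : D.IsRegular μ T γ c K) {t : ℤ} (ht : t ∈ Finset.Icc (1 : ℤ) T)
    (u : Fin p) (i : Fin q) (a : Fin m) :
    ∫ ω, D.W t ω u i * D.X t ω a i ∂μ = 0 := by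
  have h1 : ∫ ω, D.W t ω u i * D.X t ω a i ∂μ =
      cov[fun ω => D.X t ω a i, fun ω => D.W t ω u i; μ] := by
    rw [covariance_comm, covariance_eq_sub (hD.memLp_W ht u i) (hD.memLp_X ht a i),
      hD.integral_W ht, zero_mul, sub_zero]
    rfl
  have h2 : (fun ω => D.W t ω u i) = (fun ω => ∑ x : Fin k × Fin r,
      (D.R u x.1 * D.C i x.2) * D.F t ω x.1 x.2) + fun ω => D.E t ω u i := by
    ext ω; rw [W_apply]; rfl
  rw [h1, h2, covariance_add_right (hD.memLp_X ht a i) (hD.memLp_RFC ht u i)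
    (hD.memLp_E ht u i), hD.uncorr.2.2.1 t ht, add_zero,
    covariance_fun_sum_right (hD.memLp_RFC_summand ht u i) (hD.memLp_X ht a i)]
  refine Finset.sum_eq_zero fun x _ => ?_
  rw [covariance_const_mul_right, hD.uncorr.2.2.2 t ht, mul_zero]

/-- At distinct times the noise–noise and noise–factor terms vanish. The surviving factor term
carries the loadings on the outside, whence the low rank of the population array at positive lags.
-/
theorem covariance_W (hD : D.IsRegular μ T γ c K) {t s : ℤ} (ht : t ∈ Finset.Icc (1 : ℤ) T)
    (hs : s ∈ Finset.Icc (1 : ℤ) T) (hts : t ≠ s) (u : Fin p) (i : Fin q) (v : Fin p)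
    (j : Fin q) :
    cov[fun ω => D.W t ω u i, fun ω => D.W s ω v j; μ] =
      ∑ x : Fin k × Fin r, ∑ y : Fin k × Fin r, (D.R u x.1 * D.C i x.2) *
        ((D.R v y.1 * D.C j y.2) *
          cov[fun ω => D.F t ω x.1 x.2, fun ω => D.F s ω y.1 y.2; μ]) := by
  have h : ∀ t u i, (fun ω => D.W t ω u i) = (fun ω => ∑ x : Fin k × Fin r,
      (D.R u x.1 * D.C i x.2) * D.F t ω x.1 x.2) + fun ω => D.E t ω u i := by
    intro t u i; ext ω; rw [W_apply]; rfl
  have hFE : ∀ t ∈ Finset.Icc (1 : ℤ) T, ∀ s ∈ Finset.Icc (1 : ℤ) T, ∀ u i v j,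
      cov[fun ω => ∑ x : Fin k × Fin r, (D.R u x.1 * D.C i x.2) * D.F t ω x.1 x.2,
        fun ω => D.E s ω v j; μ] = 0 := by
    intro t ht s hs u i v j
    rw [covariance_fun_sum_left (hD.memLp_RFC_summand ht u i)
      (hD.memLp_E hs v j)]
    refine Finset.sum_eq_zero fun x _ => ?_
    rw [covariance_const_mul_left, hD.uncorr.2.1 t ht s hs, mul_zero]
  rw [h t, h s, covariance_add_left (hD.memLp_RFC ht u i) (hD.memLp_E ht u i)
      ((hD.memLp_RFC hs v j).add (hD.memLp_E hs v j)),
    covariance_add_right (hD.memLp_RFC ht u i) (hD.memLp_RFC hs v j) (hD.memLp_E hs v j),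
    covariance_add_right (hD.memLp_E ht u i) (hD.memLp_RFC hs v j) (hD.memLp_E hs v j),
    hFE t ht s hs, covariance_comm (fun ω => D.E t ω u i), hFE s hs t ht,
    hD.noise.2.2 t ht s hs hts, add_zero, add_zero, add_zero,
    covariance_fun_sum_fun_sum (hD.memLp_RFC_summand ht u i)
      (hD.memLp_RFC_summand hs v j)]
  refine Finset.sum_congr rfl fun x _ => Finset.sum_congr rfl fun y _ => ?_
  rw [covariance_const_mul_left, covariance_const_mul_right]

theorem abs_covariance_F_le (hD : D.IsRegular μ T γ c K) {t s : ℤ} (ht : t ∈ Finset.Icc (1 : ℤ) T)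
    (hs : s ∈ Finset.Icc (1 : ℤ) T) (a : Fin k) (b : Fin r) (a' : Fin k) (b' : Fin r) :
    |cov[fun ω => D.F t ω a b, fun ω => D.F s ω a' b'; μ]| ≤ covConst c := by
  rw [covariance_eq_sub (hD.memLp_F ht a b) (hD.memLp_F hs a' b')]
  have := abs_integral_mul_sub_le_of_moment (μ := μ) le_rfl le_rfl hD.two_lt_two_mul zero_le_one
    AlphaLE.one ((hD.meas t).2.1 a b) ((hD.meas s).2.1 a' b') ((hD.moment t ht).1 a b)
    ((hD.moment s hs).1 a' b')
  rwa [Real.one_rpow, mul_one] at this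

end IsRegular

end FactorModel

theorem sum_weights_sq {ι κ : Type*} [Fintype ι] [Fintype κ] (f : ι → κ → ℝ) (b : ℝ) :
    ∑ u, ∑ i, ∑ v, ∑ j, f u i * f v j * b = (∑ u, ∑ i, f u i) ^ 2 * b := by
  simp_rw [← Finset.sum_mul, ← Finset.mul_sum, ← Finset.sum_mul, sq]

theorem sq_scaled_sum_le (q : ℕ) (s : ℝ) (f : Fin q → ℝ) :
    (s * ∑ g, f g) ^ 2 ≤ s ^ 2 * q * ∑ g, f g ^ 2 := by
  rw [mul_pow, mul_assoc]
  refine mul_le_mul_of_nonneg_left ?_ (sq_nonneg _)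
  simpa using sq_sum_le_card_mul_sum_sq (s := Finset.univ) (f := f)

/-- The constant in the variance bounds. -/
def varConst (k r h₀ : ℕ) (c K : ℝ) : ℝ :=
  covConst (2 * ((k * r + 1) * c)) * (2 * ((h₀ + 1) + K))

namespace FactorModel

variable {Ω : Type*} [MeasurableSpace Ω] {p q m k r : ℕ} {D : FactorModel Ω p q m k r}
  {μ : Measure Ω} {T h₀ : ℕ} {γ c K : ℝ}

/-! ### The population autocovariances -/

/-- `(T-h)⁻¹ ∑_{t=1}^{T-h} Cov(W_{t,ui}, W_{t+h,vj})`. -/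
def popLag (μ : Measure Ω) (D : FactorModel Ω p q m k r) (T h : ℕ) (u : Fin p) (i : Fin q)
    (v : Fin p) (j : Fin q) : ℝ :=
  ((T : ℝ) - h)⁻¹ * ∑ t ∈ Finset.Icc (1 : ℤ) ((T : ℤ) - h),
    cov[fun ω => D.W t ω u i, fun ω => D.W (t + h) ω v j; μ]

theorem M₁_eq_gramM : D.M₁ μ T h₀ = gramM (fun h u i v j => popLag μ D T h u i v j) h₀ := by
  have : ∀ h i j, autocov μ D.W T h i j = Matrix.of fun u v => popLag μ D T h u i v j := by
    intro h i j
    ext u v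
    simp [autocov, popLag, Matrix.sum_apply]
  simp only [M₁, populationM, gramM, this]

theorem M₂_eq_gramM : D.M₂ μ T h₀ = gramM (fun h i u j v => popLag μ D T h u i v j) h₀ := by
  have : ∀ h u v, autocov μ (fun t ω => (D.W t ω)ᵀ) T h u v =
      Matrix.of fun i j => popLag μ D T h u i v j := by
    intro h u v
    ext i j
    simp [autocov, popLag, Matrix.sum_apply]
  simp only [M₂, populationM, gramM, this]

theorem mem_Icc_of_mem_lag {h : ℕ} {t : ℤ} (ht : t ∈ Finset.Icc (1 : ℤ) ((T : ℤ) - h)) :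
    t ∈ Finset.Icc (1 : ℤ) T ∧ t + h ∈ Finset.Icc (1 : ℤ) T := by
  simp only [Finset.mem_Icc] at *
  omega

theorem card_lag {h : ℕ} (hh : h ≤ T) :
    ((Finset.Icc (1 : ℤ) ((T : ℤ) - h)).card : ℝ) = (T : ℝ) - h := by
  rw [Int.card_Icc, show ((T : ℤ) - h + 1 - 1).toNat = T - h by omega, Nat.cast_sub hh]

/-- The sum of the squared scales of the entries of `W_t`. -/
def totalWeight (D : FactorModel Ω p q m k r) : ℝ :=
  ∑ u, ∑ i, D.weight u i ^ 2

namespace IsRegular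

theorem varConst_mono (hD : D.IsRegular μ T γ c K) {h h' : ℕ} (hh : h ≤ h') :
    varConst k r h c K ≤ varConst k r h' c K := by
  have h1 : (h : ℝ) ≤ h' := by exact_mod_cast hh
  have h2 : 0 ≤ covConst (2 * ((k * r + 1) * c)) :=
    covConst_nonneg (by linarith [hD.momentConst_nonneg])
  exact mul_le_mul_of_nonneg_left (by linarith) h2

theorem varConst_nonneg (hD : D.IsRegular μ T γ c K) (h₀ : ℕ) : 0 ≤ varConst k r h₀ c K := by
  have h2 : 0 ≤ covConst (2 * ((k * r + 1) * c)) :=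
    covConst_nonneg (by linarith [hD.momentConst_nonneg])
  have h3 : 0 ≤ K := le_trans
    (tsum_nonneg fun l => Real.rpow_nonneg (mixingCoeff_nonneg _ _) _) hD.tsum_le
  unfold varConst
  positivity

variable [IsProbabilityMeasure μ]

theorem popLag_eq (hD : D.IsRegular μ T γ c K) {h : ℕ} (h1 : 1 ≤ h) (u : Fin p) (i : Fin q)
    (v : Fin p) (j : Fin q) :
    popLag μ D T h u i v j = ∑ x : Fin k × Fin r, ∑ y : Fin k × Fin r,
      (D.R u x.1 * D.C i x.2) * ((D.R v y.1 * D.C j y.2) * D.SigmaF μ T h x y) := by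
  simp only [popLag, SigmaF, Matrix.smul_apply, Matrix.sum_apply, Matrix.of_apply, smul_eq_mul]
  rw [Finset.sum_congr rfl fun t ht => hD.covariance_W (mem_Icc_of_mem_lag ht).1
    (mem_Icc_of_mem_lag ht).2 (by omega) u i v j, Finset.sum_comm, Finset.mul_sum]
  refine Finset.sum_congr rfl fun x _ => ?_
  rw [Finset.sum_comm, Finset.mul_sum]
  refine Finset.sum_congr rfl fun y _ => ?_
  rw [← Finset.mul_sum, ← Finset.mul_sum]
  ring

theorem abs_SigmaF_le (hD : D.IsRegular μ T γ c K) {h : ℕ} (hh : h < T)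
    (x y : Fin k × Fin r) : |D.SigmaF μ T h x y| ≤ covConst c := by
  simp only [SigmaF, Matrix.smul_apply, Matrix.sum_apply, Matrix.of_apply, smul_eq_mul]
  have hpos : (0 : ℝ) < (T : ℝ) - h := by rw [sub_pos]; exact_mod_cast hh
  rw [abs_mul, abs_of_pos (inv_pos.mpr hpos), inv_mul_le_iff₀ hpos, ← card_lag hh.le,
    ← nsmul_eq_mul]
  refine (Finset.abs_sum_le_sum_abs _ _).trans (Finset.sum_le_card_nsmul _ _ _ fun t ht => ?_)
  exact hD.abs_covariance_F_le (mem_Icc_of_mem_lag ht).1 (mem_Icc_of_mem_lag ht).2 _ _ _ _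

theorem abs_popLag_le (hD : D.IsRegular μ T γ c K) {h : ℕ} (h1 : 1 ≤ h) (hh : h < T)
    (u : Fin p) (i : Fin q) (v : Fin p) (j : Fin q) :
    |popLag μ D T h u i v j| ≤
      (D.rowWeight u * D.colWeight i) * (D.rowWeight v * D.colWeight j) * covConst c := by
  rw [hD.popLag_eq h1, ← sum_abs_loadings, ← sum_abs_loadings, Finset.sum_mul_sum,
    Finset.sum_mul]
  refine (Finset.abs_sum_le_sum_abs _ _).trans (Finset.sum_le_sum fun x _ => ?_)
  rw [Finset.sum_mul]
  refine (Finset.abs_sum_le_sum_abs _ _).trans (Finset.sum_le_sum fun y _ => ?_)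
  rw [abs_mul, abs_mul (D.R v y.1 * _), ← mul_assoc]
  exact mul_le_mul_of_nonneg_left (hD.abs_SigmaF_le hh x y) (by positivity)

/-- For fixed `(i, v, j)` this exhibits the vector in `u` as a combination of the `k` columns of R,
the form needed by `abs_sortedEigenvalue_gramM_le`. -/
theorem popLag_eq_row (hD : D.IsRegular μ T γ c K) {h : ℕ} (h1 : 1 ≤ h) (u : Fin p)
    (i : Fin q) (v : Fin p) (j : Fin q) :
    popLag μ D T h u i v j = ∑ a, D.R u a * ∑ b, ∑ y : Fin k × Fin r,
      D.C i b * ((D.R v y.1 * D.C j y.2) * D.SigmaF μ T h (a, b) y) := by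
  rw [hD.popLag_eq h1, Fintype.sum_prod_type]
  simp only [Finset.mul_sum, mul_assoc]

theorem popLag_eq_col (hD : D.IsRegular μ T γ c K) {h : ℕ} (h1 : 1 ≤ h) (u : Fin p)
    (i : Fin q) (v : Fin p) (j : Fin q) :
    popLag μ D T h u i v j = ∑ b, D.C i b * ∑ a, ∑ y : Fin k × Fin r,
      D.R u a * ((D.R v y.1 * D.C j y.2) * D.SigmaF μ T h (a, b) y) := by
  rw [hD.popLag_eq h1, Fintype.sum_prod_type_right]
  simp only [Finset.mul_sum]
  refine Finset.sum_congr rfl fun b _ => Finset.sum_congr rfl fun a _ =>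
    Finset.sum_congr rfl fun y _ => ?_
  ring

theorem frobSq_popLag_le (hD : D.IsRegular μ T γ c K) (hT : h₀ < T) :
    frobSq (fun h u i v j => popLag μ D T h u i v j) h₀ ≤
      h₀ * (covConst c * ((∑ u, D.rowWeight u ^ 2) * ∑ i, D.colWeight i ^ 2)) ^ 2 := by
  have hcard : ∀ c : ℝ, h₀ * c = (Finset.Icc 1 h₀).card • c := by simp
  rw [hcard]
  refine Finset.sum_le_card_nsmul _ _ _ fun h hh => ?_
  obtain ⟨hh1, hh2⟩ := Finset.mem_Icc.mp hh
  calc _ ≤ ∑ u, ∑ i, ∑ v, ∑ j, (D.rowWeight u ^ 2 * D.colWeight i ^ 2) *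
          (D.rowWeight v ^ 2 * D.colWeight j ^ 2) * covConst c ^ 2 := by
        refine Finset.sum_le_sum fun u _ => Finset.sum_le_sum fun i _ =>
          Finset.sum_le_sum fun v _ => Finset.sum_le_sum fun j _ => ?_
        rw [← sq_abs]
        refine (pow_le_pow_left₀ (abs_nonneg _)
          (hD.abs_popLag_le hh1 (hh2.trans_lt hT) u i v j) 2).trans (le_of_eq ?_)
        ring
    _ = _ := by
        rw [sum_weights_sq (fun u i => D.rowWeight u ^ 2 * D.colWeight i ^ 2),
          ← Finset.sum_mul_sum]
        ring

/-! ### Mean square errors -/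

theorem meanLE_sq_lagMean_sub (hD : D.IsRegular μ T γ c K) (hT : h₀ < T) {h : ℕ} (hh : h ≤ h₀)
    (u : Fin p) (i : Fin q) (v : Fin p) (j : Fin q) :
    MeanLE μ (fun ω => (lagMean (fun t => D.W t ω) T h u i v j - popLag μ D T h u i v j) ^ 2)
      (D.weight u i ^ 2 * D.weight v j ^ 2 * ((h₀ + 1) / T * varConst k r h₀ c K)) := by
  have hhT : h < T := hh.trans_lt hT
  have hpos : (0 : ℝ) < (T : ℝ) - h := by rw [sub_pos]; exact_mod_cast hhT
  have main := (meanLE_sq_sum_mul_sub (μ := μ) (h := h) hD.meas.sigmaAt_le hD.two_lt hD.summable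
    hD.tsum_le hD.momentConst_nonneg (Finset.Icc (1 : ℤ) ((T : ℤ) - h))
    (ξ := fun t ω => D.W t ω u i) (η := fun t ω => D.W t ω v j)
    (fun t _ => D.measurable_W_sigmaAt t u i) (fun t _ => D.measurable_W_sigmaAt _ v j)
    (D.weight_pos u i) (D.weight_pos v j)
    (fun t ht => hD.meanLE_W (mem_Icc_of_mem_lag ht).1 u i)
    (fun t ht => hD.meanLE_W (mem_Icc_of_mem_lag ht).2 v j)).const_mul
    (sq_nonneg ((T : ℝ) - h)⁻¹)
  have heq : (fun ω => (lagMean (fun t => D.W t ω) T h u i v j - popLag μ D T h u i v j) ^ 2) =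
      fun ω => ((T : ℝ) - h)⁻¹ ^ 2 * (∑ t ∈ Finset.Icc (1 : ℤ) ((T : ℤ) - h),
        (D.W t ω u i * D.W (t + h) ω v j - ∫ ω', D.W t ω' u i * D.W (t + h) ω' v j ∂μ)) ^ 2 := by
    ext ω
    rw [lagMean, popLag, ← mul_sub, ← Finset.sum_sub_distrib, mul_pow]
    congr 2
    refine Finset.sum_congr rfl fun t ht => ?_
    rw [hD.integral_W_mul_W (mem_Icc_of_mem_lag ht).1 (mem_Icc_of_mem_lag ht).2]
  rw [heq]
  refine main.mono ?_
  rw [card_lag hhT.le]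
  change _ * (_ * ((T - h) * varConst k r h c K)) ≤ _
  calc _ = D.weight u i ^ 2 * D.weight v j ^ 2 * (((T : ℝ) - h)⁻¹ * varConst k r h c K) := by
        field_simp
    _ ≤ _ := by
        have h1 := inv_sub_le hT hh
        have h2 := hD.varConst_mono hh
        have h3 := hD.varConst_nonneg h
        have h4 : (0 : ℝ) ≤ (h₀ + 1) / T := by positivity
        refine mul_le_mul_of_nonneg_left (mul_le_mul h1 h2 h3 h4) (by positivity)

theorem meanLE_frobSq_lagMean_sub (hD : D.IsRegular μ T γ c K) (hT : h₀ < T) :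
    MeanLE μ (fun ω => frobSq (fun h u i v j =>
        lagMean (fun t => D.W t ω) T h u i v j - popLag μ D T h u i v j) h₀)
      (h₀ * (D.totalWeight ^ 2 * ((h₀ + 1) / T * varConst k r h₀ c K))) := by
  have h1 := MeanLE.sum (Finset.Icc 1 h₀) fun h hh => MeanLE.sum Finset.univ fun u _ =>
    MeanLE.sum Finset.univ fun i _ => MeanLE.sum Finset.univ fun v _ =>
    MeanLE.sum Finset.univ fun j _ =>
      hD.meanLE_sq_lagMean_sub hT (Finset.mem_Icc.mp hh).2 u i v j
  refine h1.mono (le_of_eq ?_)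
  rw [sum_weights_sq fun u i => D.weight u i ^ 2]
  simp [totalWeight]

/-- The case of lag 0, where the products have mean zero. The sum over columns is handled by
Cauchy–Schwarz at the cost of a factor q, since nothing is known about dependence across columns. -/
theorem meanLE_crossMean (hD : D.IsRegular μ T γ c K) (hT : 0 < T) (u : Fin p) (a : Fin m) :
    MeanLE μ (fun ω => crossMean (fun t => D.W t ω) (fun t => D.X t ω) T u a ^ 2)
      (q / T * varConst k r 0 c K * ∑ g, D.weight u g ^ 2) := by
  have hT' : (0 : ℝ) < T := by exact_mod_cast hT
  have h1 : ∀ g, MeanLE μ (fun ω => (∑ t ∈ Finset.Icc (1 : ℤ) T,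
      D.W t ω u g * D.X t ω a g) ^ 2) (D.weight u g ^ 2 * (T * varConst k r 0 c K)) := by
    intro g
    have := meanLE_sq_sum_mul_sub (μ := μ) (h := 0) hD.meas.sigmaAt_le hD.two_lt hD.summable
      hD.tsum_le hD.momentConst_nonneg (Finset.Icc (1 : ℤ) T)
      (ξ := fun t ω => D.W t ω u g) (η := fun t ω => D.X t ω a g)
      (fun t _ => D.measurable_W_sigmaAt t u g) (fun t _ => D.measurable_X_sigmaAt _ a g)
      (D.weight_pos u g) one_pos (fun t ht => hD.meanLE_W ht u g)
      (fun t ht => by simpa using hD.meanLE_X ht a g)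
    simp only [Nat.cast_zero, add_zero] at this
    convert this using 1
    · ext ω
      congr 1
      refine Finset.sum_congr rfl fun t ht => ?_
      rw [hD.integral_W_mul_X ht, sub_zero]
    · simp [varConst]
  have h2 := (MeanLE.sum Finset.univ fun g _ => h1 g).const_mul
    (a := (T : ℝ)⁻¹ ^ 2 * q) (by positivity)
  refine (h2.mono (le_of_eq ?_)).of_le ?_ (fun ω => sq_nonneg _) fun ω => ?_
  · rw [← Finset.sum_mul]; field_simp
  · simp only [crossMean, Matrix.smul_apply, Matrix.sum_apply, Matrix.mul_apply, smul_eq_mul,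
      Matrix.transpose_apply]
    exact (Measurable.const_mul (Finset.measurable_sum _ fun t _ => Finset.measurable_sum _
      fun g _ => (hD.meas.W t u g).mul ((hD.meas t).1 a g)) _).pow_const 2
  · have : crossMean (fun t => D.W t ω) (fun t => D.X t ω) T u a = (T : ℝ)⁻¹ *
        ∑ g, ∑ t ∈ Finset.Icc (1 : ℤ) T, D.W t ω u g * D.X t ω a g := by
      simp only [crossMean, Matrix.smul_apply, Matrix.sum_apply, Matrix.mul_apply, smul_eq_mul,
        Matrix.transpose_apply]
      rw [Finset.sum_comm]
    rw [this]
    exact sq_scaled_sum_le _ _ _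

theorem meanLE_sum_sq_crossMean (hD : D.IsRegular μ T γ c K) (hT : 0 < T) :
    MeanLE μ (fun ω => ∑ u, ∑ a, crossMean (fun t => D.W t ω) (fun t => D.X t ω) T u a ^ 2)
      (m * (q / T * varConst k r 0 c K * D.totalWeight)) := by
  have h1 := MeanLE.sum Finset.univ fun u _ => MeanLE.sum Finset.univ fun a _ =>
    hD.meanLE_crossMean hT u a
  refine h1.mono (le_of_eq ?_)
  simp only [Finset.sum_const, Finset.card_univ, Fintype.card_fin, nsmul_eq_mul,
    ← Finset.mul_sum, totalWeight]

theorem meanLE_energy_W (hD : D.IsRegular μ T γ c K) :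
    MeanLE μ (fun ω => energy (fun t => D.W t ω) T)
      (T * ((1 + (k * r + 1) * c) * D.totalWeight)) := by
  have h1 : ∀ t ∈ Finset.Icc (1 : ℤ) T, ∀ u i, MeanLE μ (fun ω => D.W t ω u i ^ 2)
      (D.weight u i ^ 2 * (1 + (k * r + 1) * c)) := by
    intro t ht u i
    have h2 := ((MeanLE.const (μ := μ) 1).add (hD.meanLE_W ht u i)).const_mul
      (sq_nonneg (D.weight u i))
    refine h2.of_le ((hD.meas.W t u i).pow_const 2) (fun ω => sq_nonneg _) fun ω => ?_
    have h3 := sq_le_one_add_rpow hD.two_lt_two_mul (D.W t ω u i / D.weight u i)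
    calc D.W t ω u i ^ 2 = D.weight u i ^ 2 * (D.W t ω u i / D.weight u i) ^ 2 := by
          have := (D.weight_pos u i).ne'
          field_simp
      _ ≤ _ := mul_le_mul_of_nonneg_left h3 (sq_nonneg _)
  have h2 := MeanLE.sum (Finset.Icc (1 : ℤ) T) fun t ht => MeanLE.sum Finset.univ fun u _ =>
    MeanLE.sum Finset.univ fun i _ => h1 t ht u i
  refine h2.mono (le_of_eq ?_)
  simp [← Finset.sum_mul, totalWeight]
  left
  ring

theorem meanLE_gramMean (hD : D.IsRegular μ T γ c K) (hT : 0 < T) (a b : Fin m) :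
    MeanLE μ (fun ω => (gramMean (fun t => D.X t ω) T a b -
        ((T : ℝ)⁻¹ • ∑ t ∈ Finset.Icc (1 : ℤ) T, D.Pt μ t) a b) ^ 2)
      (q ^ 2 / T * varConst k r 0 c K) := by
  have hT' : (0 : ℝ) < T := by exact_mod_cast hT
  have h1 : ∀ g, MeanLE μ (fun ω => (∑ t ∈ Finset.Icc (1 : ℤ) T,
      (D.X t ω a g * D.X t ω b g - ∫ ω', D.X t ω' a g * D.X t ω' b g ∂μ)) ^ 2)
      (T * varConst k r 0 c K) := by
    intro g
    have := meanLE_sq_sum_mul_sub (μ := μ) (h := 0) hD.meas.sigmaAt_le hD.two_lt hD.summable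
      hD.tsum_le hD.momentConst_nonneg (Finset.Icc (1 : ℤ) T)
      (ξ := fun t ω => D.X t ω a g) (η := fun t ω => D.X t ω b g)
      (fun t _ => D.measurable_X_sigmaAt t a g) (fun t _ => D.measurable_X_sigmaAt _ b g)
      one_pos one_pos (fun t ht => hD.meanLE_X ht a g)
      (fun t ht => by simpa using hD.meanLE_X ht b g)
    simp only [Nat.cast_zero, add_zero] at this
    convert this using 1
    simp [varConst]
  have h2 := (MeanLE.sum Finset.univ fun g (_ : g ∈ (Finset.univ : Finset (Fin q))) =>
    h1 g).const_mul (a := (T : ℝ)⁻¹ ^ 2 * q) (by positivity)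
  refine (h2.mono (le_of_eq ?_)).of_le ?_ (fun ω => sq_nonneg _) fun ω => ?_
  · simp; field_simp
  · have hmeas : Measurable fun ω => gramMean (fun t => D.X t ω) T a b := by
      simp only [gramMean, Matrix.smul_apply, Matrix.sum_apply, Matrix.mul_apply, smul_eq_mul,
        Matrix.transpose_apply]
      exact Measurable.const_mul (Finset.measurable_sum _ fun t _ => Finset.measurable_sum _
        fun g _ => ((hD.meas t).1 a g).mul ((hD.meas t).1 b g)) _
    exact (hmeas.sub_const _).pow_const 2
  · have hPt : ∀ t ∈ Finset.Icc (1 : ℤ) T,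
        D.Pt μ t a b = ∑ g, ∫ ω', D.X t ω' a g * D.X t ω' b g ∂μ := by
      intro t ht
      simp only [Pt, Matrix.of_apply, Matrix.mul_apply, Matrix.transpose_apply]
      exact integral_finsetSum _ fun g _ => (hD.memLp_X ht a g).integrable_mul (hD.memLp_X ht b g)
    have : gramMean (fun t => D.X t ω) T a b -
        ((T : ℝ)⁻¹ • ∑ t ∈ Finset.Icc (1 : ℤ) T, D.Pt μ t) a b = (T : ℝ)⁻¹ *
        ∑ g, ∑ t ∈ Finset.Icc (1 : ℤ) T,
          (D.X t ω a g * D.X t ω b g - ∫ ω', D.X t ω' a g * D.X t ω' b g ∂μ) := by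
      simp only [gramMean, Matrix.smul_apply, Matrix.sum_apply, Matrix.mul_apply, smul_eq_mul,
        Matrix.transpose_apply]
      rw [← mul_sub, ← Finset.sum_sub_distrib, Finset.sum_comm]
      congr 1
      refine Finset.sum_congr rfl fun t ht => ?_
      rw [hPt t ht, Finset.sum_sub_distrib]
    rw [this]
    exact sq_scaled_sum_le _ _ _

theorem meanLE_sum_sq_gramMean (hD : D.IsRegular μ T γ c K) (hT : 0 < T) :
    MeanLE μ (fun ω => ∑ a, ∑ b, (gramMean (fun t => D.X t ω) T a b -
        ((T : ℝ)⁻¹ • ∑ t ∈ Finset.Icc (1 : ℤ) T, D.Pt μ t) a b) ^ 2)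
      (m ^ 2 * (q ^ 2 / T * varConst k r 0 c K)) := by
  have h1 := MeanLE.sum Finset.univ fun a _ => MeanLE.sum Finset.univ fun b _ =>
    hD.meanLE_gramMean hT a b
  refine h1.mono (le_of_eq ?_)
  simp; ring

end IsRegular

end FactorModel

/-! ### Frobenius and spectral norms -/

theorem sum_sq_le_specNorm {a b : ℕ} (M : Matrix (Fin a) (Fin b) ℝ) :
    ∑ u, ∑ l, M u l ^ 2 ≤ b * specNorm M ^ 2 := by
  rw [Finset.sum_comm]
  have h : ∀ l ∈ (Finset.univ : Finset (Fin b)), ∑ u, M u l ^ 2 ≤ specNorm M ^ 2 := by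
    intro l _
    have h1 := (LinearMap.toContinuousLinearMap (Matrix.toEuclideanLin M)).le_opNorm
      (EuclideanSpace.single l (1 : ℝ))
    rw [PiLp.norm_single, norm_one, mul_one] at h1
    have h2 : ‖LinearMap.toContinuousLinearMap (Matrix.toEuclideanLin M)
        (EuclideanSpace.single l (1 : ℝ))‖ ^ 2 = ∑ u, M u l ^ 2 := by
      rw [EuclideanSpace.norm_sq_eq]
      simp [Matrix.toLpLin_apply]
    rw [← h2]
    exact pow_le_pow_left₀ (norm_nonneg _) h1 2
  simpa using Finset.sum_le_card_nsmul _ _ _ h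

theorem sum_sq_sum_abs_le {a b : ℕ} (M : Matrix (Fin a) (Fin b) ℝ) :
    ∑ u, (∑ l, |M u l|) ^ 2 ≤ b ^ 2 * specNorm M ^ 2 := by
  calc _ ≤ ∑ u, b * ∑ l, M u l ^ 2 := Finset.sum_le_sum fun u _ => by
        simpa using sq_sum_le_card_mul_sum_sq (s := Finset.univ) (f := fun l => |M u l|)
    _ ≤ b * (b * specNorm M ^ 2) := by
        rw [← Finset.mul_sum]
        exact mul_le_mul_of_nonneg_left (sum_sq_le_specNorm M) (by positivity)
    _ = _ := by ring

/-- Cauchy–Schwarz over pairs of indices: the array x_a x_b has Frobenius norm |x|². -/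
theorem quadratic_sub_ge {m : ℕ} (H P : Matrix (Fin m) (Fin m) ℝ) {e : ℝ} (he : 0 ≤ e)
    (h : ∑ a, ∑ b, (H a b - P a b) ^ 2 ≤ e ^ 2) (x : Fin m → ℝ) :
    x ⬝ᵥ P *ᵥ x - e * (x ⬝ᵥ x) ≤ x ⬝ᵥ H *ᵥ x := by
  have h1 : (x ⬝ᵥ H *ᵥ x - x ⬝ᵥ P *ᵥ x) ^ 2 ≤ (e * (x ⬝ᵥ x)) ^ 2 := by
    have h2 : x ⬝ᵥ H *ᵥ x - x ⬝ᵥ P *ᵥ x =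
        ∑ y : Fin m × Fin m, (x y.1 * x y.2) * (H y.1 y.2 - P y.1 y.2) := by
      rw [Fintype.sum_prod_type]
      simp only [dotProduct, Matrix.mulVec, Finset.mul_sum, ← Finset.sum_sub_distrib]
      refine Finset.sum_congr rfl fun a _ => Finset.sum_congr rfl fun b _ => ?_
      ring
    have h3 : ∑ y : Fin m × Fin m, (x y.1 * x y.2) ^ 2 = (x ⬝ᵥ x) ^ 2 := by
      rw [Fintype.sum_prod_type, sq (x ⬝ᵥ x), dotProduct, Finset.sum_mul_sum]
      refine Finset.sum_congr rfl fun a _ => Finset.sum_congr rfl fun b _ => ?_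
      ring
    rw [h2]
    refine (Finset.sum_mul_sq_le_sq_mul_sq _ _ _).trans ?_
    rw [h3, Fintype.sum_prod_type, mul_pow, mul_comm]
    exact mul_le_mul_of_nonneg_right h (sq_nonneg _)
  have h4 := abs_le_of_sq_le_sq h1 (mul_nonneg he (dotProduct_self_nonneg_real x))
  linarith [(abs_le.mp h4).1]

/-! ### Deterministic consequences of controlled sample moments -/

namespace FactorModel

variable {Ω : Type*} {p q m k r : ℕ} {D : FactorModel Ω p q m k r} {T h₀ : ℕ} {γ c K : ℝ}

theorem totalWeight_le : D.totalWeight ≤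
    2 * (p * q + (∑ u, D.rowWeight u ^ 2) * ∑ i, D.colWeight i ^ 2) := by
  have h : ∀ u i, D.weight u i ^ 2 ≤ 2 * (1 + D.rowWeight u ^ 2 * D.colWeight i ^ 2) := by
    intro u i
    unfold weight
    nlinarith [sq_nonneg (1 - D.rowWeight u * D.colWeight i)]
  calc D.totalWeight ≤ ∑ u, ∑ i, 2 * (1 + D.rowWeight u ^ 2 * D.colWeight i ^ 2) :=
        Finset.sum_le_sum fun u _ => Finset.sum_le_sum fun i _ => h u i
    _ = _ := by
        rw [Finset.sum_mul_sum]
        simp [← Finset.mul_sum, Finset.sum_add_distrib]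

theorem totalWeight_nonneg : 0 ≤ D.totalWeight :=
  Finset.sum_nonneg fun _ _ => Finset.sum_nonneg fun _ _ => sq_nonneg _

theorem MHat₁_eq_gramM (ω : Ω) : D.MHat₁ T h₀ ω =
    gramM (fun h u i v j => lagMean (fun t => D.WHat T t ω) T h u i v j) h₀ :=
  sampleM_eq_gramM _ T h₀

theorem MHat₂_eq_gramM (ω : Ω) : D.MHat₂ T h₀ ω =
    gramM (fun h i u j v => lagMean (fun t => D.WHat T t ω) T h u i v j) h₀ :=
  sampleM_eq_gramM _ T h₀

variable [MeasurableSpace Ω] {μ : Measure Ω}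

/-- On the event that the sample moments are controlled, the autocovariances of the residuals are
close to those of `W`. -/
theorem frobSq_lagMean_WHat_sub_le (hT : h₀ < T) {l e₁ e₂ e₃ : ℝ} (hl : 0 < l) {ω : Ω}
    (hH : ∀ x, l * (x ⬝ᵥ x) ≤ x ⬝ᵥ gramMean (fun t => D.X t ω) T *ᵥ x)
    (h₁ : frobSq (fun h u i v j =>
      lagMean (fun t => D.W t ω) T h u i v j - popLag μ D T h u i v j) h₀ ≤ e₁)
    (h₂ : ∑ u, ∑ a, crossMean (fun t => D.W t ω) (fun t => D.X t ω) T u a ^ 2 ≤ e₂)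
    (h₃ : energy (fun t => D.W t ω) T ≤ e₃) :
    frobSq (fun h u i v j =>
      lagMean (fun t => D.WHat T t ω) T h u i v j - popLag μ D T h u i v j) h₀ ≤
      2 * (h₀ * (((h₀ + 1) / T) ^ 2 * (3 * (2 * e₃ * (T / l * e₂) + (T / l * e₂) ^ 2)))) +
        2 * e₁ := by
  have hT0 : 0 < T := by omega
  have hU := (energy_regression_le (fun t => D.W t ω) (fun t => D.X t ω) hT0 hl hH).trans
    (mul_le_mul_of_nonneg_left h₂ (by positivity))
  set U : ℤ → Matrix (Fin p) (Fin q) ℝ := fun t =>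
    (crossMean (fun t => D.W t ω) (fun t => D.X t ω) T *
      (gramMean (fun t => D.X t ω) T)⁻¹) * D.X t ω with hUdef
  have hW : (fun t => D.WHat T t ω) = fun t => D.W t ω - U t := by
    ext1 t
    exact D.WHat_eq T ω (isUnit_det_of_quadratic_ge hl hH) t
  have h5 := frobSq_sub_le (fun h u i v j => lagMean (fun t => D.WHat T t ω) T h u i v j)
    (fun h u i v j => lagMean (fun t => D.W t ω) T h u i v j)
    (fun h u i v j => popLag μ D T h u i v j) h₀
  have h6 := frobSq_lagMean_sub_le (fun t => D.W t ω) U hT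
  rw [← hW] at h6
  have hU0 : 0 ≤ energy U T := energy_nonneg U T
  have hW0 : 0 ≤ energy (fun t => D.W t ω) T := energy_nonneg _ T
  have he₃ : 0 ≤ e₃ := hW0.trans h₃
  have h7 : 3 * (2 * energy (fun t => D.W t ω) T * energy U T + energy U T ^ 2) ≤
      3 * (2 * e₃ * (T / l * e₂) + (T / l * e₂) ^ 2) := by gcongr
  have h8 : h₀ * (((h₀ + 1) / T) ^ 2 *
        (3 * (2 * energy (fun t => D.W t ω) T * energy U T + energy U T ^ 2))) ≤
      h₀ * (((h₀ + 1) / T) ^ 2 * (3 * (2 * e₃ * (T / l * e₂) + (T / l * e₂) ^ 2))) := by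
    gcongr
  linarith

variable [IsProbabilityMeasure μ]

/-- Both matrices come from one array, so the two norm bounds control both spectra; for the trailing
eigenvalues the factor `L` is R for M₁ and C for M₂. -/
theorem IsRegular.eigenvalues_le (hD : D.IsRegular μ T γ c K) {ω : Ω} {β d : ℝ}
    (hβ : 0 ≤ β) (hd : 0 ≤ d)
    (hpop : frobSq (fun h u i v j => popLag μ D T h u i v j) h₀ ≤ β ^ 2)
    (hdiff : frobSq (fun h u i v j =>
      lagMean (fun t => D.WHat T t ω) T h u i v j - popLag μ D T h u i v j) h₀ ≤ d ^ 2) :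
    (∀ j, |sortedEigenvalue (D.MHat₁ T h₀ ω) j - sortedEigenvalue (D.M₁ μ T h₀) j| ≤
      d * (2 * β + d)) ∧
    (∀ j, k ≤ j → j < p → |sortedEigenvalue (D.MHat₁ T h₀ ω) j| ≤ d ^ 2) ∧
    (∀ j, |sortedEigenvalue (D.MHat₂ T h₀ ω) j - sortedEigenvalue (D.M₂ μ T h₀) j| ≤
      d * (2 * β + d)) ∧
    (∀ j, r ≤ j → j < q → |sortedEigenvalue (D.MHat₂ T h₀ ω) j| ≤ d ^ 2) := by
  have hpop' := (frobSq_transpose (fun h u i v j => popLag μ D T h u i v j) h₀).trans_le hpop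
  have hdiff' := (frobSq_transpose (fun h u i v j =>
    lagMean (fun t => D.WHat T t ω) T h u i v j - popLag μ D T h u i v j) h₀).trans_le hdiff
  rw [MHat₁_eq_gramM, MHat₂_eq_gramM, M₁_eq_gramM, M₂_eq_gramM]
  refine ⟨fun j => abs_sortedEigenvalue_gramM_sub_le _ _ h₀ hβ hd hpop hdiff j,
    fun j hj hjp => ?_,
    fun j => abs_sortedEigenvalue_gramM_sub_le _ _ h₀ hβ hd hpop' hdiff' j,
    fun j hj hjq => ?_⟩
  · exact abs_sortedEigenvalue_gramM_le (fun h u i v j => popLag μ D T h u i v j) _ h₀ D.R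
      (fun h a i v j => ∑ b, ∑ y : Fin k × Fin r,
        D.C i b * ((D.R v y.1 * D.C j y.2) * D.SigmaF μ T h (a, b) y))
      (fun h hh u i v j => hD.popLag_eq_row (Finset.mem_Icc.mp hh).1 u i v j) hdiff hj hjp
  · exact abs_sortedEigenvalue_gramM_le (fun h i u j v => popLag μ D T h u i v j) _ h₀ D.C
      (fun h b u j v => ∑ a, ∑ y : Fin k × Fin r,
        D.R u a * ((D.R v y.1 * D.C j y.2) * D.SigmaF μ T h (a, b) y))
      (fun h hh i u j v => hD.popLag_eq_col (Finset.mem_Icc.mp hh).1 u i v j) hdiff' hj hjq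

end FactorModel

/-! ### The stochastic bound -/

/-- The constant in `FactorModel.IsRegular.exists_small_set`. -/
def errConst (h₀ m : ℕ) (S V V₀ κ c ε : ℝ) : ℝ :=
  6 * h₀ * (h₀ + 1) ^ 2 * (4 * (((1 + c) * S + 1) * (4 / ε)) * ((m * V₀ * S + 1) * (4 / ε)) / κ +
    4 * ((m * V₀ * S + 1) * (4 / ε)) ^ 2 / κ ^ 2) + 2 * ((h₀ * (h₀ + 1) * V * S ^ 2 + 1) * (4 / ε))

theorem errConst_nonneg {h₀ m : ℕ} {S V V₀ κ c ε : ℝ} (hS : 0 ≤ S) (hV : 0 ≤ V) (hV₀ : 0 ≤ V₀)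
    (hκ : 0 < κ) (hc : 0 ≤ c) (hε : 0 < ε) : 0 ≤ errConst h₀ m S V V₀ κ c ε := by
  unfold errConst; positivity

theorem FactorModel.IsRegular.exists_small_set {Ω : Type*} [MeasurableSpace Ω] {p q m k r : ℕ}
    {D : FactorModel Ω p q m k r} {μ : Measure Ω} [IsProbabilityMeasure μ] {T h₀ : ℕ}
    {γ c K : ℝ} (hD : D.IsRegular μ T γ c K) (hT : h₀ < T) (hp : 0 < p) (hq : 0 < q)
    {S κ ε : ℝ} (hS : 0 ≤ S) (hDS : D.totalWeight ≤ S * (p * q)) (hκ : 0 < κ) (hε : 0 < ε)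
    {P : Matrix (Fin m) (Fin m) ℝ} (hP : ∀ x, κ * q * (x ⬝ᵥ x) ≤ x ⬝ᵥ P *ᵥ x)
    (hEP : ∑ a, ∑ b, (((T : ℝ)⁻¹ • ∑ t ∈ Finset.Icc (1 : ℤ) T, D.Pt μ t) a b - P a b) ^ 2 ≤
      (κ * q / 4) ^ 2)
    (hTε : 64 * m ^ 2 * varConst k r 0 c K ≤ ε * κ ^ 2 * T) :
    ∃ B : Set Ω, μ B ≤ ENNReal.ofReal ε ∧ ∀ ω ∉ B, frobSq (fun h u i v j =>
        lagMean (fun t => D.WHat T t ω) T h u i v j - popLag μ D T h u i v j) h₀ ≤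
      errConst h₀ m S (varConst k r h₀ c K) (varConst k r 0 c K) κ ((k * r + 1) * c) ε *
        ((p : ℝ) ^ 2 * (q : ℝ) ^ 2 * (T : ℝ)⁻¹) := by
  have hT0 : 0 < T := by omega
  have hT' : (0 : ℝ) < T := by exact_mod_cast hT0
  have hT1 : (1 : ℝ) ≤ T := by exact_mod_cast hT0
  have hp' : (0 : ℝ) < p := by exact_mod_cast hp
  have hq' : (0 : ℝ) < q := by exact_mod_cast hq
  have hc' : 0 ≤ (k * r + 1) * c := hD.momentConst_nonneg
  have hV := hD.varConst_nonneg h₀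
  have hV₀ := hD.varConst_nonneg 0
  have hW0 := D.totalWeight_nonneg
  set V := varConst k r h₀ c K
  set V₀ := varConst k r 0 c K
  set c' : ℝ := (k * r + 1) * c
  -- Each of these constants is a bound for a mean, multiplied by 4/ε so that Markov's inequality
  -- leaves probability ε/4. The added 1 keeps the thresholds positive.
  set c₁ : ℝ := (h₀ * (h₀ + 1) * V * S ^ 2 + 1) * (4 / ε) with hc₁
  set c₂ : ℝ := (m * V₀ * S + 1) * (4 / ε) with hc₂
  set c₃ : ℝ := ((1 + c') * S + 1) * (4 / ε) with hc₃
  have hc₁0 : 0 < c₁ := by positivity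
  have hc₂0 : 0 < c₂ := by positivity
  have hc₃0 : 0 < c₃ := by positivity
  have hfour : ∀ x y : ℝ, x * (4 / ε) * y * (ε / 4) = x * y := by
    intro x y; field_simp
  have m₁ := (hD.meanLE_frobSq_lagMean_sub hT).measure_lt_le (ε := ε / 4)
    (fun ω => Finset.sum_nonneg fun _ _ => Finset.sum_nonneg fun _ _ => Finset.sum_nonneg
      fun _ _ => Finset.sum_nonneg fun _ _ => Finset.sum_nonneg fun _ _ => sq_nonneg _)
    (a := c₁ * (p ^ 2 * q ^ 2 / T)) (by positivity) (by
      rw [mul_comm (ε / 4), hc₁, hfour]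
      calc _ ≤ h₀ * ((S * (p * q)) ^ 2 * ((h₀ + 1) / T * V)) := by gcongr
        _ = h₀ * (h₀ + 1) * V * S ^ 2 * (p ^ 2 * q ^ 2 / T) := by ring
        _ ≤ _ := by gcongr; linarith)
  have m₂ := (hD.meanLE_sum_sq_crossMean hT0).measure_lt_le (ε := ε / 4)
    (fun ω => Finset.sum_nonneg fun _ _ => Finset.sum_nonneg fun _ _ => sq_nonneg _)
    (a := c₂ * (p * q ^ 2 / T)) (by positivity) (by
      rw [mul_comm (ε / 4), hc₂, hfour]
      calc _ ≤ m * (q / T * V₀ * (S * (p * q))) := by gcongr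
        _ = m * V₀ * S * (p * q ^ 2 / T) := by ring
        _ ≤ _ := by gcongr; linarith)
  have m₃ := hD.meanLE_energy_W.measure_lt_le (ε := ε / 4) (fun ω => energy_nonneg _ _)
    (a := c₃ * (T * p * q)) (by positivity) (by
      rw [mul_comm (ε / 4), hc₃, hfour]
      calc _ ≤ T * ((1 + c') * (S * (p * q))) := by gcongr
        _ = (1 + c') * S * (T * p * q) := by ring
        _ ≤ _ := by gcongr; linarith)
  -- Here the threshold is prescribed by the eigenvalue gap instead of by ε, and the probability
  -- becomes small because T is large, by `hTε`.
  have m₄ := (hD.meanLE_sum_sq_gramMean hT0).measure_lt_le (ε := ε / 4)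
    (fun ω => Finset.sum_nonneg fun _ _ => Finset.sum_nonneg fun _ _ => sq_nonneg _)
    (a := (κ * q / 4) ^ 2) (by positivity) (by
      rw [show (m : ℝ) ^ 2 * (q ^ 2 / T * V₀) = (64 * m ^ 2 * V₀) * (q ^ 2 / (64 * T)) by
          field_simp,
        show ε / 4 * (κ * q / 4) ^ 2 = (ε * κ ^ 2 * T) * (q ^ 2 / (64 * T)) by
          field_simp; ring]
      gcongr)
  refine ⟨_, (measure_union_le _ _).trans ((add_le_add ((measure_union_le _ _).trans
    (add_le_add m₁ m₂)) ((measure_union_le _ _).trans (add_le_add m₃ m₄))).trans ?_),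
    fun ω hω => ?_⟩
  · have h4 : (0 : ℝ) ≤ ε / 4 := by positivity
    rw [← ENNReal.ofReal_add h4 h4, ← ENNReal.ofReal_add (by positivity) (by positivity)]
    exact ENNReal.ofReal_le_ofReal (by linarith)
  simp only [Set.mem_union, Set.mem_ofPred_eq, not_or, not_lt] at hω
  obtain ⟨⟨g₁, g₂⟩, g₃, g₄⟩ := hω
  -- The sample Gram matrix is within κq/4 of its mean, and the mean within κq/4 of P; this leaves
  -- half of the lower bound κq.
  have hHP : ∑ a, ∑ b, (gramMean (fun t => D.X t ω) T a b - P a b) ^ 2 ≤ (κ * q / 2) ^ 2 := by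
    calc _ ≤ ∑ a, ∑ b, (2 * (gramMean (fun t => D.X t ω) T a b -
          ((T : ℝ)⁻¹ • ∑ t ∈ Finset.Icc (1 : ℤ) T, D.Pt μ t) a b) ^ 2 +
          2 * (((T : ℝ)⁻¹ • ∑ t ∈ Finset.Icc (1 : ℤ) T, D.Pt μ t) a b - P a b) ^ 2) := by
          refine Finset.sum_le_sum fun a _ => Finset.sum_le_sum fun b _ => ?_
          generalize gramMean (fun t => D.X t ω) T a b = x
          generalize ((T : ℝ)⁻¹ • ∑ t ∈ Finset.Icc (1 : ℤ) T, D.Pt μ t) a b = y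
          nlinarith [sq_nonneg (x - 2 * y + P a b)]
      _ ≤ 2 * (κ * q / 4) ^ 2 + 2 * (κ * q / 4) ^ 2 := by
          simp only [Finset.sum_add_distrib, ← Finset.mul_sum]
          gcongr
      _ = _ := by ring
  have hH : ∀ x, κ * q / 2 * (x ⬝ᵥ x) ≤ x ⬝ᵥ gramMean (fun t => D.X t ω) T *ᵥ x := by
    intro x
    have h1 := quadratic_sub_ge _ P (by positivity) hHP x
    have h2 := hP x
    linarith
  refine (FactorModel.frobSq_lagMean_WHat_sub_le hT (by positivity) hH g₁ g₂ g₃).trans ?_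
  -- The energy of the regression error has order pq, without any growth in T.
  have hu : (T : ℝ) / (κ * q / 2) * (c₂ * (p * q ^ 2 / T)) = 2 * c₂ / κ * (p * q) := by
    field_simp
  rw [hu]
  -- The term UU has order T⁻², and T ≥ 1 lets it join the terms of order T⁻¹.
  have hTT : ((T : ℝ)⁻¹) ^ 2 ≤ (T : ℝ)⁻¹ := by
    rw [sq]; exact mul_le_of_le_one_left (by positivity) (inv_le_one_of_one_le₀ hT1)
  calc _ = 6 * h₀ * (h₀ + 1) ^ 2 * (4 * c₃ * c₂ / κ * (p ^ 2 * q ^ 2 * (T : ℝ)⁻¹) +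
        4 * c₂ ^ 2 / κ ^ 2 * (p ^ 2 * q ^ 2 * (T : ℝ)⁻¹ ^ 2)) +
          2 * c₁ * (p ^ 2 * q ^ 2 * (T : ℝ)⁻¹) := by field_simp; ring
    _ ≤ 6 * h₀ * (h₀ + 1) ^ 2 * (4 * c₃ * c₂ / κ * (p ^ 2 * q ^ 2 * (T : ℝ)⁻¹) +
        4 * c₂ ^ 2 / κ ^ 2 * (p ^ 2 * q ^ 2 * (T : ℝ)⁻¹)) +
          2 * c₁ * (p ^ 2 * q ^ 2 * (T : ℝ)⁻¹) := by gcongr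
    _ = _ := by rw [errConst]; ring

/-! ### Rates -/

theorem rpow_one_sub_le {x δ : ℝ} (hx : 1 ≤ x) (hδ : 0 ≤ δ) : x ^ (1 - δ) ≤ x := by
  conv_rhs => rw [← Real.rpow_one x]
  exact Real.rpow_le_rpow_of_exponent_le hx (by linarith)

/-- With s = pqT^{-1/2} for the error and b = p^{1-δ₁}q^{1-δ₂} for the population size: sb is the
rate of the leading eigenvalues, s² that of the trailing ones, and s² is the leading rate times the
quantity assumed to vanish. -/
theorem rate_identities {x y t δ₁ δ₂ : ℝ} (hx : 0 < x) (hy : 0 < y) (ht : 0 < t) :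
    (x * y * t ^ (-(1 / 2) : ℝ)) * (x ^ (1 - δ₁) * y ^ (1 - δ₂)) =
      x ^ (2 - δ₁) * y ^ (2 - δ₂) * t ^ (-(1 / 2) : ℝ) ∧
    (x * y * t ^ (-(1 / 2) : ℝ)) ^ 2 = x ^ 2 * y ^ 2 * t⁻¹ ∧
    x ^ 2 * y ^ 2 * t⁻¹ = (x ^ (2 - δ₁) * y ^ (2 - δ₂) * t ^ (-(1 / 2) : ℝ)) *
      (x ^ δ₁ * y ^ δ₂ * t ^ (-(1 / 2) : ℝ)) := by
  have h1 : ∀ z δ : ℝ, 0 < z → z ^ (2 - δ) = z * z ^ (1 - δ) := by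
    intro z δ hz
    rw [show 2 - δ = 1 + (1 - δ) by ring, Real.rpow_add hz, Real.rpow_one]
  have h2 : ∀ z δ : ℝ, 0 < z → z ^ 2 = z ^ (2 - δ) * z ^ δ := by
    intro z δ hz
    rw [← Real.rpow_add hz, sub_add_cancel, Real.rpow_two]
  have h3 : t⁻¹ = t ^ (-(1 / 2) : ℝ) * t ^ (-(1 / 2) : ℝ) := by
    rw [← Real.rpow_add ht, ← Real.rpow_neg_one]; norm_num
  refine ⟨?_, ?_, ?_⟩
  · rw [h1 x δ₁ hx, h1 y δ₂ hy]; ring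
  · rw [h3]; ring
  · rw [h2 x δ₁ hx, h2 y δ₂ hy, h3]; ring

/-- Neither `B` nor the exceptional event has to be measurable, as monotonicity holds for outer
measure. -/
theorem UniformBigOp.of_exists_small_set {Ω : ℕ → Type*} [∀ n, MeasurableSpace (Ω n)]
    {μ : ∀ n, Measure (Ω n)} {J : ℕ → Set ℕ} {ξ : ∀ n, ℕ → Ω n → ℝ} {a : ℕ → ℝ}
    (h : ∀ ε : ℝ, 0 < ε → ∃ c : ℝ, 0 < c ∧ ∀ᶠ n in Filter.atTop, ∃ B : Set (Ω n),
      μ n B ≤ ENNReal.ofReal ε ∧ ∀ ω ∉ B, ∀ j ∈ J n, |ξ n j ω| ≤ c * a n) :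
    UniformBigOp μ J ξ a := by
  intro ε hε
  obtain ⟨c, hc, hn⟩ := h ε hε
  refine ⟨c, hc, hn.mono ?_⟩
  rintro n ⟨B, hB, hω⟩
  refine (measure_mono ?_).trans hB
  rintro ω ⟨j, hj, hlt⟩
  by_contra hωB
  exact absurd (hω ω hωB j hj) (not_le.mpr hlt)

/-! ### Uniform constants from the asymptotic conditions -/

section Extraction

variable {Ω : ℕ → Type*} {p q : ℕ → ℕ} {m k r : ℕ}
  {D : ∀ n, FactorModel (Ω n) (p n) (q n) m k r}

theorem LoadingCond.exists_bound {δ₁ δ₂ : ℝ} (h : LoadingCond D δ₁ δ₂) :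
    ∃ L : ℝ, 0 ≤ L ∧ ∀ᶠ n in Filter.atTop,
      (∑ u, (D n).rowWeight u ^ 2) * ∑ i, (D n).colWeight i ^ 2 ≤
        L * ((p n : ℝ) ^ (1 - δ₁) * (q n : ℝ) ^ (1 - δ₂)) := by
  obtain ⟨c₁, hc₁, h₁⟩ := h.1.isBigO.exists_pos
  obtain ⟨c₂, hc₂, h₂⟩ := h.2.2.1.isBigO.exists_pos
  refine ⟨(k ^ 2 * c₁) * (r ^ 2 * c₂), by positivity, ?_⟩
  filter_upwards [h₁.bound, h₂.bound] with n hR hC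
  rw [Real.norm_of_nonneg (sq_nonneg _), Real.norm_of_nonneg (by positivity)] at hR hC
  calc _ ≤ (k ^ 2 * (c₁ * (p n : ℝ) ^ (1 - δ₁))) * (r ^ 2 * (c₂ * (q n : ℝ) ^ (1 - δ₂))) := by
        refine mul_le_mul ((sum_sq_sum_abs_le (D n).R).trans ?_)
          ((sum_sq_sum_abs_le (D n).C).trans ?_) (Finset.sum_nonneg fun _ _ => sq_nonneg _)
          (by positivity) <;> gcongr
    _ = _ := by ring

variable [∀ n, MeasurableSpace (Ω n)] {μ : ∀ n, Measure (Ω n)} {T : ℕ → ℕ}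

theorem RegressorCond.exists_bound (hq : Filter.Tendsto q Filter.atTop Filter.atTop)
    (h : RegressorCond μ T D) :
    ∃ κ : ℝ, 0 < κ ∧ ∃ P : ℕ → Matrix (Fin m) (Fin m) ℝ, ∀ᶠ n in Filter.atTop,
      (∀ x, κ * q n * (x ⬝ᵥ x) ≤ x ⬝ᵥ P n *ᵥ x) ∧
      ∑ a, ∑ b, (((T n : ℝ)⁻¹ • ∑ t ∈ Finset.Icc (1 : ℤ) (T n), (D n).Pt (μ n) t) a b -
        P n a b) ^ 2 ≤ (κ * q n / 4) ^ 2 := by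
  obtain ⟨-, P, hP, hconv, hΘ⟩ := h
  obtain ⟨c, hc, hbd⟩ := hΘ.isBigO_symm.exists_pos
  refine ⟨c⁻¹, by positivity, P, ?_⟩
  -- If each of the m² entries is at most eq, the Frobenius norm is at most m·eq ≤ κq/4 with κ =
  -- c⁻¹; using m + 1 avoids dividing by zero.
  set e : ℝ := c⁻¹ / (4 * (m + 1)) with he
  have he0 : 0 < e := by positivity
  have hsmall : ∀ a b, ∀ᶠ n in Filter.atTop, |(q n : ℝ)⁻¹ * (((T n : ℝ)⁻¹ •
      ∑ t ∈ Finset.Icc (1 : ℤ) (T n), (D n).Pt (μ n) t) a b - P n a b)| < e := by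
    intro a b
    have := (hconv a b).abs
    rw [abs_zero] at this
    exact this.eventually_lt_const he0
  filter_upwards [hbd.bound, hq.eventually_gt_atTop 0,
    Filter.eventually_all.mpr fun a => Filter.eventually_all.mpr (hsmall a)] with n hn hqn hs
  have hqn' : (0 : ℝ) < q n := by exact_mod_cast hqn
  have hherm : (P n).IsHermitian := (hP n).isHermitian
  have hnn : ∀ x, 0 ≤ x ⬝ᵥ P n *ᵥ x := fun x => by
    simpa using (hP n).posSemidef.dotProduct_mulVec_nonneg x
  constructor
  · intro x
    refine le_trans ?_ (sortedEigenvalue_last_mul_le hherm x)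
    refine mul_le_mul_of_nonneg_right ?_ (dotProduct_self_nonneg_real x)
    rw [Real.norm_of_nonneg hqn'.le,
      Real.norm_of_nonneg (sortedEigenvalue_nonneg hherm hnn _)] at hn
    rw [inv_mul_le_iff₀ hc]
    exact hn
  · have hentry : ∀ a b, (((T n : ℝ)⁻¹ • ∑ t ∈ Finset.Icc (1 : ℤ) (T n),
        (D n).Pt (μ n) t) a b - P n a b) ^ 2 ≤ (e * q n) ^ 2 := by
      intro a b
      rw [← sq_abs]
      refine pow_le_pow_left₀ (abs_nonneg _) ?_ 2
      have := (hs a b).le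
      rw [abs_mul, abs_of_pos (inv_pos.mpr hqn'), inv_mul_le_iff₀ hqn'] at this
      linarith
    calc _ ≤ ∑ _a : Fin m, ∑ _b : Fin m, (e * q n) ^ 2 :=
          Finset.sum_le_sum fun a _ => Finset.sum_le_sum fun b _ => hentry a b
      _ = (m * (e * q n)) ^ 2 := by simp; ring
      _ ≤ ((m + 1) * (e * q n)) ^ 2 := by gcongr; linarith
      _ = _ := by rw [he]; field_simp

theorem exists_isRegular {γ : ℝ} [∀ n, IsProbabilityMeasure (μ n)]
    (hmeas : ∀ n, (D n).Measurability) (hnoise : ∀ n, (D n).WhiteNoise (μ n) (T n))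
    (huncorr : ∀ n, (D n).Uncorrelated (μ n) (T n)) (hγ : 2 < γ) (hmixing : MixingCond μ D γ)
    (hmoment : MomentCond μ T D γ) :
    ∃ c K, ∀ n, (D n).IsRegular (μ n) (T n) γ c K := by
  obtain ⟨c, hc⟩ := hmoment
  obtain ⟨K, hK⟩ := hmixing
  refine ⟨max c 0, K, fun n => ⟨hmeas n, hnoise n, huncorr n, hγ, le_max_right _ _,
    fun t ht => ?_, (hK n).1, (hK n).2⟩⟩
  obtain ⟨h1, h2, h3⟩ := hc n t ht
  have hmono : ∀ ξ : Ω n → ℝ, MomentLE (μ n) ξ (2 * γ) c →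
      MeanLE (μ n) (fun ω => |ξ ω| ^ (2 * γ)) (max c 0) :=
    fun ξ h => ⟨h.1, h.2.trans (le_max_left _ _)⟩
  exact ⟨fun i j => hmono _ (h1 i j), fun l g => hmono _ (h2 l g), fun u g => hmono _ (h3 u g)⟩

end Extraction

/-- Outside a set of small probability all eigenvalue bounds hold simultaneously. -/
theorem exists_small_set_eigenvalues {Ω : ℕ → Type*} [∀ n, MeasurableSpace (Ω n)]
    (μ : ∀ n, Measure (Ω n)) [∀ n, IsProbabilityMeasure (μ n)]
    {m k r h₀ : ℕ} {p q T : ℕ → ℕ}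
    (hp : Filter.Tendsto p Filter.atTop Filter.atTop)
    (hq : Filter.Tendsto q Filter.atTop Filter.atTop)
    (hT : Filter.Tendsto T Filter.atTop Filter.atTop) (hTh : ∀ n, h₀ < T n)
    {D : ∀ n, FactorModel (Ω n) (p n) (q n) m k r} {γ c K δ₁ δ₂ : ℝ}
    (hD : ∀ n, (D n).IsRegular (μ n) (T n) γ c K)
    (hδ₁ : 0 ≤ δ₁) (hδ₂ : 0 ≤ δ₂)
    (hregressor : RegressorCond μ T D) (hloading : LoadingCond D δ₁ δ₂)
    (hrate : Filter.Tendsto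
      (fun n => (p n : ℝ) ^ δ₁ * (q n : ℝ) ^ δ₂ * (T n : ℝ) ^ (-(1 / 2) : ℝ))
      Filter.atTop (nhds 0)) (ε : ℝ) (hε : 0 < ε) :
    ∃ C : ℝ, 0 < C ∧ ∀ᶠ n in Filter.atTop, ∃ B : Set (Ω n), μ n B ≤ ENNReal.ofReal ε ∧
      ∀ ω ∉ B,
      (∀ j, |sortedEigenvalue ((D n).MHat₁ (T n) h₀ ω) j -
        sortedEigenvalue ((D n).M₁ (μ n) (T n) h₀) j| ≤
        C * ((p n : ℝ) ^ (2 - δ₁) * (q n : ℝ) ^ (2 - δ₂) * (T n : ℝ) ^ (-(1 / 2) : ℝ))) ∧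
      (∀ j, k ≤ j → j < p n → |sortedEigenvalue ((D n).MHat₁ (T n) h₀ ω) j| ≤
        C * ((p n : ℝ) ^ 2 * (q n : ℝ) ^ 2 * (T n : ℝ)⁻¹)) ∧
      (∀ j, |sortedEigenvalue ((D n).MHat₂ (T n) h₀ ω) j -
        sortedEigenvalue ((D n).M₂ (μ n) (T n) h₀) j| ≤
        C * ((p n : ℝ) ^ (2 - δ₁) * (q n : ℝ) ^ (2 - δ₂) * (T n : ℝ) ^ (-(1 / 2) : ℝ))) ∧
      (∀ j, r ≤ j → j < q n → |sortedEigenvalue ((D n).MHat₂ (T n) h₀ ω) j| ≤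
        C * ((p n : ℝ) ^ 2 * (q n : ℝ) ^ 2 * (T n : ℝ)⁻¹)) := by
  obtain ⟨L, hL, hload⟩ := hloading.exists_bound
  obtain ⟨κ, hκ, P, hreg⟩ := hregressor.exists_bound hq
  have hc : 0 ≤ c := (hD 0).nonneg
  have hcov := covConst_nonneg hc
  set S : ℝ := 2 * (1 + L) with hS
  have hS0 : 0 ≤ S := by positivity
  set e : ℝ := errConst h₀ m S (varConst k r h₀ c K) (varConst k r 0 c K) κ
    ((k * r + 1) * c) ε with he
  have he0 : 0 ≤ e := errConst_nonneg hS0 ((hD 0).varConst_nonneg h₀)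
    ((hD 0).varConst_nonneg 0) hκ (hD 0).momentConst_nonneg hε
  set β₀ : ℝ := h₀ * (covConst c * L) with hβ₀
  have hβ₀0 : 0 ≤ β₀ := by positivity
  have hTlim : Filter.Tendsto (fun n => (T n : ℝ)) Filter.atTop Filter.atTop :=
    tendsto_natCast_atTop_atTop.comp hT
  -- Inserting d = √e·s and β = β₀·b in d(2β + d) gives 2√e·β₀·sb + e·s²; the added 1 makes the
  -- constant positive.
  refine ⟨2 * √e * β₀ + e + 1, by positivity, ?_⟩
  filter_upwards [hload, hreg, hp.eventually_gt_atTop 0, hq.eventually_gt_atTop 0,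
    hrate.eventually_le_const one_pos,
    hTlim.eventually_ge_atTop (64 * m ^ 2 * varConst k r 0 c K / (ε * κ ^ 2))]
    with n hLn hPn hpn hqn hraten hTn
  have hp1 : (1 : ℝ) ≤ p n := by exact_mod_cast hpn
  have hq1 : (1 : ℝ) ≤ q n := by exact_mod_cast hqn
  have hp0 : (0 : ℝ) < p n := by linarith
  have hq0 : (0 : ℝ) < q n := by linarith
  have hT0 : (0 : ℝ) < T n := by exact_mod_cast (Nat.zero_le h₀).trans_lt (hTh n)
  obtain ⟨i1, i2, i3⟩ := rate_identities (δ₁ := δ₁) (δ₂ := δ₂) hp0 hq0 hT0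
  set ρ : ℝ := (p n : ℝ) ^ (2 - δ₁) * (q n : ℝ) ^ (2 - δ₂) * (T n : ℝ) ^ (-(1 / 2) : ℝ)
  set b : ℝ := (p n : ℝ) ^ (1 - δ₁) * (q n : ℝ) ^ (1 - δ₂) with hb
  set s : ℝ := p n * q n * (T n : ℝ) ^ (-(1 / 2) : ℝ) with hs
  have hb0 : 0 ≤ b := by positivity
  have hs0 : 0 ≤ s := by positivity
  have hρ0 : 0 ≤ ρ := by positivity
  have hbpq : b ≤ p n * q n := mul_le_mul (rpow_one_sub_le hp1 hδ₁) (rpow_one_sub_le hq1 hδ₂)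
    (by positivity) hp0.le
  have hDS : (D n).totalWeight ≤ S * (p n * q n) := by
    refine FactorModel.totalWeight_le.trans ?_
    have := hLn.trans (mul_le_mul_of_nonneg_left hbpq hL)
    rw [hS]; linarith
  have hTε : 64 * m ^ 2 * varConst k r 0 c K ≤ ε * κ ^ 2 * T n := by
    rw [div_le_iff₀ (by positivity)] at hTn; linarith
  obtain ⟨B, hB, hBω⟩ := (hD n).exists_small_set (hTh n) hpn hqn hS0 hDS hκ hε hPn.1 hPn.2 hTε
  refine ⟨B, hB, fun ω hω => ?_⟩
  have hdiff := hBω ω hω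
  rw [← he, ← i2, ← Real.sq_sqrt he0, ← mul_pow] at hdiff
  have hpop : frobSq (fun h u i v j => FactorModel.popLag (μ n) (D n) (T n) h u i v j) h₀ ≤
      (β₀ * b) ^ 2 := by
    refine ((hD n).frobSq_popLag_le (hTh n)).trans ?_
    -- Replacing h₀ by its square makes the bound a perfect square without a root of h₀ in β₀.
    have hh : (h₀ : ℝ) ≤ (h₀ : ℝ) ^ 2 := by exact_mod_cast Nat.le_self_pow two_ne_zero h₀
    calc _ ≤ (h₀ : ℝ) ^ 2 * (covConst c * (L * b)) ^ 2 := by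
          refine mul_le_mul hh ?_ (sq_nonneg _) (sq_nonneg _)
          refine pow_le_pow_left₀ (mul_nonneg hcov (mul_nonneg
            (Finset.sum_nonneg fun _ _ => sq_nonneg _)
            (Finset.sum_nonneg fun _ _ => sq_nonneg _))) ?_ 2
          exact mul_le_mul_of_nonneg_left hLn hcov
      _ = _ := by rw [hβ₀]; ring
  obtain ⟨h1, h2, h3, h4⟩ := (hD n).eigenvalues_le (mul_nonneg hβ₀0 hb0)
    (mul_nonneg (Real.sqrt_nonneg e) hs0) hpop hdiff
  -- The rate condition enters here: it makes the quadratic part of the perturbation no larger than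
  -- the linear rate.
  have hρle : s ^ 2 ≤ ρ := by
    rw [i2, i3]; exact mul_le_of_le_one_right hρ0 hraten
  have hlarge : √e * s * (2 * (β₀ * b) + √e * s) ≤ (2 * √e * β₀ + e + 1) * ρ := by
    calc _ = 2 * √e * β₀ * (s * b) + √e ^ 2 * s ^ 2 := by ring
      _ ≤ 2 * √e * β₀ * ρ + e * ρ := by rw [i1, Real.sq_sqrt he0]; gcongr
      _ ≤ _ := by linarith
  have hsmall : (√e * s) ^ 2 ≤ (2 * √e * β₀ + e + 1) *
      ((p n : ℝ) ^ 2 * (q n : ℝ) ^ 2 * (T n : ℝ)⁻¹) := by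
    rw [mul_pow, Real.sq_sqrt he0, i2]
    refine mul_le_mul_of_nonneg_right ?_ (by positivity)
    have : 0 ≤ 2 * √e * β₀ := by positivity
    linarith
  exact ⟨fun j => (h1 j).trans hlarge, fun j hj hj' => (h2 j hj hj').trans hsmall,
    fun j => (h3 j).trans hlarge, fun j hj hj' => (h4 j hj hj').trans hsmall⟩

end

/-! ### Conclusion -/

theorem theorem3 {Ω : ℕ → Type*} [∀ n, MeasurableSpace (Ω n)]
    (μ : ∀ n, MeasureTheory.Measure (Ω n)) [∀ n, MeasureTheory.IsProbabilityMeasure (μ n)]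
    (m k r h₀ : ℕ) (p q T : ℕ → ℕ)
    (hp : Filter.Tendsto p Filter.atTop Filter.atTop)
    (hq : Filter.Tendsto q Filter.atTop Filter.atTop)
    (hT : Filter.Tendsto T Filter.atTop Filter.atTop) (hTh : ∀ n, h₀ < T n)
    (D : ∀ n, FactorModel (Ω n) (p n) (q n) m k r)
    (hmeas : ∀ n, (D n).Measurability)
    (hnoise : ∀ n, (D n).WhiteNoise (μ n) (T n))
    (huncorr : ∀ n, (D n).Uncorrelated (μ n) (T n))
    (γ : ℝ) (hγ : 2 < γ) (δ₁ δ₂ : ℝ) (hδ₁ : δ₁ ∈ Set.Icc (0 : ℝ) 1)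
    (hδ₂ : δ₂ ∈ Set.Icc (0 : ℝ) 1)
    (hmixing : MixingCond μ D γ)
    (hmoment : MomentCond μ T D γ)
    (hfactor : FactorAutocovCond μ T D h₀)
    (hregressor : RegressorCond μ T D)
    (hnoiseCov : NoiseCovCond μ T D)
    (hloading : LoadingCond D δ₁ δ₂)
    (hdistinct : DistinctEigCond μ T D h₀)
    (hrate : Filter.Tendsto
      (fun n => (p n : ℝ) ^ δ₁ * (q n : ℝ) ^ δ₂ * (T n : ℝ) ^ (-(1 / 2) : ℝ))
      Filter.atTop (nhds 0)) :
    UniformBigOp μ (fun _ => {j | j < k})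
      (fun n j ω => sortedEigenvalue ((D n).MHat₁ (T n) h₀ ω) j -
        sortedEigenvalue ((D n).M₁ (μ n) (T n) h₀) j)
      (fun n => (p n : ℝ) ^ (2 - δ₁) * (q n : ℝ) ^ (2 - δ₂) * (T n : ℝ) ^ (-(1 / 2) : ℝ)) ∧
    UniformBigOp μ (fun n => {j | k ≤ j ∧ j < p n})
      (fun n j ω => sortedEigenvalue ((D n).MHat₁ (T n) h₀ ω) j)
      (fun n => (p n : ℝ) ^ 2 * (q n : ℝ) ^ 2 * (T n : ℝ)⁻¹) ∧
    UniformBigOp μ (fun _ => {j | j < r})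
      (fun n j ω => sortedEigenvalue ((D n).MHat₂ (T n) h₀ ω) j -
        sortedEigenvalue ((D n).M₂ (μ n) (T n) h₀) j)
      (fun n => (p n : ℝ) ^ (2 - δ₁) * (q n : ℝ) ^ (2 - δ₂) * (T n : ℝ) ^ (-(1 / 2) : ℝ)) ∧
    UniformBigOp μ (fun n => {j | r ≤ j ∧ j < q n})
      (fun n j ω => sortedEigenvalue ((D n).MHat₂ (T n) h₀ ω) j)
      (fun n => (p n : ℝ) ^ 2 * (q n : ℝ) ^ 2 * (T n : ℝ)⁻¹) := by
  obtain ⟨c, K, hD⟩ := exists_isRegular hmeas hnoise huncorr hγ hmixing hmoment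
  -- For each ε the exceptional set does not depend on `j`, which is what makes the four bounds
  -- uniform.
  have key := exists_small_set_eigenvalues μ hp hq hT hTh hD hδ₁.1 hδ₂.1 hregressor hloading hrate
  refine ⟨UniformBigOp.of_exists_small_set fun ε hε => ?_,
    UniformBigOp.of_exists_small_set fun ε hε => ?_,
    UniformBigOp.of_exists_small_set fun ε hε => ?_,
    UniformBigOp.of_exists_small_set fun ε hε => ?_⟩ <;>
  obtain ⟨C, hC, hn⟩ := key ε hε <;>
  refine ⟨C, hC, hn.mono fun n ⟨B, hB, hω⟩ => ⟨B, hB, fun ω hωB j hj => ?_⟩⟩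
  · exact (hω ω hωB).1 j
  · exact (hω ω hωB).2.1 j hj.1 hj.2
  · exact (hω ω hωB).2.2.1 j
  · exact (hω ω hωB).2.2.2 j hj.1 hj.2
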